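/- Let $S\subset\mathbb{R}^2$ be a finite set of points in general position, i.e., no three distinct points of $S$ are collinear. A point of a finite set $A\subset\mathbb{R}^2$ is called outer in $A$ if it lies on the boundary of the convex hull of $A$. The convex layers of $S$ are defined by letting $L_0$ be the set of outer points of $S$ and, for $i\ge 1$, letting $L_i$ be the set of outer points of $S\setminus\bigcup_{k<i}L_k$; the layer number $L(S)$ is the number of non-empty layers $L_i$. A plane spanning path on $S$ is an (undirected) path that visits each point of $S$ exactly once, whose edges are drawn as straight-line segments, and in which no two distinct edges intersect except at a common endpoint; two such paths are the same if they have the same edges. Let $\mathcal{P}(S)$ be the set of all plane spanning paths on $S$. A flip on $P\in\mathcal{P}(S)$ replaces one edge $e$ of $P$ by another edge $f$ between two points of $S$ such that the result $P'$ again belongs to $\mathcal{P}(S)$ and $P'\neq P$. The flip graph of $\mathcal{P}(S)$ has vertex set $\mathcal{P}(S)$, two paths being adjacent if one can be transformed into the other by a single flip. **Theorem.** If $L(S)\le 2$, then the flip graph of $\mathcal{P}(S)$ is connected. -/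

import Mathlib

namespace PlanePaths

/-- The Euclidean plane. -/
abbrev Plane : Type := EuclideanSpace ℝ (Fin 2)

/-- No three (distinct) points of `S` are collinear. -/
def GeneralPosition (S : Finset Plane) : Prop :=
  ∀ a ∈ S, ∀ b ∈ S, ∀ c ∈ S, a ≠ b → b ≠ c → a ≠ c →
    ¬ Collinear ℝ ({a, b, c} : Set Plane)

/-- The outer points of `A`: those on the boundary of the convex hull of `A`. -/
def outer (A : Set Plane) : Set Plane :=
  A ∩ frontier (convexHull ℝ A)

/-- What is left of `A` after removing its first `i` convex layers. -/
def remaining (A : Set Plane) : ℕ → Set Plane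
  | 0 => A
  | i + 1 => remaining A i \ outer (remaining A i)

/-- The `i`-th convex layer of `A`: the points that are outer in what is left of `A` after
removing the layers `0, …, i - 1` (see `layer_eq`). -/
def layer (A : Set Plane) (i : ℕ) : Set Plane :=
  outer (remaining A i)

theorem layer_eq (A : Set Plane) (i : ℕ) :
    layer A i = outer (A \ ⋃ k < i, layer A k) := by
  have h : remaining A i = A \ ⋃ k < i, layer A k := by
    induction i with
    | zero => simp [remaining]
    | succ i ih =>
      rw [Set.biUnion_lt_succ, ← Set.sdiff_sdiff, ← ih]
      rfl
  rw [← h]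
  rfl

/-- The layer number of `A`: the number of its non-empty convex layers. -/
noncomputable def layerNumber (A : Set Plane) : ℕ∞ :=
  {i : ℕ | (layer A i).Nonempty}.encard

/-- A graph on `S`, drawn with straight-line segments, is plane: two distinct edges do not
intersect except at a common endpoint. -/
def IsPlane {S : Finset Plane} (G : SimpleGraph S) : Prop :=
  ∀ a b c d : S, G.Adj a b → G.Adj c d → s(a, b) ≠ s(c, d) →
    ∀ x ∈ segment ℝ (a : Plane) (b : Plane) ∩ segment ℝ (c : Plane) (d : Plane),
      (x = a ∨ x = b) ∧ (x = c ∨ x = d)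

/-- `G` is a path that visits each point of `S` exactly once. -/
def IsSpanningPath {S : Finset Plane} (G : SimpleGraph S) : Prop :=
  Nonempty (SimpleGraph.pathGraph S.card ≃g G)

/-- The set of all plane spanning paths on `S`. Paths are undirected, and identified with their
sets of edges. -/
def planeSpanningPaths (S : Finset Plane) : Set (SimpleGraph S) :=
  {G | IsSpanningPath G ∧ IsPlane G}

/-- `P'` arises from `P` by replacing an edge `e` of `P` with a new edge `f`. -/
def IsFlip {S : Finset Plane} (P P' : SimpleGraph S) : Prop :=
  ∃ e ∈ P.edgeSet, ∃ f ∉ P.edgeSet, P'.edgeSet = insert f (P.edgeSet \ {e})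

theorem IsFlip.symm {S : Finset Plane} {P P' : SimpleGraph S} (h : IsFlip P P') :
    IsFlip P' P := by
  obtain ⟨e, he, f, hf, h⟩ := h
  have hef : e ≠ f := fun h' => hf (h' ▸ he)
  refine ⟨f, by simp [h], e, by simp [h, hef], ?_⟩
  rw [h, Set.insert_sdiff_of_mem _ (Set.mem_singleton f),
    Set.sdiff_singleton_eq_self (fun h' => hf h'.1), Set.insert_sdiff_singleton,
    Set.insert_eq_of_mem he]

theorem IsFlip.irrefl {S : Finset Plane} (P : SimpleGraph S) : ¬ IsFlip P P := by
  rintro ⟨e, -, f, hf, h⟩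
  exact hf (h ▸ Set.mem_insert f _)

/-- The flip graph of the set of all plane spanning paths on `S`. -/
def flipGraph (S : Finset Plane) : SimpleGraph (planeSpanningPaths S) where
  Adj P P' := IsFlip (P : SimpleGraph S) (P' : SimpleGraph S)
  symm := ⟨fun _ _ h => h.symm⟩
  loopless := ⟨fun P h => IsFlip.irrefl (P : SimpleGraph S) h⟩

end PlanePaths

/-! Call a point inner if it lies in the convex hull of the other points. With at most two layers
the inner points are in convex position, a property that passes to subsets, so induction on the
number of points is available.

Paths are lists of points. The basic flip reverses a suffix: only the edge entering the suffix
changes, and the start stays fixed. The core is `rooted`: two plane spanning paths with the same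
extreme start s are connected by such flips. If a path begins with a hull edge sq, then q is extreme
once s is deleted, nothing crosses sq, and by induction the rest can be rearranged freely. For paths
beginning with different hull edges sq and sq', let the rest run from q to q' and reverse it. It
remains to make the first edge a hull edge (`reach_hull_head`).

If the second vertex is extreme, the first edge already is a hull edge. If the path ends in an
extreme point t, take a hull edge tw other than the last edge of the path, let w' be the successor
of w, add tw and remove ww'. For w = s the path then starts with a hull edge, unless ww' already was
one. For w ≠ s, `hull_parity` says that ww' is no hull edge, since otherwise the piece from w' to t
would cut w off from s. So the number of hull edges grows, which cannot go on forever (`hull_step`).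

The hard case is a path that ends with a run E of inner points after its last extreme point k, while
an inner point also occurs earlier (`inner_end`). By convex position no edge outside the run crosses
any segment between points of E (`clear_segs`), so by induction the run can be reordered at will
after its first point e. The aim is to insert some f in E at an edge ab before the run that is not a
hull edge. Put f last and replace ab by af, so that the path ends in b. If b is extreme, this is the
goal; if b is inner and visible from f, a second flip joins f to b, and the run is shorter.

That such an f exists is `Conf.exists_good`. Look from f at an inner vertex c before the run and
turn the sightline along the first edge it meets, towards an extreme end x of that edge (a `Wall`).
If no other inner point is swept, f sees x. Otherwise the first inner point z swept is visible: if z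
lies before the run, its edges form a new wall with fewer inner points beyond it; if z lies in E,
then z sees what it needs and can be inserted itself. The exception z = e, which has to stay first
in the run, is handled by making another point of E first.

Finally, reading paths backwards brings an extreme point to the front, and a path between two
extreme points, read both ways, links the two starts. -/

namespace PlanePaths

/-! ### Signed areas, triangles and separation -/

/-- The signed area form, rescaled by `σ` so that either orientation can be taken as positive. -/
def D (σ : ℝ) (a b c : Plane) : ℝ :=
  σ * ((b 0 - a 0) * (c 1 - a 1) - (b 1 - a 1) * (c 0 - a 0))

theorem D_rot (σ : ℝ) (a b c : Plane) : D σ a b c = D σ b c a := by unfold D; ring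

theorem D_swap (σ : ℝ) (a b c : Plane) : D σ a b c = -D σ a c b := by unfold D; ring

theorem D_swap' (σ : ℝ) (a b c : Plane) : D σ a b c = -D σ b a c := by unfold D; ring

theorem D_neg (σ : ℝ) (a b c : Plane) : D (-σ) a b c = -D σ a b c := by unfold D; ring

theorem D_scale (σ : ℝ) (a b c : Plane) : D σ a b c = σ * D 1 a b c := by unfold D; ring

@[simp] theorem D_self_left (σ : ℝ) (a b : Plane) : D σ a a b = 0 := by unfold D; ring

@[simp] theorem D_self_right (σ : ℝ) (a b : Plane) : D σ a b b = 0 := by unfold D; ring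

@[simp] theorem D_self_outer (σ : ℝ) (a b : Plane) : D σ a b a = 0 := by unfold D; ring

theorem D_add (σ : ℝ) (a b c z : Plane) :
    D σ a b z + D σ b c z + D σ c a z = D σ a b c := by unfold D; ring

/-- The three-term Grassmann–Plücker relation. -/
theorem D_plucker (σ : ℝ) (a b c d e : Plane) :
    D σ a b c * D σ a d e - D σ a b d * D σ a c e + D σ a b e * D σ a c d = 0 := by
  unfold D; ring

theorem D_comb₂ (σ : ℝ) {s t : ℝ} (h : s + t = 1) (a b p q : Plane) :
    D σ p q (s • a + t • b) = s * D σ p q a + t * D σ p q b := by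
  obtain rfl : t = 1 - s := by linarith
  simp [D]; ring

theorem D_comb₃ (σ : ℝ) {s t u : ℝ} (h : s + t + u = 1) (a b c p q : Plane) :
    D σ p q (s • a + t • b + u • c) = s * D σ p q a + t * D σ p q b + u * D σ p q c := by
  obtain rfl : u = 1 - s - t := by linarith
  simp [D]; ring

theorem bary (σ : ℝ) {a b c : Plane} (h : D σ a b c ≠ 0) (z : Plane) :
    z = (D σ b c z / D σ a b c) • a + (D σ c a z / D σ a b c) • b +
      (D σ a b z / D σ a b c) • c := by
  ext i
  have key : ∀ i : Fin 2, D σ a b c * z i =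
      D σ b c z * a i + D σ c a z * b i + D σ a b z * c i := by
    intro i
    fin_cases i <;> simp [D] <;> ring
  simp only [PiLp.add_apply, PiLp.smul_apply, smul_eq_mul]
  field_simp
  linarith [key i]

/-- The closed triangle with the given vertices. -/
def Tri (a b c : Plane) : Set Plane := convexHull ℝ {a, b, c}

theorem mem_Tri {a b c z : Plane} : z ∈ Tri a b c ↔
    ∃ s t u : ℝ, 0 ≤ s ∧ 0 ≤ t ∧ 0 ≤ u ∧ s + t + u = 1 ∧ z = s • a + t • b + u • c := by
  rw [Tri, convexHull_insert (by simp), convexHull_pair]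
  constructor
  · intro h
    simp only [convexJoin_singleton_left, Set.mem_iUnion] at h
    obtain ⟨y, ⟨p, q, hp, hq, hpq, rfl⟩, ⟨s, t, hs, ht, hst, rfl⟩⟩ := h
    refine ⟨s, t * p, t * q, hs, by positivity, by positivity, ?_, ?_⟩
    · rw [add_assoc, ← mul_add, hpq, mul_one, hst]
    · rw [smul_add, smul_smul, smul_smul, add_assoc]
  · rintro ⟨s, t, u, hs, ht, hu, h, rfl⟩
    simp only [convexJoin_singleton_left, Set.mem_iUnion]
    rcases eq_or_lt_of_le (add_nonneg ht hu) with h0 | h0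
    · have : t = 0 := by linarith
      have : u = 0 := by linarith
      subst t u
      obtain rfl : s = 1 := by linarith
      exact ⟨b, left_mem_segment _ _ _, 1, 0, by simp, le_rfl, by simp, by simp⟩
    · refine ⟨(t / (t + u)) • b + (u / (t + u)) • c,
        ⟨_, _, by positivity, by positivity, by field_simp, rfl⟩, s, t + u, hs, h0.le,
        by linarith, ?_⟩
      rw [smul_add, smul_smul, smul_smul, mul_div_cancel₀ _ h0.ne', mul_div_cancel₀ _ h0.ne',
        add_assoc]

theorem Tri_subset {a b c : Plane} {K : Set Plane} (hK : Convex ℝ K) (ha : a ∈ K) (hb : b ∈ K)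
    (hc : c ∈ K) : Tri a b c ⊆ K :=
  convexHull_min (by rintro x (rfl | rfl | rfl) <;> assumption) hK

theorem convex_Tri (a b c : Plane) : Convex ℝ (Tri a b c) := convex_convexHull _ _

theorem Tri_left (a b c : Plane) : a ∈ Tri a b c := subset_convexHull _ _ (by simp)

theorem Tri_mid (a b c : Plane) : b ∈ Tri a b c := subset_convexHull _ _ (by simp)

theorem Tri_right (a b c : Plane) : c ∈ Tri a b c := subset_convexHull _ _ (by simp)

theorem Tri_comm₁ (a b c : Plane) : Tri a b c = Tri b a c := by
  rw [Tri, Tri, Set.insert_comm]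

theorem Tri_comm₂ (a b c : Plane) : Tri a b c = Tri a c b := by
  rw [Tri, Tri, Set.pair_comm]

theorem mem_Tri_of_D {σ : ℝ} {a b c z : Plane} (h : 0 < D σ a b c) (h₁ : 0 ≤ D σ a b z)
    (h₂ : 0 ≤ D σ b c z) (h₃ : 0 ≤ D σ c a z) : z ∈ Tri a b c := by
  refine mem_Tri.2 ⟨_, _, _, ?_, ?_, ?_, ?_, bary σ h.ne' z⟩
  · positivity
  · positivity
  · positivity
  · field_simp
    linarith [D_add σ a b c z]

theorem D_of_mem_Tri {σ : ℝ} {a b c z : Plane} (h : 0 ≤ D σ a b c) (hz : z ∈ Tri a b c) :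
    0 ≤ D σ a b z ∧ 0 ≤ D σ b c z ∧ 0 ≤ D σ c a z := by
  obtain ⟨s, t, u, hs, ht, hu, hsum, rfl⟩ := mem_Tri.1 hz
  simp only [D_comb₃ σ hsum]
  have e₁ : D σ b c a = D σ a b c := (D_rot ..).symm
  have e₂ : D σ c a b = D σ a b c := D_rot ..
  simp only [D_self_outer, D_self_right, e₁, e₂, mul_zero, add_zero, zero_add]
  exact ⟨by positivity, by positivity, by positivity⟩

theorem D_of_mem_segment {σ : ℝ} {a b q : Plane} (h : q ∈ segment ℝ a b) : D σ a b q = 0 := by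
  obtain ⟨s, t, -, -, hst, rfl⟩ := h
  simp [D_comb₂ σ hst]

theorem D_nonneg_of_mem_segment {σ : ℝ} {p q u v z : Plane} (hu : 0 ≤ D σ p q u)
    (hv : 0 ≤ D σ p q v) (hz : z ∈ segment ℝ u v) : 0 ≤ D σ p q z := by
  obtain ⟨s, t, hs, ht, hst, rfl⟩ := hz
  rw [D_comb₂ σ hst]; positivity

theorem D_pos_of_mem_segment {σ : ℝ} {p q u v z : Plane} (hu : 0 < D σ p q u)
    (hv : 0 ≤ D σ p q v) (hz : z ∈ segment ℝ u v) (hne : z ≠ v) : 0 < D σ p q z := by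
  obtain ⟨s, t, hs, ht, hst, rfl⟩ := hz
  rw [D_comb₂ σ hst]
  have : 0 < s := by
    refine lt_of_le_of_ne hs fun h => hne ?_
    obtain rfl : t = 1 := by linarith
    simp [← h]
  positivity

theorem D_opposite {σ : ℝ} {p q u v z : Plane} (h : D σ p q z = 0) (hz : z ∈ segment ℝ u v)
    (hu : D σ p q u ≠ 0) (hv : D σ p q v ≠ 0) :
    (0 < D σ p q u ∧ D σ p q v < 0) ∨ (D σ p q u < 0 ∧ 0 < D σ p q v) := by
  obtain ⟨s, t, hs, ht, hst, rfl⟩ := hz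
  rw [D_comb₂ σ hst] at h
  have hs0 : 0 < s ∨ 0 < t := by
    by_contra! hcon
    linarith
  rcases lt_or_gt_of_ne hu with h₁ | h₁ <;> rcases lt_or_gt_of_ne hv with h₂ | h₂
  · exfalso
    rcases hs0 with h0 | h0 <;> nlinarith
  · exact Or.inr ⟨h₁, h₂⟩
  · exact Or.inl ⟨h₁, h₂⟩
  · exfalso
    rcases hs0 with h0 | h0 <;> nlinarith

/-- A point on the boundary line of a triangle with the right signs lies on that side. -/
theorem mem_segment_of_D {σ : ℝ} {a b c z : Plane} (h : 0 < D σ a b c) (h₁ : 0 ≤ D σ a b z)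
    (h₂ : D σ b c z = 0) (h₃ : 0 ≤ D σ c a z) : z ∈ segment ℝ b c := by
  have hz := bary σ h.ne' z
  rw [h₂, zero_div, zero_smul, zero_add] at hz
  refine ⟨_, _, ?_, ?_, ?_, hz.symm⟩
  · positivity
  · positivity
  · have := D_add σ a b c z
    field_simp
    linarith

/-- `A`, `B` and `A'`, `B'` are the values of two affine functions at the ends of a segment. The
sign of `A * B' - B * A'` decides which of them vanishes first, since it is the sign of the second
function at the zero `A / (A - A')` of the first. -/
theorem exit_aux {A B A' B' : ℝ} (hA : 0 ≤ A) (hB : 0 ≤ B) (h : A' < 0 ∨ B' < 0) :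
    ∃ t : ℝ, 0 ≤ t ∧ t ≤ 1 ∧ ((1 - t) * A + t * A' = 0 ∧ 0 ≤ (1 - t) * B + t * B' ∨
      (1 - t) * B + t * B' = 0 ∧ 0 ≤ (1 - t) * A + t * A') := by
  wlog hw : 0 ≤ A * B' - B * A' generalizing A B A' B'
  · obtain ⟨t, h0, h1, h2⟩ := this hB hA h.symm (by linarith)
    exact ⟨t, h0, h1, h2.symm⟩
  rcases lt_or_ge A' 0 with hA' | hA'
  swap
  · have hB' : B' < 0 := h.resolve_left (not_lt.2 hA')
    have hd : 0 < B - B' := by linarith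
    refine ⟨B / (B - B'), by positivity, by rw [div_le_one hd]; linarith, Or.inr ⟨?_, ?_⟩⟩
    · field_simp; ring
    · have h₁ : (1 - B / (B - B')) * A + B / (B - B') * A' = (A * -B' + B * A') / (B - B') := by
        field_simp; ring
      have : 0 ≤ A * -B' := mul_nonneg hA (by linarith)
      rw [h₁]; positivity
  have hd : 0 < A - A' := by linarith
  refine ⟨A / (A - A'), by positivity, by rw [div_le_one hd]; linarith, Or.inl ⟨?_, ?_⟩⟩
  · field_simp; ring
  · have : (1 - A / (A - A')) * B + A / (A - A') * B' = (A * B' - B * A') / (A - A') := by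
      field_simp; ring
    rw [this]; positivity

/-- A segment which enters a triangle through the side `ab` and does not end in the triangle
leaves it through one of the other two sides. -/
theorem exit {σ : ℝ} {a b c q z : Plane} (h : 0 < D σ a b c) (hq : q ∈ segment ℝ a b)
    (hz : 0 < D σ a b z) (hT : z ∉ Tri a b c) :
    ∃ r ∈ segment ℝ q z, r ∈ segment ℝ a c ∨ r ∈ segment ℝ b c := by
  have hqT : q ∈ Tri a b c :=
    (convex_Tri a b c).segment_subset (Tri_left a b c) (Tri_mid a b c) hq
  obtain ⟨-, hA, hB⟩ := D_of_mem_Tri h.le hqT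
  have hq0 : D σ a b q = 0 := D_of_mem_segment hq
  have hneg : D σ b c z < 0 ∨ D σ c a z < 0 := by
    by_contra! hcon
    exact hT (mem_Tri_of_D h hz.le hcon.1 hcon.2)
  obtain ⟨t, h0, h1, ht⟩ := exit_aux hA hB hneg
  have hsum : (1 - t) + t = 1 := by ring
  refine ⟨(1 - t) • q + t • z, ⟨1 - t, t, by linarith, h0, hsum, rfl⟩, ?_⟩
  simp only [← D_comb₂ σ hsum] at ht
  have hC : 0 ≤ D σ a b ((1 - t) • q + t • z) := by
    rw [D_comb₂ σ hsum, hq0]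
    have := mul_nonneg h0 hz.le
    linarith
  rcases ht with ⟨h₁, h₂⟩ | ⟨h₁, h₂⟩
  · exact Or.inr (mem_segment_of_D h hC h₁ h₂)
  · refine Or.inl ?_
    rw [segment_symm]
    exact mem_segment_of_D (a := b) (by rwa [← D_rot]) h₂ h₁ hC |> fun h' => by
      simpa using h'

/-- `a` is strictly separated by a line from `G`. -/
def Ext (a : Plane) (G : Set Plane) : Prop :=
  ∃ α β : ℝ, ∀ g ∈ G, 0 < α * (g 0 - a 0) + β * (g 1 - a 1)

theorem Ext.mono {a : Plane} {G H : Set Plane} (h : Ext a H) (hGH : G ⊆ H) : Ext a G := by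
  obtain ⟨α, β, h⟩ := h
  exact ⟨α, β, fun g hg => h g (hGH hg)⟩

theorem Ext_of_D {σ : ℝ} {a b : Plane} {G : Set Plane} (h : ∀ g ∈ G, 0 < D σ a b g) : Ext b G :=
  ⟨-(σ * (b 1 - a 1)), σ * (b 0 - a 0), fun g hg => by
    have := h g hg
    unfold D at this
    nlinarith⟩

theorem Ext_of_D' {σ : ℝ} {a b : Plane} {G : Set Plane} (h : ∀ g ∈ G, 0 < D σ a b g) : Ext a G :=
  ⟨-(σ * (b 1 - a 1)), σ * (b 0 - a 0), fun g hg => by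
    have := h g hg
    unfold D at this
    nlinarith⟩

theorem Ext_of_notMem_convexHull {a : Plane} {G : Set Plane} (hG : G.Finite)
    (h : a ∉ convexHull ℝ G) : Ext a G := by
  obtain ⟨f, u, h₁, h₂⟩ := geometric_hahn_banach_point_closed (convex_convexHull ℝ G)
    (hG.isCompact_convexHull ℝ).isClosed h
  refine ⟨f (EuclideanSpace.single 0 1), f (EuclideanSpace.single 1 1), fun g hg => ?_⟩
  have h₃ := h₂ g (subset_convexHull ℝ G hg)
  have e : ∀ x : Plane, f x = f (EuclideanSpace.single 0 1) * x 0 +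
      f (EuclideanSpace.single 1 1) * x 1 := by
    intro x
    have hx : x = x 0 • EuclideanSpace.single 0 (1 : ℝ) + x 1 • EuclideanSpace.single 1 1 := by
      ext i; fin_cases i <;> simp
    conv_lhs => rw [hx]
    simp only [map_add, map_smul, smul_eq_mul]
    ring
  rw [e a] at h₁
  rw [e g] at h₃
  linarith

/-- Among finitely many points in an open half plane bounded by a line through `a` there is one
that comes first in the angular order around `a`. -/
theorem exists_tangent {σ : ℝ} {a : Plane} {G : Finset Plane} (hne : G.Nonempty)
    (hext : Ext a G) (hgp : ∀ g ∈ G, ∀ h ∈ G, g ≠ h → D σ a g h ≠ 0) :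
    ∃ g ∈ G, ∀ h ∈ G, h ≠ g → 0 < D σ a g h := by
  obtain ⟨α, β, hpos⟩ := hext
  -- The denominator is the separating functional, positive on `G`. The quotient is therefore the
  -- tangent of the angle against its normal, up to the factor `σ`, and is monotone in the angular
  -- order.
  obtain ⟨g, hg, hmin⟩ := G.exists_min_image (fun g =>
    σ * (α * (g 1 - a 1) - β * (g 0 - a 0)) / (α * (g 0 - a 0) + β * (g 1 - a 1))) hne
  refine ⟨g, hg, fun h hh hne => lt_of_le_of_ne ?_ (Ne.symm (hgp g hg h hh hne.symm))⟩
  have h₁ := hmin h hh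
  have hg0 := hpos g hg
  have hh0 := hpos h hh
  rw [div_le_div_iff₀ hg0 hh0] at h₁
  have key : (α ^ 2 + β ^ 2) * D σ a g h =
      σ * (α * (h 1 - a 1) - β * (h 0 - a 0)) * (α * (g 0 - a 0) + β * (g 1 - a 1)) -
      σ * (α * (g 1 - a 1) - β * (g 0 - a 0)) * (α * (h 0 - a 0) + β * (h 1 - a 1)) := by
    unfold D; ring
  have hsq : 0 < α ^ 2 + β ^ 2 := by
    by_contra hcon
    have hα : α = 0 := by nlinarith [sq_nonneg α, sq_nonneg β]
    have hβ : β = 0 := by nlinarith [sq_nonneg α, sq_nonneg β]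
    simp [hα, hβ] at hg0
  have : 0 ≤ (α ^ 2 + β ^ 2) * D σ a g h := by rw [key]; linarith
  exact nonneg_of_mul_nonneg_right this hsq

end PlanePaths

/-! ### Paths as lists and reversal of suffixes -/

namespace PlanePaths

open List

/-- No three points of `T` are collinear. -/
def GP (T : Finset Plane) : Prop :=
  ∀ a ∈ T, ∀ b ∈ T, ∀ c ∈ T, a ≠ b → b ≠ c → a ≠ c → D 1 a b c ≠ 0

theorem GP.mono {T U : Finset Plane} (h : GP T) (hU : U ⊆ T) : GP U :=
  fun a ha b hb c hc => h a (hU ha) b (hU hb) c (hU hc)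

theorem GP.ne {T : Finset Plane} (h : GP T) {σ : ℝ} (hσ : σ ≠ 0) {a b c : Plane} (ha : a ∈ T)
    (hb : b ∈ T) (hc : c ∈ T) (hab : a ≠ b) (hbc : b ≠ c) (hac : a ≠ c) : D σ a b c ≠ 0 := by
  rw [D_scale]
  exact mul_ne_zero hσ (h a ha b hb c hc hab hbc hac)

/-- The consecutive pairs of a list. -/
def edgesL : List Plane → List (Sym2 Plane)
  | x :: y :: l => s(x, y) :: edgesL (y :: l)
  | _ => []

@[simp] theorem edgesL_nil : edgesL [] = [] := rfl

@[simp] theorem edgesL_singleton (x : Plane) : edgesL [x] = [] := rfl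

@[simp] theorem edgesL_cons_cons (x y : Plane) (l : List Plane) :
    edgesL (x :: y :: l) = s(x, y) :: edgesL (y :: l) := rfl

theorem edgesL_append (A : List Plane) (x y : Plane) (B : List Plane) :
    edgesL (A ++ x :: y :: B) = edgesL (A ++ [x]) ++ s(x, y) :: edgesL (y :: B) := by
  induction A with
  | nil => simp
  | cons a A ih =>
    cases A with
    | nil => simp
    | cons b A => simpa using ih

theorem edgesL_reverse (l : List Plane) : edgesL l.reverse = (edgesL l).reverse := by
  induction l with
  | nil => rfl
  | cons x l ih =>
    cases l with
    | nil => rfl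
    | cons y l =>
      have : (x :: y :: l).reverse = l.reverse ++ y :: x :: [] := by simp
      rw [this, edgesL_append]
      simp only [edgesL_singleton, edgesL_cons_cons, reverse_cons]
      rw [← ih, reverse_cons, Sym2.eq_swap]

theorem mem_edgesL_iff {l : List Plane} {e : Sym2 Plane} :
    e ∈ edgesL l ↔ ∃ A x y B, l = A ++ x :: y :: B ∧ e = s(x, y) := by
  constructor
  · induction l with
    | nil => simp
    | cons x l ih =>
      cases l with
      | nil => simp
      | cons y l =>
        intro h
        rcases List.mem_cons.1 h with rfl | h
        · exact ⟨[], x, y, l, rfl, rfl⟩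
        · obtain ⟨A, u, v, B, h', h₂⟩ := ih h
          exact ⟨x :: A, u, v, B, by simp [h'], h₂⟩
  · rintro ⟨A, x, y, B, rfl, rfl⟩
    rw [edgesL_append]
    simp

theorem mem_of_mem_edgesL {l : List Plane} {a b : Plane} (h : s(a, b) ∈ edgesL l) :
    a ∈ l ∧ b ∈ l := by
  obtain ⟨A, x, y, B, rfl, h'⟩ := mem_edgesL_iff.1 h
  rcases Sym2.eq_iff.1 h' with ⟨rfl, rfl⟩ | ⟨rfl, rfl⟩ <;> simp

theorem ne_of_mem_edgesL {l : List Plane} (hl : l.Nodup) {a b : Plane}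
    (h : s(a, b) ∈ edgesL l) : a ≠ b := by
  obtain ⟨A, x, y, B, rfl, h'⟩ := mem_edgesL_iff.1 h
  have hxy : x ≠ y := by
    rintro rfl
    have := (List.nodup_append.1 hl).2.1
    simp at this
  rcases Sym2.eq_iff.1 h' with ⟨rfl, rfl⟩ | ⟨rfl, rfl⟩
  · exact hxy
  · exact hxy.symm

/-- The segment `ab` is disjoint from all segments of `E` that do not share an endpoint with it. -/
def Clear (E : Set (Sym2 Plane)) (a b : Plane) : Prop :=
  ∀ c d, s(c, d) ∈ E → a ≠ c → a ≠ d → b ≠ c → b ≠ d →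
    Disjoint (segment ℝ a b) (segment ℝ c d)

theorem Clear.symm {E : Set (Sym2 Plane)} {a b : Plane} (h : Clear E a b) : Clear E b a := by
  intro c d he h₁ h₂ h₃ h₄
  rw [segment_symm]
  exact h c d he h₃ h₄ h₁ h₂

theorem Clear.mono {E F : Set (Sym2 Plane)} {a b : Plane} (h : Clear F a b) (hEF : E ⊆ F) :
    Clear E a b := fun c d he => h c d (hEF he)

theorem Clear.union {E F : Set (Sym2 Plane)} {a b : Plane} (hE : Clear E a b)
    (hF : Clear F a b) : Clear (E ∪ F) a b :=
  fun c d he => he.elim (hE c d) (hF c d)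

theorem Clear.insert {E : Set (Sym2 Plane)} {a b c d : Plane} (h : Clear E a b)
    (hcd : a ≠ c → a ≠ d → b ≠ c → b ≠ d → Disjoint (segment ℝ a b) (segment ℝ c d)) :
    Clear (insert s(c, d) E) a b := by
  rintro x y (he | he) h₁ h₂ h₃ h₄
  · rcases Sym2.eq_iff.1 he with ⟨rfl, rfl⟩ | ⟨rfl, rfl⟩
    · exact hcd h₁ h₂ h₃ h₄
    · rw [segment_symm ℝ x y]
      exact hcd h₂ h₁ h₄ h₃
  · exact h x y he h₁ h₂ h₃ h₄

theorem clear_congr {E : Set (Sym2 Plane)} {a b c d : Plane} (h : s(a, b) = s(c, d)) :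
    Clear E a b ↔ Clear E c d := by
  rcases Sym2.eq_iff.1 h with ⟨rfl, rfl⟩ | ⟨rfl, rfl⟩
  · rfl
  · exact ⟨Clear.symm, Clear.symm⟩

/-- No two segments of `E` without common endpoint meet. -/
def NC (E : Set (Sym2 Plane)) : Prop :=
  ∀ a b, s(a, b) ∈ E → Clear E a b

theorem NC.mono {E F : Set (Sym2 Plane)} (h : NC F) (hEF : E ⊆ F) : NC E :=
  fun a b he => (h a b (hEF he)).mono hEF

theorem NC.insert {E : Set (Sym2 Plane)} {a b : Plane} (h : NC E) (hab : Clear E a b) :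
    NC (insert s(a, b) E) := by
  rintro c d (he | he)
  · rw [clear_congr he]
    exact hab.insert (fun h => absurd rfl h)
  · refine (h c d he).insert fun h₁ h₂ h₃ h₄ => ?_
    exact (hab c d he h₁.symm h₃.symm h₂.symm h₄.symm).symm

theorem NC.union {E F : Set (Sym2 Plane)} (hE : NC E) (hF : NC F)
    (h : ∀ a b, s(a, b) ∈ E → Clear F a b) : NC (E ∪ F) := by
  rintro a b (he | he)
  · exact (hE a b he).union (h a b he)
  · refine Clear.union (fun c d hcd h₁ h₂ h₃ h₄ => ?_) (hF a b he)
    exact (h c d hcd a b he h₁.symm h₃.symm h₂.symm h₄.symm).symm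

theorem NC_empty : NC ∅ := fun _ _ h => h.elim

/-- The set of consecutive pairs of a list. -/
def ES (l : List Plane) : Set (Sym2 Plane) := {e | e ∈ edgesL l}

theorem mem_ES {l : List Plane} {e : Sym2 Plane} : e ∈ ES l ↔ e ∈ edgesL l := Iff.rfl

theorem ES_append (A : List Plane) (x y : Plane) (B : List Plane) :
    ES (A ++ x :: y :: B) = insert s(x, y) (ES (A ++ [x]) ∪ ES (y :: B)) := by
  ext e
  simp only [mem_ES, edgesL_append, Set.mem_insert_iff, Set.mem_union, List.mem_append,
    List.mem_cons]
  tauto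

theorem ES_cons_cons (x y : Plane) (l : List Plane) :
    ES (x :: y :: l) = insert s(x, y) (ES (y :: l)) := by
  ext e; simp [mem_ES]

@[simp] theorem ES_singleton (x : Plane) : ES [x] = ∅ := by ext; simp [mem_ES]

@[simp] theorem ES_nil : ES [] = ∅ := by ext; simp [mem_ES]

@[simp] theorem ES_reverse (l : List Plane) : ES l.reverse = ES l := by
  ext e; simp [mem_ES, edgesL_reverse]

/-- `l` lists the points of `T` in the order of a plane spanning path. -/
structure PH (T : Finset Plane) (l : List Plane) : Prop where
  nodup : l.Nodup
  mem : ∀ x, x ∈ l ↔ x ∈ T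
  nc : NC (ES l)

theorem PH.reverse {T : Finset Plane} {l : List Plane} (h : PH T l) : PH T l.reverse :=
  ⟨List.nodup_reverse.2 h.nodup, by simp [h.mem], by simpa using h.nc⟩

theorem PH.tail {T : Finset Plane} {a : Plane} {l : List Plane} (h : PH T (a :: l)) :
    PH (T.erase a) l := by
  refine ⟨h.nodup.of_cons, fun x => ?_, h.nc.mono ?_⟩
  · have := h.mem x
    have h' := (List.nodup_cons.1 h.nodup).1
    rw [Finset.mem_erase, ← this]
    constructor
    · intro hx
      exact ⟨fun h => h' (h ▸ hx), by simp [hx]⟩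
    · rintro ⟨h₁, h₂⟩
      simpa [h₁] using h₂
  · cases l with
    | nil => simp
    | cons y l => rw [ES_cons_cons]; exact Set.subset_insert _ _

theorem PH.cons {T : Finset Plane} {a b : Plane} {l : List Plane} (ha : a ∈ T)
    (h : PH (T.erase a) (b :: l)) (hc : Clear (ES (b :: l)) a b) : PH T (a :: b :: l) := by
  refine ⟨List.nodup_cons.2 ⟨fun h' => ?_, h.nodup⟩, fun x => ?_, ?_⟩
  · simpa using (h.mem a).1 h'
  · rw [List.mem_cons, h.mem, Finset.mem_erase]
    by_cases hx : x = a
    · simp [hx, ha]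
    · simp [hx]
  · rw [ES_cons_cons]
    exact h.nc.insert hc

theorem PH.length {T : Finset Plane} {l : List Plane} (h : PH T l) : l.length = T.card := by
  rw [← List.toFinset_card_of_nodup h.nodup]
  congr 1
  ext x
  simp [h.mem]

/-- Reversing a suffix of a path. -/
def Step (T : Finset Plane) (l l' : List Plane) : Prop :=
  PH T l ∧ PH T l' ∧ ∃ A B, A ≠ [] ∧ l = A ++ B ∧ l' = A ++ B.reverse

theorem Step.symm {T : Finset Plane} {l l' : List Plane} (h : Step T l l') : Step T l' l := by
  obtain ⟨h, h', A, B, hA, rfl, rfl⟩ := h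
  exact ⟨h', h, A, B.reverse, hA, rfl, by simp⟩

theorem Step.head {T : Finset Plane} {l l' : List Plane} (h : Step T l l') :
    l'.head? = l.head? := by
  obtain ⟨h, h', A, B, hA, rfl, rfl⟩ := h
  cases A with
  | nil => exact absurd rfl hA
  | cons a A => rfl

/-- Reachability by reversing suffixes. -/
def Reach (T : Finset Plane) : List Plane → List Plane → Prop :=
  Relation.ReflTransGen (Step T)

theorem Reach.refl (T : Finset Plane) (l : List Plane) : Reach T l l :=
  Relation.ReflTransGen.refl

theorem Reach.trans {T : Finset Plane} {l₁ l₂ l₃ : List Plane} (h : Reach T l₁ l₂)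
    (h' : Reach T l₂ l₃) : Reach T l₁ l₃ :=
  Relation.ReflTransGen.trans h h'

theorem Step.reach {T : Finset Plane} {l l' : List Plane} (h : Step T l l') : Reach T l l' :=
  Relation.ReflTransGen.single h

theorem Reach.symm {T : Finset Plane} {l l' : List Plane} (h : Reach T l l') : Reach T l' l :=
  (@Relation.ReflTransGen.stdSymm _ _ ⟨fun _ _ h => Step.symm h⟩).symm _ _ h

theorem Reach.head {T : Finset Plane} {l l' : List Plane} (h : Reach T l l') :
    l'.head? = l.head? := by
  induction h with
  | refl => rfl
  | tail _ h ih => rw [h.head, ih]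

theorem Reach.ph {T : Finset Plane} {l l' : List Plane} (h : Reach T l l') (hl : PH T l) :
    PH T l' := by
  induction h with
  | refl => exact hl
  | tail _ h ih => exact h.2.1

/-- Reversing suffixes never moves the first point, so a prefix that is compatible with every path
from that point can be carried along. -/
theorem Reach.lift {T U : Finset Plane} {P l l' : List Plane} (h : Reach U l l')
    (hP : ∀ m, PH U m → m.head? = l.head? → PH T (P ++ m)) : Reach T (P ++ l) (P ++ l') := by
  induction h with
  | refl => exact Reach.refl _ _
  | @tail m m' hm hs ih =>
    have hs' : Step T (P ++ m) (P ++ m') := by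
      obtain ⟨h₁, h₂, A, B, hA, h₃, h₄⟩ := id hs
      have hh := Reach.head hm
      exact ⟨hP m h₁ hh, hP m' h₂ (hs.head.trans hh), P ++ A, B, by simp [hA], by simp [h₃],
        by simp [h₄]⟩
    exact ih.trans hs'.reach

/-- A segment in a closed half plane bounded by a line through `ab` is disjoint from `ab` if it
avoids the line. -/
theorem disjoint_of_side {σ : ℝ} {a b c d : Plane} (hc : 0 < D σ a b c) (hd : 0 < D σ a b d) :
    Disjoint (segment ℝ a b) (segment ℝ c d) := by
  rw [Set.disjoint_left]
  intro x h₁ h₂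
  by_cases hx : x = d
  · subst hx
    exact hd.ne' (D_of_mem_segment h₁)
  · exact (D_pos_of_mem_segment hc hd.le h₂ hx).ne' (D_of_mem_segment h₁)

theorem clear_of_side {σ : ℝ} {a b : Plane} {l : List Plane}
    (h : ∀ x ∈ l, x ≠ a → x ≠ b → 0 < D σ a b x) : Clear (ES l) a b := by
  intro c d hcd h₁ h₂ h₃ h₄
  have := mem_of_mem_edgesL hcd
  exact disjoint_of_side (h c this.1 h₁.symm h₃.symm) (h d this.2 h₂.symm h₄.symm)

/-- An extreme point of a finite set is joined to any other point of it by a plane path through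
all points. -/
theorem exists_path {F : Finset Plane} (hF : GP F) {a b : Plane} (ha : a ∈ F) (hb : b ∈ F)
    (hab : a ≠ b) (hext : Ext a (F.erase a)) :
    ∃ l, PH F l ∧ l.head? = some a ∧ l.getLast? = some b := by
  induction hn : F.card using Nat.strong_induction_on generalizing F a with
  | _ n ih =>
    have hbG : b ∈ F.erase a := by simp [hb, hab.symm]
    have hGF : F.erase a ⊆ F := Finset.erase_subset _ _
    have hgp : ∀ σ : ℝ, σ ≠ 0 → ∀ g ∈ F.erase a, ∀ h ∈ F.erase a, g ≠ h → D σ a g h ≠ 0 := by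
      intro σ hσ g hg h hh hgh
      exact hF.ne hσ ha (hGF hg) (hGF hh) (Finset.ne_of_mem_erase hg).symm hgh
        (Finset.ne_of_mem_erase hh).symm
    by_cases h1 : F.erase a = {b}
    · have hmem : ∀ x, x ∈ F ↔ x = a ∨ x = b := by
        intro x
        by_cases hxa : x = a
        · simp [hxa, ha]
        · have := Finset.ext_iff.1 h1 x
          simpa [hxa] using this
      refine ⟨[a, b], ⟨by simp [hab], by simp [hmem], ?_⟩, rfl, rfl⟩
      rw [ES_cons_cons, ES_singleton]
      exact NC_empty.insert (fun _ _ h => h.elim)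
    -- The two tangents from `a` end in different points unless only `b` is left, so one of them
    -- avoids `b`. Its end is extreme in the rest, and no edge between the remaining points crosses
    -- a tangent.
    obtain ⟨σ, a', ha', hne, hside⟩ : ∃ σ : ℝ, ∃ a' ∈ F.erase a, a' ≠ b ∧
        ∀ h ∈ F.erase a, h ≠ a' → 0 < D σ a a' h := by
      obtain ⟨u, hu, hu'⟩ := exists_tangent (σ := 1) ⟨b, hbG⟩ hext (hgp 1 (by norm_num))
      obtain ⟨v, hv, hv'⟩ := exists_tangent (σ := -1) ⟨b, hbG⟩ hext (hgp (-1) (by norm_num))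
      by_cases hub : u = b
      · refine ⟨-1, v, hv, fun hvb => h1 ?_, hv'⟩
        subst hub hvb
        refine Finset.eq_singleton_iff_unique_mem.2 ⟨hu, fun x hx => ?_⟩
        by_contra hxu
        have h₁ := hu' x hx hxu
        have h₂ := hv' x hx hxu
        rw [D_neg] at h₂
        linarith
      · exact ⟨1, u, hu, hub, hu'⟩
    obtain ⟨l, hl, hhead, hlast⟩ := ih (F.erase a).card
      (by rw [← hn]; exact Finset.card_erase_lt_of_mem ha) (hF.mono hGF) ha' hbG hne
      (Ext_of_D (σ := σ) (a := a) fun g hg => hside g (by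
        exact Finset.mem_of_mem_erase hg) (by simpa using (Finset.ne_of_mem_erase hg))) rfl
    cases l with
    | nil => simp at hhead
    | cons x l =>
      obtain rfl : x = a' := by simpa using hhead
      refine ⟨a :: x :: l, PH.cons ha hl (clear_of_side (σ := σ) fun y hy _ hya => ?_), rfl, ?_⟩
      · exact hside y ((hl.mem y).1 hy) hya
      · simpa using hlast

theorem segment_inter_of_D {σ : ℝ} {a b d x : Plane} (h : D σ a b d ≠ 0)
    (h₁ : x ∈ segment ℝ a b) (h₂ : x ∈ segment ℝ a d) : x = a := by
  obtain ⟨s, t, -, -, hst, rfl⟩ := h₂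
  have := D_of_mem_segment (σ := σ) h₁
  rw [D_comb₂ σ hst] at this
  have ht : t = 0 := by simpa [h] using this
  obtain rfl : s = 1 := by linarith
  simp [ht]

end PlanePaths

/-! ### From lists to the flip graph -/

namespace PlanePaths

open List

theorem GeneralPosition.gp {S : Finset Plane} (h : GeneralPosition S) : GP S := by
  intro a ha b hb c hc hab hbc hac h0
  refine h a ha b hb c hc hab hbc hac ?_
  rw [collinear_iff_of_mem (p₀ := a) (by simp)]
  refine ⟨b - a, ?_⟩
  have hba : ∃ i, b i - a i ≠ 0 := by
    by_contra! hcon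
    exact hab (by ext i; linarith [hcon i])
  obtain ⟨i, hi⟩ := hba
  rintro p (rfl | rfl | rfl)
  · exact ⟨0, by simp⟩
  · exact ⟨1, by simp⟩
  · refine ⟨(p i - a i) / (b i - a i), ?_⟩
    unfold D at h0
    ext j
    simp only [vadd_eq_add, PiLp.add_apply, PiLp.smul_apply, PiLp.sub_apply, smul_eq_mul]
    field_simp
    fin_cases i <;> fin_cases j <;> simp <;> simp at h0 <;> linarith

theorem mem_edgesL_iff_getElem {l : List Plane} {e : Sym2 Plane} :
    e ∈ edgesL l ↔ ∃ (i : ℕ) (h : i + 1 < l.length), e = s(l[i], l[i + 1]) := by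
  induction l with
  | nil => simp
  | cons x l ih =>
    cases l with
    | nil => simp
    | cons y l =>
      rw [edgesL_cons_cons, List.mem_cons, ih]
      constructor
      · rintro (h | ⟨i, hi, h⟩)
        · exact ⟨0, by simp, h⟩
        · exact ⟨i + 1, by simpa using hi, by simpa using h⟩
      · rintro ⟨i, hi, h⟩
        cases i with
        | zero => exact Or.inl h
        | succ i => exact Or.inr ⟨i, by simpa using hi, by simpa using h⟩

theorem edgesL_nodup {l : List Plane} (hl : l.Nodup) : (edgesL l).Nodup := by
  induction l with
  | nil => simp
  | cons x l ih =>
    cases l with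
    | nil => simp
    | cons y l =>
      rw [edgesL_cons_cons, List.nodup_cons]
      refine ⟨fun h => ?_, ih hl.of_cons⟩
      exact (List.nodup_cons.1 hl).1 (mem_of_mem_edgesL h).1

/-- The graph drawn by a list of points. -/
def toGraph (S : Finset Plane) (l : List Plane) : SimpleGraph S where
  Adj a b := a ≠ b ∧ s((a : Plane), (b : Plane)) ∈ edgesL l
  symm := ⟨fun _ _ h => ⟨h.1.symm, by rw [Sym2.eq_swap]; exact h.2⟩⟩
  loopless := ⟨fun _ h => h.1 rfl⟩

theorem toGraph_adj {S : Finset Plane} {l : List Plane} (hl : l.Nodup) {a b : S} :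
    (toGraph S l).Adj a b ↔ s((a : Plane), (b : Plane)) ∈ edgesL l :=
  ⟨fun h => h.2, fun h => ⟨fun hab => ne_of_mem_edgesL hl h (by rw [hab]), h⟩⟩

theorem getElem_mem_edgesL_iff {l : List Plane} (hl : l.Nodup) {i j : ℕ} (hi : i < l.length)
    (hj : j < l.length) : s(l[i], l[j]) ∈ edgesL l ↔ i + 1 = j ∨ j + 1 = i := by
  rw [mem_edgesL_iff_getElem]
  constructor
  · rintro ⟨k, hk, h⟩
    rcases Sym2.eq_iff.1 h with ⟨h₁, h₂⟩ | ⟨h₁, h₂⟩ <;>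
      rw [hl.getElem_inj_iff] at h₁ h₂ <;> omega
  · rintro (rfl | rfl)
    · exact ⟨i, hj, rfl⟩
    · exact ⟨j, hi, Sym2.eq_swap⟩

/-- `NC` only concerns edges without a common endpoint. Two edges at the same vertex meet nowhere
else by general position. -/
theorem toGraph_mem {S : Finset Plane} (hS : GP S) {l : List Plane} (h : PH S l) :
    toGraph S l ∈ planeSpanningPaths S := by
  refine ⟨?_, ?_⟩
  · have hlen := h.length
    let f : Fin S.card → S := fun i =>
      ⟨l[(i : ℕ)]'(by rw [hlen]; exact i.2), (h.mem _).1 (List.getElem_mem _)⟩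
    have hf : Function.Injective f := by
      intro i j hij
      have := congrArg Subtype.val hij
      exact Fin.ext ((h.nodup.getElem_inj_iff).1 this)
    have hb : Function.Bijective f :=
      (Fintype.bijective_iff_injective_and_card f).2 ⟨hf, by simp⟩
    refine ⟨⟨Equiv.ofBijective f hb, ?_⟩⟩
    intro i j
    rw [toGraph_adj h.nodup, SimpleGraph.pathGraph_adj]
    exact getElem_mem_edgesL_iff h.nodup _ _
  · have key : ∀ a b d : S, a ≠ b → a ≠ d → b ≠ d → ∀ x ∈ segment ℝ (a : Plane) b ∩
        segment ℝ (a : Plane) d, x = a := by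
      intro a b d hab had hbd x hx
      exact segment_inter_of_D (hS a a.2 b b.2 d d.2 (Subtype.coe_injective.ne hab)
        (Subtype.coe_injective.ne hbd) (Subtype.coe_injective.ne had)) hx.1 hx.2
    intro a b c d hab hcd hne x hx
    have hab' := hab.1
    have hcd' := hcd.1
    by_cases hac : a = c
    · subst hac
      have := key a b d hab' hcd' (fun h => hne (by rw [h])) x hx
      simp [this]
    by_cases had : a = d
    · subst had
      rw [segment_symm ℝ (c : Plane)] at hx
      have := key a b c hab' hac (fun h => hne (by rw [h, Sym2.eq_swap])) x hx
      simp [this]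
    by_cases hbc : b = c
    · subst hbc
      rw [segment_symm ℝ (a : Plane)] at hx
      have := key b a d hab'.symm hcd' had x hx
      simp [this]
    by_cases hbd : b = d
    · subst hbd
      rw [segment_symm ℝ (a : Plane), segment_symm ℝ (c : Plane)] at hx
      have := key b a c hab'.symm hcd'.symm hac x hx
      simp [this]
    have inj := @Subtype.coe_injective Plane (· ∈ S)
    exact absurd hx.2 (Set.disjoint_left.1 (h.nc a b hab.2 c d hcd.2 (inj.ne hac) (inj.ne had)
      (inj.ne hbc) (inj.ne hbd)) hx.1)

theorem exists_list {S : Finset Plane} {G : SimpleGraph S} (hG : G ∈ planeSpanningPaths S) :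
    ∃ l, PH S l ∧ toGraph S l = G := by
  obtain ⟨⟨φ⟩, hpl⟩ := hG
  have inj := @Subtype.coe_injective Plane (· ∈ S)
  set l : List Plane := List.ofFn fun i => (φ i : Plane) with hl
  have hnd : l.Nodup := List.nodup_ofFn.2 (inj.comp φ.injective)
  have hmem : ∀ x, x ∈ l ↔ x ∈ S := by
    intro x
    rw [hl, List.mem_ofFn]
    constructor
    · rintro ⟨i, rfl⟩
      exact (φ i).2
    · intro hx
      exact ⟨φ.symm ⟨x, hx⟩, by simp⟩
  have hadj : ∀ a b : S, s((a : Plane), (b : Plane)) ∈ edgesL l ↔ G.Adj a b := by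
    intro a b
    have ha : (a : Plane) = l[((φ.symm a : Fin _) : ℕ)]'(by simp [hl]) := by simp [hl]
    have hb : (b : Plane) = l[((φ.symm b : Fin _) : ℕ)]'(by simp [hl]) := by simp [hl]
    rw [ha, hb, getElem_mem_edgesL_iff hnd, ← SimpleGraph.pathGraph_adj]
    exact φ.symm.map_rel_iff
  refine ⟨l, ⟨hnd, hmem, ?_⟩, ?_⟩
  · intro a b hab c d hcd hac had hbc hbd
    have h₁ := mem_of_mem_edgesL hab
    have h₂ := mem_of_mem_edgesL hcd
    simp only [hmem] at h₁ h₂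
    rw [Set.disjoint_left]
    intro x hx hx'
    have := hpl ⟨a, h₁.1⟩ ⟨b, h₁.2⟩ ⟨c, h₂.1⟩ ⟨d, h₂.2⟩ ((hadj _ _).1 hab)
      ((hadj _ _).1 hcd) (fun h => ?_) x ⟨hx, hx'⟩
    · simp only at this
      rcases this with ⟨rfl | rfl, rfl | rfl⟩ <;> contradiction
    · rcases Sym2.eq_iff.1 h with ⟨h, -⟩ | ⟨h, -⟩
      · exact hac (congrArg Subtype.val h)
      · exact had (congrArg Subtype.val h)
  · ext a b
    rw [toGraph_adj hnd, hadj]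

/-- If the suffix after `a` runs from `b` to `c`, its reversal replaces the edge `ab` by `ac` and
keeps all others. A suffix with at most one point gives the first alternative. -/
theorem Step.isFlip {S : Finset Plane} {l l' : List Plane} (h : Step S l l') :
    toGraph S l = toGraph S l' ∨ IsFlip (toGraph S l) (toGraph S l') := by
  obtain ⟨h, h', A, B, hA, rfl, rfl⟩ := h
  obtain ⟨A, a, rfl⟩ := List.eq_nil_or_concat A |>.resolve_left hA
  simp only [List.append_assoc, List.singleton_append, List.concat_eq_append] at h h' ⊢
  cases B with
  | nil => exact Or.inl rfl
  | cons b B =>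
    rcases List.eq_nil_or_concat B with rfl | ⟨B, c, rfl⟩
    · exact Or.inl rfl
    refine Or.inr ?_
    have hr : (b :: B.concat c).reverse = c :: (b :: B).reverse := by simp
    have hes : ES (c :: (b :: B).reverse) = ES (b :: B.concat c) := by
      rw [← hr, ES_reverse]
    have hn := edgesL_nodup h.nodup
    have hn' := edgesL_nodup h'.nodup
    have e₁ : ES (A ++ a :: b :: B.concat c) =
      insert s(a, b) (ES (A ++ [a]) ∪ ES (b :: B.concat c)) := ES_append _ _ _ _
    have e₂ : ES (A ++ a :: c :: (b :: B).reverse) =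
      insert s(a, c) (ES (A ++ [a]) ∪ ES (b :: B.concat c)) := by
      rw [← hes]; exact ES_append _ _ _ _
    rw [hr] at h' hn' ⊢
    rw [edgesL_append, List.nodup_append] at hn hn'
    have hbc : b ≠ c := by
      rintro rfl
      have := (List.nodup_append.1 h.nodup).2.1
      simp at this
    have hfe : s(a, c) ≠ s(a, b) := by
      intro h
      rcases Sym2.eq_iff.1 h with ⟨-, h⟩ | ⟨h₁, h₂⟩
      · exact hbc h.symm
      · exact hbc (h₁.symm.trans h₂.symm)
    have n₁ : s(a, b) ∉ ES (A ++ [a]) ∪ ES (b :: B.concat c) := by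
      rintro (hm | hm)
      · exact hn.2.2 _ hm _ (List.mem_cons_self) rfl
      · exact (List.nodup_cons.1 hn.2.1).1 hm
    have n₂ : s(a, c) ∉ ES (A ++ [a]) ∪ ES (b :: B.concat c) := by
      rintro (hm | hm)
      · exact hn'.2.2 _ hm _ (List.mem_cons_self) rfl
      · rw [← hes] at hm
        exact (List.nodup_cons.1 hn'.2.1).1 hm
    have ha : a ∈ S := (h.mem a).1 (by simp)
    have hb : b ∈ S := (h.mem b).1 (by simp)
    have hc : c ∈ S := (h.mem c).1 (by simp)
    have adj₁ : ∀ x y : S, (toGraph S (A ++ a :: b :: B.concat c)).Adj x y ↔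
        s((x : Plane), (y : Plane)) = s(a, b) ∨
        s((x : Plane), (y : Plane)) ∈ ES (A ++ [a]) ∪ ES (b :: B.concat c) := by
      intro x y
      rw [toGraph_adj h.nodup, ← mem_ES, e₁, Set.mem_insert_iff]
    have adj₂ : ∀ x y : S, (toGraph S (A ++ a :: c :: (b :: B).reverse)).Adj x y ↔
        s((x : Plane), (y : Plane)) = s(a, c) ∨
        s((x : Plane), (y : Plane)) ∈ ES (A ++ [a]) ∪ ES (b :: B.concat c) := by
      intro x y
      rw [toGraph_adj h'.nodup, ← mem_ES, e₂, Set.mem_insert_iff]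
    refine ⟨s(⟨a, ha⟩, ⟨b, hb⟩), ?_, s(⟨a, ha⟩, ⟨c, hc⟩), ?_, ?_⟩
    · rw [SimpleGraph.mem_edgeSet, adj₁]
      exact Or.inl rfl
    · rw [SimpleGraph.mem_edgeSet, adj₁]
      rintro (hm | hm)
      · exact hfe hm
      · exact n₂ hm
    · ext e
      induction e using Sym2.ind with
      | _ x y =>
        have q : ∀ (u v : Plane) (hu : u ∈ S) (hv : v ∈ S), s(x, y) = s(⟨u, hu⟩, ⟨v, hv⟩) ↔
            s((x : Plane), (y : Plane)) = s(u, v) := by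
          intro u v hu hv
          simp only [Sym2.eq_iff, Subtype.ext_iff]
        rw [Set.mem_insert_iff, Set.mem_sdiff, Set.mem_singleton_iff, SimpleGraph.mem_edgeSet,
          SimpleGraph.mem_edgeSet, adj₁, adj₂, q, q]
        constructor
        · rintro (hm | hm)
          · exact Or.inl hm
          · exact Or.inr ⟨Or.inr hm, fun hcon => n₁ (hcon ▸ hm)⟩
        · rintro (hm | ⟨hm | hm, hm'⟩)
          · exact Or.inl hm
          · exact absurd hm hm'
          · exact Or.inr hm

theorem toGraph_reverse (S : Finset Plane) (l : List Plane) :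
    toGraph S l.reverse = toGraph S l := by
  ext a b
  simp [toGraph, edgesL_reverse]

/-- One move: reversing a suffix, or traversing the path backwards. -/
def Move (S : Finset Plane) (l l' : List Plane) : Prop :=
  Step S l l' ∨ PH S l ∧ l' = l.reverse

theorem flipGraph_connected {S : Finset Plane} (hS : GP S) (hne : ∃ l, PH S l)
    (h : ∀ l l', PH S l → PH S l' → Relation.ReflTransGen (Move S) l l') :
    (flipGraph S).Connected := by
  obtain ⟨l₀, hl₀⟩ := hne
  have key : ∀ l l', PH S l → Relation.ReflTransGen (Move S) l l' →
      ∃ h' : PH S l', ∀ hl : toGraph S l ∈ planeSpanningPaths S,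
        (flipGraph S).Reachable ⟨toGraph S l, hl⟩ ⟨toGraph S l', toGraph_mem hS h'⟩ := by
    intro l l' hl hll'
    induction hll' with
    | refl => exact ⟨hl, fun _ => SimpleGraph.Reachable.refl _⟩
    | @tail m m' _ hm ih =>
      obtain ⟨h₁, h₂⟩ := ih
      rcases hm with hm | ⟨hm, rfl⟩
      · refine ⟨hm.2.1, fun hl => (h₂ hl).trans ?_⟩
        rcases hm.isFlip with he | he
        · have : (⟨toGraph S m, toGraph_mem hS h₁⟩ : planeSpanningPaths S) =
            ⟨toGraph S m', toGraph_mem hS hm.2.1⟩ := Subtype.ext he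
          rw [this]
        · exact SimpleGraph.Adj.reachable he
      · refine ⟨hm.reverse, fun hl => (h₂ hl).trans ?_⟩
        have : (⟨toGraph S m, toGraph_mem hS h₁⟩ : planeSpanningPaths S) =
          ⟨toGraph S m.reverse, toGraph_mem hS hm.reverse⟩ := Subtype.ext (toGraph_reverse S m).symm
        rw [this]
  have : Nonempty (planeSpanningPaths S) := ⟨⟨_, toGraph_mem hS hl₀⟩⟩
  refine ⟨?_⟩
  rintro ⟨G, hG⟩ ⟨G', hG'⟩
  obtain ⟨l, hl, rfl⟩ := exists_list hG
  obtain ⟨l', hl', rfl⟩ := exists_list hG'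
  exact (key l l' hl (h l l' hl hl')).2 hG

end PlanePaths

/-! ### Crossing parity and consecutive hull edges -/

namespace PlanePaths

open List

/-- Orientation test. -/
noncomputable def P (σ : ℝ) (a b c : Plane) : Bool := decide (0 < D σ a b c)

theorem P_rot (σ : ℝ) (a b c : Plane) : P σ a b c = P σ b c a := by
  unfold P; rw [D_rot]

theorem P_swap {σ : ℝ} {a b c : Plane} (h : D σ a b c ≠ 0) : P σ a c b = !P σ a b c := by
  unfold P
  rw [D_swap]
  rcases lt_or_gt_of_ne h with h | h
  · simp [h, h.le]
  · simp [h, h.le]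

/-- Whether the segments `pq` and `xy` cross, by orientation tests. -/
noncomputable def X (σ : ℝ) (p q x y : Plane) : Bool :=
  (P σ p q x ^^ P σ p q y) && (P σ x y p ^^ P σ x y q)

/-- Whether `p` is in the triangle `wxy`, by orientation tests. -/
noncomputable def inTri (σ : ℝ) (w x y p : Plane) : Bool :=
  (P σ w x p == P σ x y p) && (P σ x y p == P σ y w p)

/-- The three terms of the Grassmann–Plücker relation add up to zero, so they cannot all have the
same sign. The two conjuncts exclude the two constant sign patterns. -/
theorem P_plucker {σ : ℝ} {a b c d e : Plane} (h₁ : D σ a b c ≠ 0) (h₂ : D σ a d e ≠ 0)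
    (h₃ : D σ a b d ≠ 0) (h₄ : D σ a c e ≠ 0) (h₅ : D σ a b e ≠ 0) (h₆ : D σ a c d ≠ 0) :
    ¬ ((P σ a b c = P σ a d e) ∧ (P σ a b d ≠ P σ a c e) ∧ (P σ a b e = P σ a c d)) ∧
    ¬ ((P σ a b c ≠ P σ a d e) ∧ (P σ a b d = P σ a c e) ∧ (P σ a b e ≠ P σ a c d)) := by
  have key := D_plucker σ a b c d e
  have hprod : ∀ {x y : ℝ}, x ≠ 0 → y ≠ 0 → ((decide (0 < x) = decide (0 < y) ↔ 0 < x * y) ∧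
      (decide (0 < x) ≠ decide (0 < y) ↔ x * y < 0)) := by
    intro x y hx hy
    rcases lt_or_gt_of_ne hx with hx | hx <;> rcases lt_or_gt_of_ne hy with hy | hy
    · have := mul_pos_of_neg_of_neg hx hy
      simp [hx.not_gt, hy.not_gt, this, this.le]
    · have := mul_neg_of_neg_of_pos hx hy
      simp [hx.not_gt, hy, this]
    · have := mul_neg_of_pos_of_neg hx hy
      simp [hx, hy.not_gt, this]
    · have := mul_pos hx hy
      simp [hx, hy, this, this.le]
  unfold P
  rw [(hprod h₁ h₂).1, (hprod h₁ h₂).2, (hprod h₃ h₄).1, (hprod h₃ h₄).2, (hprod h₅ h₆).1,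
    (hprod h₅ h₆).2]
  constructor
  · rintro ⟨h, h', h''⟩; linarith
  · rintro ⟨h, h', h''⟩; linarith

/-- The number of sides of the triangle `wxy` crossed by `pq` is odd if and only if exactly one
of `p` and `q` is in the triangle. -/
theorem triangle_parity {T : Finset Plane} (hT : GP T) {σ : ℝ} (hσ : σ ≠ 0) {w x y p q : Plane}
    (hw : w ∈ T) (hx : x ∈ T) (hy : y ∈ T) (hp : p ∈ T) (hq : q ∈ T)
    (hd : [w, x, y, p, q].Nodup) :
    (X σ p q x y ^^ (X σ p q w x ^^ X σ p q w y)) = (inTri σ w x y p ^^ inTri σ w x y q) := by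
  simp only [List.nodup_cons, List.mem_cons, not_or, List.not_mem_nil, not_false_eq_true,
    List.nodup_nil, and_true] at hd
  obtain ⟨⟨wx, wy, wp, wq⟩, ⟨xy, xp, xq⟩, ⟨yp, yq⟩, pq⟩ := hd
  have n₁ := hT.ne hσ hp hw hx (Ne.symm wp) wx (Ne.symm xp)
  have n₂ := hT.ne hσ hp hw hy (Ne.symm wp) wy (Ne.symm yp)
  have n₃ := hT.ne hσ hp hw hq (Ne.symm wp) wq pq
  have n₄ := hT.ne hσ hp hx hy (Ne.symm xp) xy (Ne.symm yp)
  have n₅ := hT.ne hσ hp hx hq (Ne.symm xp) xq pq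
  have n₆ := hT.ne hσ hp hy hq (Ne.symm yp) yq pq
  have m₁ := hT.ne hσ hq hw hx (Ne.symm wq) wx (Ne.symm xq)
  have m₂ := hT.ne hσ hq hw hy (Ne.symm wq) wy (Ne.symm yq)
  have m₃ := hT.ne hσ hq hw hp (Ne.symm wq) wp (Ne.symm pq)
  have m₄ := hT.ne hσ hq hx hy (Ne.symm xq) xy (Ne.symm yq)
  have m₅ := hT.ne hσ hq hx hp (Ne.symm xq) xp (Ne.symm pq)
  have m₆ := hT.ne hσ hq hy hp (Ne.symm yq) yp (Ne.symm pq)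
  -- The relations based at `p` and at `q` are all the geometry needed. What remains is a finite
  -- check on nine orientations.
  have c₁ := P_plucker n₁ n₆ n₂ n₅ n₃ n₄
  have c₂ := P_plucker m₁ m₆ m₂ m₅ m₃ m₄
  have r₁ : P σ p q w = !P σ p w q := P_swap n₃
  have r₂ : P σ p q x = !P σ p x q := P_swap n₅
  have r₃ : P σ p q y = !P σ p y q := P_swap n₆
  have r₄ : P σ x y p = P σ p x y := (P_rot ..).symm
  have r₅ : P σ x y q = P σ q x y := (P_rot ..).symm
  have r₆ : P σ w x p = P σ p w x := (P_rot ..).symm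
  have r₇ : P σ w x q = P σ q w x := (P_rot ..).symm
  have r₈ : P σ w y p = P σ p w y := (P_rot ..).symm
  have r₉ : P σ w y q = P σ q w y := (P_rot ..).symm
  have s₁ : P σ y w p = !P σ p w y := by rw [← P_swap n₂, ← P_rot]
  have s₂ : P σ y w q = !P σ q w y := by rw [← P_swap m₂, ← P_rot]
  have s₃ : P σ q w p = !P σ p w q := by rw [← P_swap n₃, ← P_rot]
  have s₄ : P σ q x p = !P σ p x q := by rw [← P_swap n₅, ← P_rot]
  have s₅ : P σ q y p = !P σ p y q := by rw [← P_swap n₆, ← P_rot]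
  unfold X inTri
  rw [s₃, s₄, s₅] at c₂
  rw [r₁, r₂, r₃, r₄, r₅, r₆, r₇, r₈, r₉, s₁, s₂]
  generalize P σ p w x = b₁ at *
  generalize P σ p w y = b₂ at *
  generalize P σ p w q = b₃ at *
  generalize P σ p x y = b₄ at *
  generalize P σ p x q = b₅ at *
  generalize P σ p y q = b₆ at *
  generalize P σ q w x = b₇ at *
  generalize P σ q w y = b₈ at *
  generalize P σ q x y = b₉ at *
  clear r₁ r₂ r₃ r₄ r₅ r₆ r₇ r₈ r₉ s₁ s₂ s₃ s₄ s₅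
  revert c₁ c₂
  revert b₁ b₂ b₃ b₄ b₅ b₆ b₇ b₈ b₉
  clear * -
  decide

theorem P_true {σ : ℝ} {a b c : Plane} (h : 0 < D σ a b c) : P σ a b c = true := by simp [P, h]

theorem P_false {σ : ℝ} {a b c : Plane} (h : 0 < D σ a b c) : P σ a c b = false := by
  rw [P_swap h.ne', P_true h]; rfl

/-- If `pq` and `xy` cross by orientation tests, then they meet. -/
theorem inter_of_X {σ : ℝ} {p q x y : Plane} (h₁ : D σ p q x ≠ 0) (h₂ : D σ p q y ≠ 0)
    (h₃ : D σ x y p ≠ 0) (h₄ : D σ x y q ≠ 0) (h : X σ p q x y = true) :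
    ¬ Disjoint (segment ℝ p q) (segment ℝ x y) := by
  have sgn : ∀ {u v : ℝ}, u ≠ 0 → v ≠ 0 → (decide (0 < u) ^^ decide (0 < v)) = true →
      0 < u / (u - v) ∧ 0 < - v / (u - v) := by
    intro u v hu hv huv
    rcases lt_or_gt_of_ne hu with hu | hu <;> rcases lt_or_gt_of_ne hv with hv | hv
    · simp [hu.not_gt, hv.not_gt] at huv
    · exact ⟨div_pos_of_neg_of_neg hu (by linarith), div_pos_of_neg_of_neg (by linarith)
        (by linarith)⟩
    · exact ⟨div_pos hu (by linarith), div_pos (by linarith) (by linarith)⟩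
    · simp [hu, hv] at huv
  unfold X at h
  rw [Bool.and_eq_true] at h
  obtain ⟨a₁, a₂⟩ := sgn h₁ h₂ h.1
  obtain ⟨b₁, b₂⟩ := sgn h₃ h₄ h.2
  have na : D σ p q x - D σ p q y ≠ 0 := by
    rintro h0; simp [h0] at a₁
  have nb : D σ x y p - D σ x y q ≠ 0 := by
    rintro h0; simp [h0] at b₁
  rw [Set.not_disjoint_iff]
  -- The crossing point divides each segment in the ratio of the areas that its ends span with the
  -- other segment.
  refine ⟨(-D σ x y q / (D σ x y p - D σ x y q)) • p + (D σ x y p / (D σ x y p - D σ x y q)) • q,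
    ⟨_, _, b₂.le, b₁.le, by field_simp; ring, rfl⟩,
    (-D σ p q y / (D σ p q x - D σ p q y)), (D σ p q x / (D σ p q x - D σ p q y)),
    a₂.le, a₁.le, by field_simp; ring, ?_⟩
  have e₁ : D σ x y p - D σ x y q = D σ p q y - D σ p q x := by unfold D; ring
  have hσ : σ ≠ 0 := by
    rintro rfl
    simp [D] at h₁
  ext i
  simp only [PiLp.add_apply, PiLp.smul_apply, smul_eq_mul]
  rw [e₁] at nb ⊢
  field_simp
  fin_cases i <;> simp [D] <;> ring

/-- The parity of the number of triangles with apex `w` over a path that contain `p`. -/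
noncomputable def fan (σ : ℝ) (w p : Plane) : List Plane → Bool
  | x :: y :: l => inTri σ w x y p ^^ fan σ w p (y :: l)
  | _ => false

/-- Sum `triangle_parity` over the fan. Each interior spoke occurs twice and cancels, and the edges
of the list are not crossed by `pq`, so only the first and the last spoke remain. -/
theorem fan_edge {T : Finset Plane} (hT : GP T) {σ : ℝ} (hσ : σ ≠ 0) {w p q : Plane}
    (hw : w ∈ T) (hp : p ∈ T) (hq : q ∈ T) (hwp : w ≠ p) (hwq : w ≠ q) (hpq : p ≠ q)
    {y z : Plane} {l : List Plane} (hz : (y :: l).getLast? = some z) (hl : (y :: l).Nodup)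
    (hlT : ∀ x ∈ y :: l, x ∈ T ∧ x ≠ w ∧ x ≠ p ∧ x ≠ q)
    (hc : Clear (ES (y :: l)) p q) :
    (fan σ w p (y :: l) ^^ fan σ w q (y :: l)) = (X σ p q w y ^^ X σ p q w z) := by
  induction l generalizing y with
  | nil =>
    obtain rfl : y = z := by simpa using hz
    simp [fan]
  | cons x l ih =>
    have h := ih (y := x) (by simpa using hz) hl.of_cons
      (fun u hu => hlT u (List.mem_cons_of_mem _ hu))
      (hc.mono (by rw [ES_cons_cons]; exact Set.subset_insert _ _))
    obtain ⟨yT, yw, yp, yq⟩ := hlT y (by simp)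
    obtain ⟨xT, xw, xp, xq⟩ := hlT x (by simp)
    have yx : y ≠ x := fun h => (List.nodup_cons.1 hl).1 (by simp [h])
    have h₂ := triangle_parity hT hσ hw yT xT hp hq (by
      simp [yw.symm, xw.symm, hwp, hwq, yx, yp, yq, xp, xq, hpq])
    have h₃ : X σ p q y x = false := by
      by_contra hX
      rw [Bool.not_eq_false] at hX
      exact inter_of_X (hT.ne hσ hp hq yT hpq yq.symm yp.symm)
        (hT.ne hσ hp hq xT hpq xq.symm xp.symm) (hT.ne hσ yT xT hp yx xp yp)
        (hT.ne hσ yT xT hq yx xq yq) hX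
        (hc y x (by simp [mem_ES]) yp.symm xp.symm yq.symm xq.symm)
    simp only [fan]
    rw [h₃] at h₂
    clear ih
    generalize fan σ w p (x :: l) = b₁ at *
    generalize fan σ w q (x :: l) = b₂ at *
    generalize inTri σ w y x p = b₃ at *
    generalize inTri σ w y x q = b₄ at *
    generalize X σ p q w y = b₅ at *
    generalize X σ p q w x = b₆ at *
    generalize X σ p q w z = b₇ at *
    revert h h₂
    revert b₁ b₂ b₃ b₄ b₅ b₆ b₇
    clear * -
    decide

/-- Within an open half plane bounded by a line through `a` the angular order around `a` is
transitive. -/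
theorem Ext_trans {σ : ℝ} {a b c d : Plane} {G : Set Plane} (h : Ext a G) (hb : b ∈ G)
    (hc : c ∈ G) (hd : d ∈ G) (h₁ : 0 < D σ a b c) (h₂ : 0 < D σ a c d) : 0 < D σ a b d := by
  obtain ⟨α, β, h⟩ := h
  have := h b hb
  have := h c hc
  have := h d hd
  have key : (α * (c 0 - a 0) + β * (c 1 - a 1)) * D σ a b d =
      (α * (b 0 - a 0) + β * (b 1 - a 1)) * D σ a c d +
      (α * (d 0 - a 0) + β * (d 1 - a 1)) * D σ a b c := by
    unfold D; ring
  have : 0 < (α * (c 0 - a 0) + β * (c 1 - a 1)) * D σ a b d := by rw [key]; positivity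
  exact (mul_pos_iff_of_pos_left (by linarith)).1 this

/-- As `wp` crosses no edge `yx` of the list and all points lie in a half plane at `w`, the triangle
`wyx` contains `p` exactly if the line `wp` separates `y` from `x`. These parities telescope. -/
theorem fan_last {T : Finset Plane} (hT : GP T) {σ : ℝ} (hσ : σ ≠ 0) {w p : Plane}
    (hw : w ∈ T) (hp : p ∈ T) (hwp : w ≠ p) (hext : Ext w (T.erase w))
    {y z : Plane} {l : List Plane} (hz : (y :: l).getLast? = some z) (hl : (y :: l).Nodup)
    (hlT : ∀ x ∈ y :: l, x ∈ T ∧ x ≠ w ∧ x ≠ p)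
    (hc : Clear (ES (y :: l)) w p) :
    fan σ w p (y :: l) = (P σ w p y ^^ P σ w p z) := by
  induction l generalizing y with
  | nil =>
    obtain rfl : y = z := by simpa using hz
    simp [fan]
  | cons x l ih =>
    have h := ih (y := x) (by simpa using hz) hl.of_cons
      (fun u hu => hlT u (List.mem_cons_of_mem _ hu))
      (hc.mono (by rw [ES_cons_cons]; exact Set.subset_insert _ _))
    obtain ⟨yT, yw, yp⟩ := hlT y (by simp)
    obtain ⟨xT, xw, xp⟩ := hlT x (by simp)
    have yx : y ≠ x := fun h => (List.nodup_cons.1 hl).1 (by simp [h])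
    have h₃ : X σ w p y x = false := by
      by_contra hX
      rw [Bool.not_eq_false] at hX
      exact inter_of_X (hT.ne hσ hw hp yT hwp yp.symm yw.symm)
        (hT.ne hσ hw hp xT hwp xp.symm xw.symm) (hT.ne hσ yT xT hw yx xw yw)
        (hT.ne hσ yT xT hp yx xp yp) hX
        (hc y x (by simp [mem_ES]) yw.symm xw.symm yp.symm xp.symm)
    have ny := hT.ne hσ hw hp yT hwp yp.symm yw.symm
    have nx := hT.ne hσ hw hp xT hwp xp.symm xw.symm
    have nyx := hT.ne hσ hw yT xT yw.symm yx xw.symm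
    have r₁ : P σ w y p = !P σ w p y := P_swap ny
    have r₂ : P σ x w p = P σ w p x := P_rot ..
    have r₃ : P σ y x w = P σ w y x := (P_rot ..).symm
    have mem : ∀ u, u ∈ T → u ≠ w → u ∈ ((T.erase w : Finset Plane) : Set Plane) := by
      intro u hu huw; simp [hu, huw]
    have t₁ : P σ w y p = true → P σ w p x = true → P σ w y x = true := by
      intro h₁ h₂
      simp only [P, decide_eq_true_eq] at h₁ h₂ ⊢
      exact Ext_trans hext (mem y yT yw) (mem p hp hwp.symm) (mem x xT xw) h₁ h₂
    have t₂ : P σ w y p = false → P σ w p x = false → P σ w y x = false := by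
      intro h₁ h₂
      have q : P σ w x y = true := by
        have h₃ : P σ w p y = true := by rw [r₁] at h₁; simpa using h₁
        have h₄ : P σ w x p = true := by rw [P_swap nx, h₂]; rfl
        simp only [P, decide_eq_true_eq] at h₃ h₄ ⊢
        exact Ext_trans hext (mem x xT xw) (mem p hp hwp.symm) (mem y yT yw) h₄ h₃
      rw [P_swap nyx] at q
      simpa using q
    simp only [fan, h]
    unfold X at h₃
    unfold inTri
    rw [r₁, r₂]
    rw [r₁] at t₁ t₂
    rw [r₃] at h₃
    clear ih
    generalize P σ w p y = b₁ at *
    generalize P σ w p x = b₂ at *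
    generalize P σ w p z = b₃ at *
    generalize P σ w y x = b₄ at *
    generalize P σ y x p = b₅ at *
    clear h r₁ r₂ r₃
    revert h₃ t₁ t₂
    revert b₁ b₂ b₃ b₄ b₅
    clear * -
    decide

theorem notMem_Tri_of_Ext {a b c d : Plane} {G : Set Plane} (h : Ext a G) (hb : b ∈ G)
    (hc : c ∈ G) (hd : d ∈ G) : a ∉ Tri b c d := by
  obtain ⟨α, β, h⟩ := h
  intro ha
  obtain ⟨s, t, u, hs, ht, hu, hsum, ha⟩ := mem_Tri.1 ha
  have h₁ := h b hb
  have h₂ := h c hc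
  have h₃ := h d hd
  have e : s * (α * (b 0 - a 0) + β * (b 1 - a 1)) + t * (α * (c 0 - a 0) + β * (c 1 - a 1)) +
      u * (α * (d 0 - a 0) + β * (d 1 - a 1)) = 0 := by
    have e₀ : a 0 = s * b 0 + t * c 0 + u * d 0 := by
      have := congrArg (fun v : Plane => v 0) ha; simpa using this
    have e₁ : a 1 = s * b 1 + t * c 1 + u * d 1 := by
      have := congrArg (fun v : Plane => v 1) ha; simpa using this
    obtain rfl : u = 1 - s - t := by linarith
    linear_combination (-α) * e₀ - β * e₁
  have p₁ := mul_nonneg hs h₁.le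
  have p₂ := mul_nonneg ht h₂.le
  have p₃ := mul_nonneg hu h₃.le
  have z₁ : s = 0 := (mul_eq_zero.1 (by linarith)).resolve_right h₁.ne'
  have z₂ : t = 0 := (mul_eq_zero.1 (by linarith)).resolve_right h₂.ne'
  have z₃ : u = 0 := (mul_eq_zero.1 (by linarith)).resolve_right h₃.ne'
  linarith

theorem inTri_mem {σ : ℝ} {w x y p : Plane} (h₁ : D σ w x p ≠ 0) (h₂ : D σ x y p ≠ 0)
    (h₃ : D σ y w p ≠ 0) (h : inTri σ w x y p = true) : p ∈ Tri w x y := by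
  have hadd := D_add σ w x y p
  simp only [inTri, P, Bool.and_eq_true, beq_iff_eq, decide_eq_decide] at h
  rcases lt_or_gt_of_ne h₁ with h₁ | h₁
  · have h₂ : D σ x y p < 0 := lt_of_le_of_ne (not_lt.1 fun h' => h₁.not_gt (h.1.2 h')) h₂
    have h₃ : D σ y w p < 0 := lt_of_le_of_ne (not_lt.1 fun h' => h₂.not_gt (h.2.2 h')) h₃
    refine mem_Tri_of_D (σ := -σ) ?_ ?_ ?_ ?_ <;> rw [D_neg] <;> linarith
  · have h₂ := h.1.1 h₁
    have h₃ := h.2.1 h₂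
    exact mem_Tri_of_D (by linarith) h₁.le h₂.le h₃.le

/-- An extreme point lies in no triangle of other points. It is the starting point, outside the
polygon, in `hull_parity`. -/
theorem fan_outer {T : Finset Plane} (hT : GP T) {σ : ℝ} (hσ : σ ≠ 0) {w s : Plane}
    (hw : w ∈ T) (hs : s ∈ T) (hws : w ≠ s) (hext : Ext s (T.erase s))
    {l : List Plane} (hl : l.Nodup) (hlT : ∀ x ∈ l, x ∈ T ∧ x ≠ w ∧ x ≠ s) :
    fan σ w s l = false := by
  induction l with
  | nil => rfl
  | cons y l ih =>
    cases l with
    | nil => rfl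
    | cons x l =>
      have h := ih hl.of_cons (fun u hu => hlT u (List.mem_cons_of_mem _ hu))
      obtain ⟨yT, yw, ys⟩ := hlT y (by simp)
      obtain ⟨xT, xw, xs⟩ := hlT x (by simp)
      have yx : y ≠ x := fun h => (List.nodup_cons.1 hl).1 (by simp [h])
      have h₂ : inTri σ w y x s = false := by
        by_contra hi
        rw [Bool.not_eq_false] at hi
        exact notMem_Tri_of_Ext hext (by simp [hw, hws]) (by simp [yT, ys]) (by simp [xT, xs])
          (inTri_mem (hT.ne hσ hw yT hs yw.symm ys hws) (hT.ne hσ yT xT hs yx xs ys)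
            (hT.ne hσ xT hw hs xw hws xs) hi)
      simp [fan, h, h₂]

/-- If `tw` and `ww'` are hull edges, a plane spanning path from an extreme point to `t`
cannot pass from `w` to `w'`. -/
theorem hull_parity {T : Finset Plane} (hT : GP T) {σ : ℝ} (hσ : σ ≠ 0) {s t w w' : Plane}
    {A C : List Plane} (h : PH T (s :: A ++ w :: w' :: C))
    (hlast : (w' :: C).getLast? = some t) (hs : Ext s (T.erase s)) (hw : Ext w (T.erase w))
    (h₁ : ∀ x ∈ T, x ≠ t → x ≠ w → 0 < D σ t w x)
    (h₂ : ∀ x ∈ T, x ≠ w → x ≠ w' → 0 < D σ w w' x) : False := by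
  have hnd := h.nodup
  rw [List.nodup_append] at hnd
  obtain ⟨nA, nB, nAB⟩ := hnd
  have hmem : ∀ x, x ∈ s :: A ∨ x ∈ w :: w' :: C → x ∈ T := fun x hx =>
    (h.mem x).1 (List.mem_append.2 hx)
  have hwT : w ∈ T := hmem w (Or.inr (by simp))
  have hw'T : w' ∈ T := hmem w' (Or.inr (by simp))
  have htm : t ∈ w' :: C := List.mem_of_getLast? hlast
  have htT : t ∈ T := hmem t (Or.inr (List.mem_cons_of_mem _ htm))
  have hsT : s ∈ T := hmem s (Or.inl (by simp))
  have hCnd : (w' :: C).Nodup := nB.of_cons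
  have hCw : ∀ x ∈ w' :: C, x ≠ w := fun x hx hxw => (List.nodup_cons.1 nB).1 (hxw ▸ hx)
  have hsub : ES (w' :: C) ⊆ ES (s :: A ++ w :: w' :: C) := by
    rw [ES_append]
    exact fun e he => Or.inr (Or.inr he)
  have hCT : ∀ p ∈ s :: A, ∀ x ∈ w' :: C, x ∈ T ∧ x ≠ w ∧ x ≠ p := fun p hp x hx =>
    ⟨hmem x (Or.inr (List.mem_cons_of_mem _ hx)), hCw x hx,
      (nAB p hp x (List.mem_cons_of_mem _ hx)).symm⟩
  have hAw : ∀ p ∈ s :: A, w ≠ p := fun p hp => (nAB p hp w (by simp)).symm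
  -- The fan parity says whether `p` is inside the closed polygon w, w', …, t. Edges before `w`
  -- cross neither the path from `w'` to `t` nor the hull edges `ww'` and `tw`, so the parity
  -- remains that of `s`.
  have inv : ∀ B p E, s :: A = B ++ p :: E → fan σ w p (w' :: C) = false := by
    intro B
    induction B using List.reverseRecOn with
    | nil =>
      intro p E hp
      obtain ⟨rfl, -⟩ : s = p ∧ A = E := by simpa using hp
      exact fan_outer hT hσ hwT hsT (hAw s (by simp)) hs hCnd (hCT s (by simp))
    | append_singleton B q ih =>
      intro p E hp
      have hq := ih q (p :: E) (by simpa using hp)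
      have hqm : q ∈ s :: A := by rw [hp]; simp
      have hpm : p ∈ s :: A := by rw [hp]; simp
      have hqp : q ≠ p := by
        rintro rfl
        rw [hp, List.append_assoc] at nA
        simpa using (List.nodup_append.1 nA).2.1
      have hqT := hmem q (Or.inl hqm)
      have hpT := hmem p (Or.inl hpm)
      have hfe := fan_edge hT hσ hwT hqT hpT (hAw q hqm) (hAw p hpm) hqp hlast hCnd
        (fun x hx => ⟨hmem x (Or.inr (List.mem_cons_of_mem _ hx)), hCw x hx,
          (hCT q hqm x hx).2.2, (hCT p hpm x hx).2.2⟩)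
        ((h.nc q p (by
          rw [hp, List.append_assoc, List.append_assoc, List.singleton_append, List.cons_append,
            ES_append]
          exact Or.inl rfl)).mono hsub)
      have x₁ : ∀ u ∈ s :: A, P σ w w' u = true := fun u hu =>
        P_true (h₂ u (hmem u (Or.inl hu)) (hAw u hu).symm (hCT u hu w' (by simp)).2.2.symm)
      have x₂ : ∀ u ∈ s :: A, P σ w t u = false := fun u hu => by
        have := h₁ u (hmem u (Or.inl hu)) (hCT u hu t htm).2.2.symm (hAw u hu).symm
        rw [D_rot] at this
        exact P_false this
      simp only [X, x₁ p hpm, x₁ q hqm, x₂ p hpm, x₂ q hqm, hq] at hfe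
      simpa using hfe
  obtain ⟨B, p, hBp⟩ : ∃ B p, s :: A = B ++ [p] :=
    ⟨(s :: A).dropLast, (s :: A).getLast (by simp), (List.dropLast_append_getLast _).symm⟩
  have hpm : p ∈ s :: A := by rw [hBp]; simp
  have hpT := hmem p (Or.inl hpm)
  -- The edge from the predecessor `p` to `w` enters the angle between `wt` and `ww'` without
  -- crossing the path from `w'` to `t`. So `p` is inside the polygon, against the invariant.
  have h₃ := inv B p [] hBp
  rw [fan_last hT hσ hwT hpT (hAw p hpm) hw hlast hCnd (hCT p hpm), P_false
    (h₂ p hpT (hAw p hpm).symm (hCT p hpm w' (by simp)).2.2.symm), P_rot, P_rot, P_true (h₁ p hpT (hCT p hpm t htm).2.2.symm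
      (hAw p hpm).symm)] at h₃
  · simp at h₃
  · refine (h.nc w p ?_).mono hsub
    rw [hBp, List.append_assoc, List.singleton_append, ES_append, Sym2.eq_swap]
    exact Or.inl rfl

end PlanePaths

/-! ### Inner points, hull edges and the configuration of a tail of inner points -/

namespace PlanePaths

open List

/-- `x` is a point of `T` which is not an extreme point of `T`. -/
def Inner (T : Finset Plane) (x : Plane) : Prop :=
  x ∈ T ∧ x ∈ convexHull ℝ ((T : Set Plane) \ {x})

/-- The inner points of `T` are in convex position. -/
def TwoLayer (T : Finset Plane) : Prop :=
  ∀ x, Inner T x → x ∉ convexHull ℝ ({y | Inner T y} \ {x})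

theorem Inner.mono {T U : Finset Plane} {x : Plane} (h : Inner U x) (hUT : U ⊆ T) : Inner T x :=
  ⟨hUT h.1, convexHull_mono (Set.sdiff_subset_sdiff_left (by exact_mod_cast hUT)) h.2⟩

/-- Points that are inner in a subset are inner in the whole set, so convex position of the inner
points is inherited. This is what permits induction over subsets. -/
theorem TwoLayer.mono {T U : Finset Plane} (h : TwoLayer T) (hUT : U ⊆ T) : TwoLayer U :=
  fun x hx hx' => h x (hx.mono hUT) (convexHull_mono
    (Set.sdiff_subset_sdiff_left fun _ hy => Inner.mono hy hUT) hx')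

theorem ext_of_not_inner {T : Finset Plane} {x : Plane} (hx : x ∈ T) (h : ¬ Inner T x) :
    Ext x (T.erase x) := by
  refine Ext_of_notMem_convexHull (Finset.finite_toSet _) fun h' => h ⟨hx, ?_⟩
  rwa [Finset.coe_erase] at h'

theorem Ext.notMem_convexHull {a : Plane} {G : Set Plane} (h : Ext a G) : a ∉ convexHull ℝ G := by
  obtain ⟨α, β, h⟩ := h
  intro ha
  have hK : Convex ℝ {g : Plane | 0 < α * (g 0 - a 0) + β * (g 1 - a 1)} := by
    rintro x hx y hy s t hs ht hst
    simp only [Set.mem_ofPred_eq, PiLp.add_apply, PiLp.smul_apply, smul_eq_mul] at hx hy ⊢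
    have e : α * (s * x 0 + t * y 0 - a 0) + β * (s * x 1 + t * y 1 - a 1) =
        s * (α * (x 0 - a 0) + β * (x 1 - a 1)) + t * (α * (y 0 - a 0) + β * (y 1 - a 1)) := by
      obtain rfl : t = 1 - s := by linarith
      ring
    rw [e]
    rcases eq_or_lt_of_le hs with rfl | hs
    · obtain rfl : t = 1 := by linarith
      simpa using hy
    · have := mul_nonneg ht hy.le
      have := mul_pos hs hx
      linarith
  have : 0 < α * (a 0 - a 0) + β * (a 1 - a 1) := convexHull_min (fun g hg => h g hg) hK ha
  simp at this

theorem not_inner_of_ext {T : Finset Plane} {x : Plane} (h : Ext x (T.erase x)) : ¬ Inner T x := by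
  intro hx
  refine h.notMem_convexHull ?_
  rw [Finset.coe_erase]
  exact hx.2

theorem TwoLayer.ext {T : Finset Plane} (h : TwoLayer T) {x : Plane} (hx : Inner T x) :
    Ext x ({y | Inner T y} \ {x}) := by
  refine Ext_of_notMem_convexHull (Set.Finite.subset T.finite_toSet fun y hy => hy.1.1) (h x hx)

theorem eq_of_mem_Tri_of_not_inner {T : Finset Plane} {a b c d : Plane} (ha : a ∈ T) (hb : b ∈ T)
    (hc : c ∈ T) (hd : d ∈ T) (hdo : ¬ Inner T d) (h : d ∈ Tri a b c) : d = a ∨ d = b ∨ d = c := by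
  by_contra! hcon
  refine hdo ⟨hd, Tri_subset (convex_convexHull ℝ _) ?_ ?_ ?_ h⟩ <;>
    refine subset_convexHull _ _ ⟨by assumption, fun h => ?_⟩
  · exact hcon.1 h.symm
  · exact hcon.2.1 h.symm
  · exact hcon.2.2 h.symm

/-- An inner point in the triangle would contradict convex position, and an extreme point lies in no
triangle of other points. Emptiness of triangles with inner corners is the main form in which the
two-layer hypothesis is used. -/
theorem TwoLayer.eq_of_mem_Tri {T : Finset Plane} (hT : TwoLayer T) {a b c d : Plane}
    (ha : Inner T a) (hb : Inner T b) (hc : Inner T c) (hd : d ∈ T) (h : d ∈ Tri a b c) :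
    d = a ∨ d = b ∨ d = c := by
  by_cases hdi : Inner T d
  · by_contra! hcon
    refine hT d hdi (Tri_subset (convex_convexHull ℝ _) ?_ ?_ ?_ h) <;>
      refine subset_convexHull _ _ ⟨by assumption, fun h => ?_⟩
    · exact hcon.1 h.symm
    · exact hcon.2.1 h.symm
    · exact hcon.2.2 h.symm
  · exact eq_of_mem_Tri_of_not_inner ha.1 hb.1 hc.1 hd hdi h

/-- All points of `T` except `a` and `b` are on the same side of the line `ab`. -/
def HullEdge (T : Finset Plane) (a b : Plane) : Prop :=
  a ≠ b ∧ ∃ σ : ℝ, ∀ x ∈ T, x ≠ a → x ≠ b → 0 < D σ a b x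

theorem HullEdge.symm {T : Finset Plane} {a b : Plane} (h : HullEdge T a b) : HullEdge T b a := by
  obtain ⟨hab, σ, h⟩ := h
  refine ⟨hab.symm, -σ, fun x hx hb ha => ?_⟩
  rw [D_neg, ← D_swap']
  exact h x hx ha hb

theorem HullEdge.not_inner_left {T : Finset Plane} {a b : Plane} (h : HullEdge T a b) :
    ¬ Inner T a := by
  obtain ⟨hab, σ, h⟩ := h
  rintro ⟨-, ha⟩
  have hK : Convex ℝ {x : Plane | x = b ∨ 0 < D σ a b x} := by
    rintro x hx y hy s t hs ht hst
    have key : ∀ {z}, z = b ∨ 0 < D σ a b z → 0 ≤ D σ a b z := by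
      rintro z (rfl | hz)
      · simp
      · exact hz.le
    by_cases hxb : x = b
    · by_cases hyb : y = b
      · left
        rw [hxb, hyb, ← add_smul, hst, one_smul]
      · have hy' := hy.resolve_left hyb
        rcases eq_or_lt_of_le ht with rfl | ht
        · left
          obtain rfl : s = 1 := by linarith
          simpa using hxb
        · right
          rw [D_comb₂ σ hst]
          have := mul_nonneg hs (key hx)
          have := mul_pos ht hy'
          linarith
    · have hx' := hx.resolve_left hxb
      rcases eq_or_lt_of_le hs with rfl | hs
      · obtain rfl : t = 1 := by linarith
        simpa using hy
      · right
        rw [D_comb₂ σ hst]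
        have := mul_nonneg ht (key hy)
        have := mul_pos hs hx'
        linarith
  have := convexHull_min (fun g hg => ?_) hK ha
  · rcases this with this | this
    · exact hab this
    · simp at this
  · by_cases hgb : g = b
    · exact Or.inl hgb
    · exact Or.inr (h g hg.1 hg.2 hgb)

theorem HullEdge.not_inner_right {T : Finset Plane} {a b : Plane} (h : HullEdge T a b) :
    ¬ Inner T b := h.symm.not_inner_left

/-- The segments between points of `E`. -/
def segs (E : Finset Plane) : Set (Sym2 Plane) := {p | ∃ u ∈ E, ∃ v ∈ E, u ≠ v ∧ p = s(u, v)}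

theorem mem_segs {E : Finset Plane} {u v : Plane} : s(u, v) ∈ segs E ↔ u ∈ E ∧ v ∈ E ∧ u ≠ v := by
  constructor
  · rintro ⟨a, ha, b, hb, hab, h⟩
    rcases Sym2.eq_iff.1 h with ⟨rfl, rfl⟩ | ⟨rfl, rfl⟩
    · exact ⟨ha, hb, hab⟩
    · exact ⟨hb, ha, hab.symm⟩
  · rintro ⟨hu, hv, h⟩
    exact ⟨u, hu, v, hv, h, rfl⟩

/-- The edges of the path `R` and the edge joining it to `e`. -/
def RE (R : List Plane) (k e : Plane) : Set (Sym2 Plane) := insert s(k, e) (ES R)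

/-- A path `R` from which an edge `ke` leads to a set `E` of inner points that may be visited in
any order. -/
structure Conf (T : Finset Plane) (R : List Plane) (k e : Plane) (E : Finset Plane) : Prop where
  gp : GP T
  two : TwoLayer T
  memT : ∀ x ∈ R, x ∈ T
  cover : ∀ x ∈ T, x ∈ R ∨ x ∈ E
  inner : ∀ x ∈ E, Inner T x
  disj : ∀ x ∈ R, x ∉ E
  nodup : R.Nodup
  last : R.getLast? = some k
  outer : ¬ Inner T k
  start : e ∈ E
  -- All segments between points of `E` are avoided, not just those on the present path, so that `E`
  -- can be reordered.
  clear : ∀ a b, s(a, b) ∈ RE R k e → Clear (RE R k e ∪ segs E) a b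

/-- The edges of the path and the segments between points of `E`. -/
abbrev Ob (R : List Plane) (k e : Plane) (E : Finset Plane) : Set (Sym2 Plane) :=
  RE R k e ∪ segs E

theorem GP.eq_or_eq_of_mem_segment {T : Finset Plane} (hT : GP T) {a b q : Plane} (ha : a ∈ T)
    (hb : b ∈ T) (hq : q ∈ T) (h : q ∈ segment ℝ a b) : q = a ∨ q = b := by
  by_contra! hcon
  by_cases hab : a = b
  · subst hab
    simp only [segment_same, Set.mem_singleton_iff] at h
    exact hcon.1 h
  · exact hT a ha b hb q hq hab hcon.2.symm hcon.1.symm (D_of_mem_segment h)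

namespace Conf

variable {T : Finset Plane} {R : List Plane} {k e : Plane} {E : Finset Plane}

theorem k_mem (h : Conf T R k e E) : k ∈ R := List.mem_of_getLast? h.last

theorem ne_of_mem (h : Conf T R k e E) {x y : Plane} (hx : x ∈ R) (hy : y ∈ E) : x ≠ y :=
  fun hxy => h.disj x hx (hxy ▸ hy)

theorem of_RE (h : Conf T R k e E) {a b : Plane} (hab : s(a, b) ∈ RE R k e) :
    a ≠ b ∧ (a ∈ R ∨ a = e) ∧ (b ∈ R ∨ b = e) := by
  rcases hab with hab | hab
  · have := h.ne_of_mem h.k_mem h.start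
    rcases Sym2.eq_iff.1 hab with ⟨rfl, rfl⟩ | ⟨rfl, rfl⟩
    · exact ⟨this, Or.inl h.k_mem, Or.inr rfl⟩
    · exact ⟨this.symm, Or.inr rfl, Or.inl h.k_mem⟩
  · have := mem_of_mem_edgesL hab
    exact ⟨ne_of_mem_edgesL h.nodup hab, Or.inl this.1, Or.inl this.2⟩

theorem of_Ob (h : Conf T R k e E) {a b : Plane} (hab : s(a, b) ∈ Ob R k e E) :
    a ≠ b ∧ a ∈ T ∧ b ∈ T := by
  have he : ∀ x, x ∈ R ∨ x = e → x ∈ T := by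
    rintro x (hx | rfl)
    · exact h.memT x hx
    · exact (h.inner x h.start).1
  rcases hab with hab | hab
  · have := h.of_RE hab
    exact ⟨this.1, he a this.2.1, he b this.2.2⟩
  · rw [mem_segs] at hab
    exact ⟨hab.2.2, (h.inner a hab.1).1, (h.inner b hab.2.1).1⟩

/-- An edge of the path meets an edge of the path or a segment between points of `E` only in a
common endpoint. -/
theorem touch (h : Conf T R k e E) {a b x v r : Plane} (hxv : s(x, v) ∈ RE R k e)
    (hab : s(a, b) ∈ Ob R k e E) (hr : r ∈ segment ℝ x v) (hr' : r ∈ segment ℝ a b) :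
    s(a, b) = s(x, v) ∨ (r = x ∧ (a = x ∨ b = x)) ∨ (r = v ∧ (a = v ∨ b = v)) := by
  obtain ⟨hab', ha, hb⟩ := h.of_Ob hab
  obtain ⟨hxv', hx, hv⟩ := h.of_Ob (Or.inl hxv)
  have key : ∀ {p q s t : Plane}, p ∈ T → q ∈ T → t ∈ T → p ≠ q → s = p → s ≠ t → q ≠ t →
      s ∈ T → r ∈ segment ℝ p q → r ∈ segment ℝ s t → r = p := by
    rintro p q s t hp hq ht hpq rfl hst hqt - h₁ h₂
    exact segment_inter_of_D (h.gp s hp q hq t ht hpq hqt hst) h₁ h₂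
  by_cases hax : a = x
  · by_cases hbv : b = v
    · left; rw [hax, hbv]
    · exact Or.inr (Or.inl ⟨key hx hv hb hxv' hax hab' (Ne.symm hbv) ha hr hr', Or.inl hax⟩)
  by_cases hbx : b = x
  · by_cases hav : a = v
    · left; rw [hbx, hav, Sym2.eq_swap]
    · exact Or.inr (Or.inl ⟨key hx hv ha hxv' hbx hab'.symm (Ne.symm hav) hb hr
        (by rwa [segment_symm]), Or.inr hbx⟩)
  by_cases hav : a = v
  · exact Or.inr (Or.inr ⟨key hv hx hb hxv'.symm hav hab' (Ne.symm hbx) ha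
      (by rwa [segment_symm]) hr', Or.inl hav⟩)
  by_cases hbv : b = v
  · exact Or.inr (Or.inr ⟨key hv hx ha hxv'.symm hbv hab'.symm (Ne.symm hax) hb
      (by rwa [segment_symm]) (by rwa [segment_symm]), Or.inr hbv⟩)
  exact absurd hr' (Set.disjoint_left.1 (h.clear x v hxv a b hab (Ne.symm hax) (Ne.symm hbx)
    (Ne.symm hav) (Ne.symm hbv)) hr)

end Conf

end PlanePaths

/-! ### Which edges can block a sightline -/

namespace PlanePaths

open List

theorem eq_of_mem_segments {a b x : Plane} (h₁ : a ∈ segment ℝ b x) (h₂ : b ∈ segment ℝ x a) :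
    a = b := by
  rw [segment_symm] at h₂
  rw [mem_segment_iff_wbtw] at h₁ h₂
  exact (wbtw_swap_left_iff ℝ x).1 ⟨h₂, h₁⟩

theorem eq_of_mem_segment_of_D {σ : ℝ} {f p q u w : Plane} (hq : q ∈ segment ℝ f p)
    (hp : D σ u w p = 0) (hq0 : D σ u w q = 0) (hf : D σ u w f ≠ 0) : q = p := by
  obtain ⟨s, t, -, -, hst, rfl⟩ := hq
  rw [D_comb₂ σ hst, hp] at hq0
  have hs : s = 0 := by simpa [hf] using hq0
  obtain rfl : t = 1 := by linarith
  simp [hs]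

theorem exists_sign {a b c : Plane} (h : D 1 a b c ≠ 0) : ∃ σ : ℝ, σ ≠ 0 ∧ 0 < D σ a b c := by
  refine ⟨D 1 a b c, h, ?_⟩
  rw [D_scale]
  exact mul_self_pos.2 h

theorem ne_zero_of_D {σ : ℝ} {a b c : Plane} (h : 0 < D σ a b c) : σ ≠ 0 := by
  rintro rfl
  simp [D] at h

theorem ne_of_D {σ : ℝ} {a b c : Plane} (h : 0 < D σ a b c) : a ≠ b ∧ b ≠ c ∧ a ≠ c := by
  refine ⟨?_, ?_, ?_⟩ <;> rintro rfl <;> simp at h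

/-- A point on the ray from `f` through `p`, seen along that ray. -/
theorem D_of_mem_ray {σ : ℝ} {f p z : Plane} (h : z ∈ segment ℝ f p) (hz : z ≠ f) :
    ∃ s : ℝ, 0 < s ∧ ∀ w, D σ f z w = s * D σ f p w := by
  obtain ⟨s, t, -, ht, hst, rfl⟩ := h
  refine ⟨t, lt_of_le_of_ne ht ?_, fun w => ?_⟩
  · rintro rfl
    obtain rfl : s = 1 := by linarith
    simp at hz
  · rw [D_swap, D_comb₂ σ hst, D_swap σ f p w]
    simp

/-- An edge crossing `fp` would enter the triangle `fgp`. It cannot end inside by `H₄`, cannot leave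
through `fg` by `H₁`, and cannot leave through `gp`, which is part of the path edge `xv`. The vertex
`v` may sit at the corner `g`; `H₃` keeps its other edges out of the triangle. -/
theorem Conf.reach {T : Finset Plane} {R : List Plane} {k e : Plane} {E : Finset Plane}
    (h : Conf T R k e E) {σ : ℝ} {f g x v p : Plane} (hxv : s(x, v) ∈ RE R k e)
    (hg : g ∈ segment ℝ x v) (hpos : 0 < D σ f g x) (hp : p ∈ segment ℝ g x) (hpg : p ≠ g)
    (H₁ : ∀ a b, s(a, b) ∈ Ob R k e E → a ≠ f → b ≠ f → ∀ q ∈ segment ℝ a b,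
      q ∈ segment ℝ f g → q = g)
    (H₃ : g = v → ∀ b, s(v, b) ∈ Ob R k e E → b ≠ x → b ≠ f → ∀ q ∈ segment ℝ v b,
      q ∈ Tri f g x → q = v)
    (H₄ : ∀ w ∈ T, w ∈ Tri f g p → w ∈ segment ℝ f p ∨ (w = v ∧ v = g))
    (H₅ : ∀ w ∈ T, D σ f p w = 0 → w ∈ segment ℝ f p)
    {a b : Plane} (hab : s(a, b) ∈ Ob R k e E) (haf : a ≠ f) (hbf : b ≠ f) {q : Plane}
    (hq : q ∈ segment ℝ a b) (hqp : q ∈ segment ℝ f p) :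
    a ∈ segment ℝ f p ∨ b ∈ segment ℝ f p ∨ q = p := by
  by_contra! hcon
  obtain ⟨haP, hbP, hqne⟩ := hcon
  obtain ⟨-, haT, hbT⟩ := h.of_Ob hab
  have hfp : 0 < D σ f g p :=
    D_pos_of_mem_segment hpos (by simp) (by rwa [segment_symm]) hpg
  have hpfg : 0 < D σ p f g := by rwa [D_rot]
  -- Let `b` be the end on the same side of `fp` as `g`.
  wlog hb : 0 < D σ p f b generalizing a b
  · refine this (by rwa [Sym2.eq_swap]) hbf haf (by rwa [segment_symm]) hbP haP hbT haT ?_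
    have h₁ : D σ f p q = 0 := D_of_mem_segment hqp
    rcases D_opposite h₁ hq (fun h0 => haP (H₅ a haT h0)) (fun h0 => hbP (H₅ b hbT h0)) with
      ⟨h₂, h₃⟩ | ⟨h₂, h₃⟩
    · exact absurd (by rw [D_swap']; linarith) hb
    · rw [D_swap']; linarith
  have ha : D σ p f a < 0 := by
    have h₁ : D σ f p q = 0 := D_of_mem_segment hqp
    rw [D_swap'] at hb ⊢
    rcases D_opposite h₁ hq (fun h0 => haP (H₅ a haT h0)) (fun h0 => hbP (H₅ b hbT h0)) with
      ⟨h₂, h₃⟩ | ⟨h₂, h₃⟩ <;> linarith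
  have hpxv : p ∈ segment ℝ x v :=
    (convex_segment x v).segment_subset hg (left_mem_segment ℝ x v) hp
  have hxvf : D σ x v f ≠ 0 := by
    intro h0
    obtain ⟨s, t, -, -, hst, rfl⟩ := hg
    rw [D_rot, D_rot, D_comb₂ σ hst] at hpos
    rw [← D_rot, D_swap'] at h0
    simp only [D_self_outer, mul_zero, zero_add, neg_eq_zero.1 h0] at hpos
    simp at hpos
  have onLine : q ∈ segment ℝ x v → False := fun hqx =>
    hqne (eq_of_mem_segment_of_D hqp (D_of_mem_segment hpxv) (D_of_mem_segment hqx) hxvf)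
  by_cases hbTri : b ∈ Tri p f g
  · rcases H₄ b hbT (by rwa [Tri_comm₁ p f g, Tri_comm₂ f p g] at hbTri) with h' | ⟨rfl, rfl⟩
    · exact hbP h'
    · by_cases hax : a = x
      · subst hax
        exact onLine hq
      · have hqT : q ∈ Tri f b x := by
          refine (convex_Tri f b x).segment_subset (Tri_left f b x) ?_ hqp
          exact (convex_Tri f b x).segment_subset (Tri_mid f b x) (Tri_right f b x) hp
        have := H₃ rfl a (by rwa [Sym2.eq_swap]) hax haf q (by rwa [segment_symm]) hqT
        subst this
        have := D_of_mem_segment (σ := σ) hqp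
        rw [D_swap] at this
        linarith
  obtain ⟨r, hr, hr'⟩ := exit hpfg (by rwa [segment_symm]) hb hbTri
  have hrab : r ∈ segment ℝ a b :=
    (convex_segment a b).segment_subset hq (right_mem_segment ℝ a b) hr
  have hrpg : r ∈ segment ℝ p g := by
    rcases hr' with hr' | hr'
    · exact hr'
    · rw [H₁ a b hab haf hbf r hrab hr']
      exact right_mem_segment ℝ p g
  have hrgx : r ∈ segment ℝ g x :=
    (convex_segment g x).segment_subset hp (left_mem_segment ℝ g x) hrpg
  have hrxv : r ∈ segment ℝ x v :=
    (convex_segment x v).segment_subset hpxv hg hrpg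
  rcases h.touch hxv hab hrxv hrab with h' | ⟨rfl, h'⟩ | ⟨rfl, h'⟩
  · refine onLine ?_
    rcases Sym2.eq_iff.1 h' with ⟨rfl, rfl⟩ | ⟨rfl, rfl⟩
    · exact hq
    · rwa [segment_symm]
  · have : r = p := eq_of_mem_segments hrpg hp
    subst this
    rcases h' with rfl | rfl
    · exact haP (right_mem_segment ℝ f _)
    · exact hbP (right_mem_segment ℝ f _)
  · have : r = g := eq_of_mem_segments hrgx hg
    subst this
    rcases h' with rfl | rfl
    · linarith
    · exact hbTri (Tri_right p f _)

/-- An edge of `R` which is not a hull edge and near which the inner point `f` can be inserted. -/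
def Prog (T : Finset Plane) (R : List Plane) (O : Set (Sym2 Plane)) (f : Plane) : Prop :=
  ∃ A a b B, R = A ++ a :: b :: B ∧ ¬ HullEdge T a b ∧ Clear O f a ∧
    (¬ Inner T b ∨ Clear O f b)

theorem prev_of_edge {A B : List Plane} {g g' b : Plane} (hn : (A ++ g :: g' :: B).Nodup)
    (hb : s(g, b) ∈ ES (A ++ g :: g' :: B)) (hbg : b ≠ g') : ∃ A', A = A' ++ [b] := by
  have hn' := List.nodup_append.1 hn
  rw [ES_append] at hb
  rcases hb with hb | hb | hb
  · rcases Sym2.eq_iff.1 hb with ⟨-, h⟩ | ⟨h₁, h₂⟩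
    · exact absurd h hbg
    · exact absurd (h₂.trans h₁) hbg
  · rcases List.eq_nil_or_concat A with rfl | ⟨A', y, rfl⟩
    · simp at hb
    · refine ⟨A', ?_⟩
      rw [List.concat_eq_append, List.append_assoc, List.singleton_append, ES_append] at hb
      rcases hb with hb | hb | hb
      · rcases Sym2.eq_iff.1 hb with ⟨h₁, h₂⟩ | ⟨h₁, h₂⟩
        · exact absurd h₁.symm (hn'.2.2 y (by simp) g (by simp))
        · rw [h₂]; simp
      · have := (mem_of_mem_edgesL hb).1
        exact absurd rfl (hn'.2.2 g (by simpa using this) g (by simp))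
      · simp at hb
  · have := (mem_of_mem_edgesL hb).1
    exact absurd this (List.nodup_cons.1 hn'.2.1).1

namespace Conf

variable {T : Finset Plane} {R : List Plane} {k e : Plane} {E : Finset Plane}

theorem edge_mem (_ : Conf T R k e E) {A B : List Plane} {a b : Plane}
    (hR : R = A ++ a :: b :: B) : s(a, b) ∈ RE R k e := by
  refine Or.inr ?_
  rw [hR, ES_append]
  exact Or.inl rfl

/-- The triangle `fyg` has inner corners and hence contains no other point of `T`. An edge entering
it through `fy` would have to leave through `fg`, which is a free sightline, or through the path
edge `gy`. Only an edge ending in `g` escapes this. -/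
theorem block (h : Conf T R k e E) {f g y a b q : Plane} (hf : f ∈ E) (hg : g ∈ R)
    (hgi : Inner T g) (hgy : s(g, y) ∈ ES R) (hyi : Inner T y) (hc : Clear (Ob R k e E) f g)
    (hab : s(a, b) ∈ Ob R k e E) (haf : a ≠ f) (hbf : b ≠ f) (hay : a ≠ y) (hby : b ≠ y)
    (hq : q ∈ segment ℝ a b) (hq' : q ∈ segment ℝ f y) : a = g ∨ b = g := by
  by_contra! hcon
  obtain ⟨hag, hbg⟩ := hcon
  obtain ⟨-, haT, hbT⟩ := h.of_Ob hab
  have hfT := (h.inner f hf).1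
  have hyR := (mem_of_mem_edgesL hgy).2
  have hfy : f ≠ y := (h.ne_of_mem hyR hf).symm
  have hfg : f ≠ g := (h.ne_of_mem hg hf).symm
  have hyg : y ≠ g := (ne_of_mem_edgesL h.nodup hgy).symm
  obtain ⟨σ, hσ, hpos⟩ := exists_sign (h.gp f hfT y hyi.1 g hgi.1 hfy hyg hfg)
  have nz : ∀ w ∈ T, w ≠ f → w ≠ y → D σ f y w ≠ 0 := fun w hw hwf hwy =>
    h.gp.ne hσ hfT hyi.1 hw hfy hwy.symm hwf.symm
  have h₁ : D σ f y q = 0 := D_of_mem_segment hq'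
  wlog hb : 0 < D σ f y b generalizing a b
  · refine this (by rwa [Sym2.eq_swap]) hbf haf hby hay (by rwa [segment_symm]) hbg hag hbT haT ?_
    rcases D_opposite h₁ hq (nz a haT haf hay) (nz b hbT hbf hby) with h₂ | h₂
    · exact h₂.1
    · exact absurd h₂.2 hb
  have hbTri : b ∉ Tri f y g := by
    intro hb'
    rcases h.two.eq_of_mem_Tri (h.inner f hf) hyi hgi hbT hb' with h' | h' | h'
    · exact hbf h'
    · exact hby h'
    · exact hbg h'
  obtain ⟨r, hr, hr'⟩ := exit hpos hq' hb hbTri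
  have hrab : r ∈ segment ℝ a b :=
    (convex_segment a b).segment_subset hq (right_mem_segment ℝ a b) hr
  rcases hr' with hr' | hr'
  · exact Set.disjoint_left.1 (hc a b hab haf.symm hbf.symm hag.symm hbg.symm) hr' hrab
  · rw [segment_symm] at hr'
    exact Set.disjoint_left.1 (h.clear g y (Or.inr hgy) a b hab hag.symm hbg.symm hay.symm
      hby.symm) hr' hrab

/-- If `f` sees the inner vertex `g` of the path and cannot be inserted next to it, then the edge
before `g` hides the successor of `g` from `f`. -/
theorem stepV (h : Conf T R k e E) {f g : Plane} (hf : f ∈ E) (hg : g ∈ R)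
    (hgi : Inner T g) (hc : Clear (Ob R k e E) f g) (hn : ¬ Prog T R (Ob R k e E) f) :
    ∃ A x g' B, R = A ++ x :: g :: g' :: B ∧ ¬ Inner T x ∧ Inner T g' ∧
      (∀ σ, 0 < D σ f g g' → 0 < D σ f g x) ∧
      (∀ σ, 0 < D σ f g x → D σ g x g' < 0) := by
  obtain ⟨A, C, hR⟩ := List.append_of_mem hg
  cases C with
  | nil =>
    have := h.last
    rw [hR] at this
    simp only [List.getLast?_append, List.getLast?_singleton, Option.some_or] at this
    obtain rfl : g = k := by simpa using this
    exact absurd hgi h.outer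
  | cons g' B =>
    have hnd := h.nodup
    have hgg' : s(g, g') ∈ ES R := by rw [hR, ES_append]; exact Or.inl rfl
    have hg'R := (mem_of_mem_edgesL hgg').2
    have hnh : ¬ HullEdge T g g' := fun hh => hh.not_inner_left hgi
    have hg'i : Inner T g' := by
      by_contra hcon
      exact hn ⟨A, g, g', B, hR, hnh, hc, Or.inl hcon⟩
    have hncl : ¬ Clear (Ob R k e E) f g' := fun hcl =>
      hn ⟨A, g, g', B, hR, hnh, hc, Or.inr hcl⟩
    have getx : ∀ b, s(g, b) ∈ Ob R k e E → b ≠ f → b ≠ g' → ∃ A', A = A' ++ [b] := by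
      intro b hb hbf hbg
      rcases hb with (hb | hb) | hb
      · exfalso
        rcases Sym2.eq_iff.1 hb with ⟨rfl, -⟩ | ⟨rfl, -⟩
        · exact h.outer hgi
        · exact h.disj _ hg h.start
      · exact prev_of_edge (hR ▸ hnd) (by rw [← hR]; exact hb) hbg
      · exact absurd (mem_segs.1 hb).1 (h.disj g hg)
    -- The point `g'` is hidden from `f`, and by `block` only by an edge at `g`. Besides `gg'` the
    -- only candidate is the edge from the predecessor `x`.
    have hx : ∃ A' x, A = A' ++ [x] ∧ x ≠ f ∧ ∃ q, q ∈ segment ℝ g x ∧ q ∈ segment ℝ f g' := by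
      unfold Clear at hncl
      push Not at hncl
      obtain ⟨a, b, hab, haf, hbf, hag, hbg, hd⟩ := hncl
      obtain ⟨q, hq', hq⟩ := Set.not_disjoint_iff.1 hd
      rcases h.block hf hg hgi hgg' hg'i hc hab haf.symm hbf.symm hag.symm hbg.symm hq hq' with
        rfl | rfl
      · obtain ⟨A', hA⟩ := getx b hab hbf.symm hbg.symm
        exact ⟨A', b, hA, hbf.symm, q, hq, hq'⟩
      · obtain ⟨A', hA⟩ := getx a (by rwa [Sym2.eq_swap]) haf.symm hag.symm
        exact ⟨A', a, hA, haf.symm, q, by rwa [segment_symm], hq'⟩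
    obtain ⟨A', x, rfl, hxf, q, hq, hq'⟩ := hx
    have hR' : R = A' ++ x :: g :: g' :: B := by simpa using hR
    have hxgE : s(x, g) ∈ ES R := by rw [hR', ES_append]; exact Or.inl rfl
    have hxR := (mem_of_mem_edgesL hxgE).1
    have hxT := h.memT x hxR
    have hfT := (h.inner f hf).1
    have hfg : f ≠ g := (h.ne_of_mem hg hf).symm
    have hfg' : f ≠ g' := (h.ne_of_mem hg'R hf).symm
    have hgx : g ≠ x := (ne_of_mem_edgesL h.nodup hxgE).symm
    have hgg : g ≠ g' := ne_of_mem_edgesL h.nodup hgg'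
    have hxg' : x ≠ g' := by
      rintro rfl
      have := h.nodup
      rw [hR'] at this
      simpa using (List.nodup_append.1 this).2.1
    have side : ∀ σ, σ ≠ 0 → 0 < D σ f g g' → 0 < D σ f g x := by
      intro σ hσ h₁
      have hqf : q ≠ f := by
        rintro rfl
        rcases h.gp.eq_or_eq_of_mem_segment hgi.1 hxT hfT hq with h' | h'
        · exact hfg h'
        · exact hxf h'.symm
      have h₂ : 0 < D σ f g q := D_pos_of_mem_segment h₁ (by simp) (by rwa [segment_symm]) hqf
      by_contra hcon
      have h₃ : 0 ≤ D (-σ) f g x := by rw [D_neg]; linarith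
      have h₄ := D_nonneg_of_mem_segment (σ := -σ) (p := f) (q := g) (u := g) (v := x)
        (by simp) h₃ hq
      rw [D_neg] at h₄
      linarith
    have side' : ∀ σ, 0 < D σ f g x → D σ g x g' < 0 := by
      intro σ h₁
      have hσ := ne_zero_of_D h₁
      rw [D_rot] at h₁
      have := D_opposite (D_of_mem_segment (σ := σ) hq) hq' h₁.ne'
        (h.gp.ne hσ hgi.1 hxT hg'i.1 hgx hxg' hgg)
      rcases this with ⟨-, h₂⟩ | ⟨h₂, -⟩ <;> linarith
    -- If `x` were inner, `f` could be inserted between `x` and `g` unless `gg'` hides `x`. But `xg`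
    -- hiding `g'` and `gg'` hiding `x` force opposite orientations of `f`, `x`, `g'`.
    refine ⟨A', x, g', B, hR', fun hxi => ?_, hg'i, fun σ hσ => side σ (ne_zero_of_D hσ) hσ, side'⟩
    refine hn ⟨A', x, g, g' :: B, hR', fun hh => hh.not_inner_right hgi, ?_, Or.inr hc⟩
    intro a b hab haf hbf hax hbx
    rw [Set.disjoint_left]
    intro q₂ hq₂' hq₂
    have crossing : ∀ b, s(g, b) ∈ Ob R k e E → b ≠ f → b ≠ x → q₂ ∈ segment ℝ g b → False := by
      intro b hb hbf hbx hq₂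
      by_cases hbg' : b = g'
      swap
      · obtain ⟨A'', hA⟩ := getx b hb hbf hbg'
        have := (List.append_inj_right' hA rfl)
        exact hbx (by simpa using this.symm)
      subst hbg'
      obtain ⟨σ, hσ, hpos⟩ := exists_sign (h.gp f hfT g hgi.1 b hg'i.1 hfg hgg hfg')
      have h₁ := side σ hσ hpos
      have p₁ : D σ f b g < 0 := by rw [D_swap]; linarith
      have p₂ : D σ f x g < 0 := by rw [D_swap]; linarith
      have s₁ := D_opposite (D_of_mem_segment (σ := σ) hq') hq p₁.ne
        (h.gp.ne hσ hfT hg'i.1 hxT hfg' hxg'.symm hxf.symm)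
      have s₂ := D_opposite (D_of_mem_segment (σ := σ) hq₂') hq₂ p₂.ne
        (h.gp.ne hσ hfT hxT hg'i.1 hxf.symm hxg' hfg')
      rw [D_swap σ f x b] at s₂
      rcases s₁ with ⟨_, _⟩ | ⟨_, _⟩ <;> rcases s₂ with ⟨_, _⟩ | ⟨_, _⟩ <;> linarith
    rcases h.block hf hg hgi (y := x) (by rw [Sym2.eq_swap]; exact hxgE) hxi hc hab haf.symm
      hbf.symm hax.symm hbx.symm hq₂ hq₂' with rfl | rfl
    · exact crossing b hab hbf.symm hbx.symm hq₂
    · exact crossing a (by rwa [Sym2.eq_swap]) haf.symm hax.symm (by rwa [segment_symm])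

end Conf

end PlanePaths

/-! ### Walls and the first inner point behind the sightline -/

namespace PlanePaths

open List

/-- Seen from `f` in the direction of the inner point `c`, the first edge of the path is `xv`,
which is met in `g`; its part from `g` to the extreme point `x` lies to the left. -/
structure Wall (T : Finset Plane) (R : List Plane) (k e : Plane) (E : Finset Plane) (σ : ℝ)
    (f c x v g : Plane) : Prop where
  hf : f ∈ E
  ci : Inner T c
  xT : x ∈ T
  xo : ¬ Inner T x
  xv : s(x, v) ∈ RE R k e
  gxv : g ∈ segment ℝ x v
  gfc : g ∈ segment ℝ f c
  pos : 0 < D σ f g x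
  clear : ∀ a b, s(a, b) ∈ Ob R k e E → a ≠ f → b ≠ f → ∀ q ∈ segment ℝ a b,
    q ∈ segment ℝ f g → q = g
  -- Either the sightline ends in the vertex `c = v` of the wall, whose other edges stay out of the
  -- triangle, or it crosses the wall before reaching `c`.
  alt : (g = c ∧ v = c ∧ ∀ b, s(v, b) ∈ Ob R k e E → b ≠ x → b ≠ f → ∀ q ∈ segment ℝ v b,
    q ∈ Tri f g x → q = v) ∨ (g ≠ c ∧ g ≠ v)

/-- What is known about the first inner point `z` in a wall. -/
structure First (T : Finset Plane) (R : List Plane) (k e : Plane) (E : Finset Plane) (σ : ℝ)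
    (f c x g z p : Plane) : Prop where
  zi : Inner T z
  zTri : z ∈ Tri f g x
  zf : z ≠ f
  zc : z ≠ c
  hp : p ∈ segment ℝ g x
  hz : z ∈ segment ℝ f p
  pg : p ≠ g
  px : p ≠ x
  first : ∀ w, Inner T w → w ∈ Tri f g x → w ≠ f → w ≠ c → w ≠ z → 0 < D σ f z w
  sees : Clear (Ob R k e E) f z

theorem exists_ray {f g x z : Plane} (hz : z ∈ Tri f g x) (hzf : z ≠ f) :
    ∃ p ∈ segment ℝ g x, z ∈ segment ℝ f p := by
  obtain ⟨s, t, u, hs, ht, hu, hsum, rfl⟩ := mem_Tri.1 hz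
  have h0 : 0 < t + u := by
    refine lt_of_le_of_ne (add_nonneg ht hu) fun h0 => hzf ?_
    have : t = 0 := by linarith
    have : u = 0 := by linarith
    subst t u
    obtain rfl : s = 1 := by linarith
    simp
  refine ⟨(t / (t + u)) • g + (u / (t + u)) • x,
    ⟨_, _, by positivity, by positivity, by field_simp, rfl⟩, s, t + u, hs, h0.le,
    by linarith, ?_⟩
  rw [smul_add, smul_smul, smul_smul, mul_div_cancel₀ _ h0.ne', mul_div_cancel₀ _ h0.ne',
    add_assoc]

variable {T : Finset Plane} {R : List Plane} {k e : Plane} {E : Finset Plane}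

namespace Wall

variable {σ : ℝ} {f c x v g : Plane}

theorem fi (W : Wall T R k e E σ f c x v g) (h : Conf T R k e E) : Inner T f := h.inner f W.hf

theorem posc (W : Wall T R k e E σ f c x v g) : 0 < D σ f c x := by
  obtain ⟨s, t, -, ht, hst, hg⟩ := W.gfc
  have := W.pos
  rw [← hg, D_swap, D_comb₂ σ hst, D_swap σ f x c] at this
  simp only [D_self_outer] at this
  rcases eq_or_lt_of_le ht with rfl | ht
  · simp at this
  · have h' : 0 < t * D σ f c x := by linarith
    exact (mul_pos_iff_of_pos_left ht).1 h'

theorem fc (W : Wall T R k e E σ f c x v g) : f ≠ c := (ne_of_D W.posc).1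

theorem Tri_sub (W : Wall T R k e E σ f c x v g) : Tri f g x ⊆ Tri f c x :=
  Tri_subset (convex_Tri _ _ _) (Tri_left _ _ _)
    ((convex_Tri f c x).segment_subset (Tri_left _ _ _) (Tri_mid _ _ _) W.gfc) (Tri_right _ _ _)

/-- The corner `g` need not be a point of `T`, so the triangle is enlarged to `fcx`, where `x` is
the only extreme corner. -/
theorem vertex (W : Wall T R k e E σ f c x v g) (h : Conf T R k e E) {w : Plane} (hw : w ∈ T)
    (hwT : w ∈ Tri f g x) : Inner T w ∨ w = x := by
  by_contra! hcon
  rcases eq_of_mem_Tri_of_not_inner (W.fi h).1 W.ci.1 W.xT hw hcon.1 (W.Tri_sub hwT) with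
    rfl | rfl | rfl
  · exact hcon.1 (W.fi h)
  · exact hcon.1 W.ci
  · exact hcon.2 rfl

/-- On the ray from `f`, the point `c` comes at or after `g`, so it is in the triangle only if it
coincides with `g`. -/
theorem c_eq (W : Wall T R k e E σ f c x v g) (hc : c ∈ Tri f g x) : c = g ∧ v = g := by
  rcases W.alt with ⟨h₁, h₂, -⟩ | ⟨h₁, -⟩
  · exact ⟨h₁.symm, by rw [h₁, h₂]⟩
  · exfalso
    have hD : D σ f g c = 0 := by
      obtain ⟨s, t, -, -, hst, hg⟩ := W.gfc
      rw [← hg, D_swap, D_comb₂ σ hst]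
      simp
    have h₂ := D_of_mem_Tri (σ := σ) W.pos.le hc
    have : c ∈ segment ℝ f g :=
      mem_segment_of_D (a := x) (b := f) (c := g) (z := c) (by rw [D_rot]; exact W.pos) h₂.2.2 hD
        h₂.2.1
    rw [segment_symm] at this
    exact h₁ (eq_of_mem_segments this W.gfc).symm

theorem h3 (W : Wall T R k e E σ f c x v g) (hgv : g = v) : ∀ b, s(v, b) ∈ Ob R k e E → b ≠ x →
    b ≠ f → ∀ q ∈ segment ℝ v b, q ∈ Tri f g x → q = v := by
  rcases W.alt with ⟨-, -, h₃⟩ | ⟨-, h₂⟩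
  · exact h₃
  · exact absurd hgv h₂

/-- If there is no inner point in a wall, then `f` sees `x`. -/
theorem clear_of_empty (W : Wall T R k e E σ f c x v g) (h : Conf T R k e E)
    (hZ : ∀ w, Inner T w → w ∈ Tri f g x → w = f ∨ w = c) : Clear (Ob R k e E) f x := by
  obtain ⟨-, hgx, hfx⟩ := ne_of_D W.pos
  have hσ := ne_zero_of_D W.pos
  have hfT := (W.fi h).1
  intro a b hab haf hbf hax hbx
  rw [Set.disjoint_left]
  intro q hq' hq
  obtain ⟨-, haT, hbT⟩ := h.of_Ob hab
  have H₄ : ∀ w ∈ T, w ∈ Tri f g x → w ∈ segment ℝ f x ∨ (w = v ∧ v = g) := by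
    intro w hw hwT
    rcases W.vertex h hw hwT with hwi | hwx
    · rcases hZ w hwi hwT with hwf | hwc
      · rw [hwf]; exact Or.inl (left_mem_segment ℝ f x)
      · subst hwc
        obtain ⟨h₁, h₂⟩ := W.c_eq hwT
        exact Or.inr ⟨h₁.trans h₂.symm, h₂⟩
    · rw [hwx]; exact Or.inl (right_mem_segment ℝ f x)
  have H₅ : ∀ w ∈ T, D σ f x w = 0 → w ∈ segment ℝ f x := by
    intro w hw hwD
    by_cases hwf : w = f
    · rw [hwf]; exact left_mem_segment ℝ f x
    by_cases hwx : w = x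
    · rw [hwx]; exact right_mem_segment ℝ f x
    exact absurd hwD (h.gp.ne hσ hfT W.xT hw hfx (Ne.symm hwx) (Ne.symm hwf))
  rcases h.reach W.xv W.gxv W.pos (right_mem_segment ℝ g x) hgx.symm W.clear W.h3 H₄ H₅ hab
    haf.symm hbf.symm hq hq' with h' | h' | h'
  · rcases h.gp.eq_or_eq_of_mem_segment hfT W.xT haT h' with h' | h'
    · exact haf h'.symm
    · exact hax h'.symm
  · rcases h.gp.eq_or_eq_of_mem_segment hfT W.xT hbT h' with h' | h'
    · exact hbf h'.symm
    · exact hbx h'.symm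
  · rw [h'] at hq
    rcases h.gp.eq_or_eq_of_mem_segment haT hbT W.xT hq with h' | h'
    · exact hax h'
    · exact hbx h'

/-- Otherwise the first one is visible. -/
theorem exists_first (W : Wall T R k e E σ f c x v g) (h : Conf T R k e E)
    (hZ : ¬ ∀ w, Inner T w → w ∈ Tri f g x → w = f ∨ w = c) :
    ∃ z p, First T R k e E σ f c x g z p := by
  classical
  obtain ⟨hfg, hgx, hfx⟩ := ne_of_D W.pos
  have hσ := ne_zero_of_D W.pos
  have hfT := (W.fi h).1
  push Not at hZ
  obtain ⟨w₀, hw₀i, hw₀T, hw₀f, hw₀c⟩ := hZ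
  set Z := T.filter (fun z => Inner T z ∧ z ∈ Tri f g x ∧ z ≠ f ∧ z ≠ c) with hZdef
  have hZmem : ∀ z, z ∈ Z ↔ Inner T z ∧ z ∈ Tri f g x ∧ z ≠ f ∧ z ≠ c := by
    intro z
    rw [hZdef, Finset.mem_filter]
    exact ⟨fun h => h.2, fun h => ⟨h.1.1, h⟩⟩
  -- Turn the ray from `fg` towards `fx` and stop at the first inner point. The angular order makes
  -- sense because `f` is extreme among the inner points.
  obtain ⟨z, hz, hfirst⟩ := exists_tangent (σ := σ) (a := f) (G := Z)
    ⟨w₀, (hZmem w₀).2 ⟨hw₀i, hw₀T, hw₀f, hw₀c⟩⟩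
    ((h.two.ext (W.fi h)).mono fun z hz => by
      have hz' : z ∈ Z := hz
      rw [hZmem] at hz'
      exact ⟨hz'.1, hz'.2.2.1⟩)
    (fun a ha b hb hab => by
      rw [hZmem] at ha hb
      exact h.gp.ne hσ hfT ha.1.1 hb.1.1 ha.2.2.1.symm hab hb.2.2.1.symm)
  obtain ⟨hzi, hzT, hzf, hzc⟩ := (hZmem z).1 hz
  have hfirst' : ∀ w, Inner T w → w ∈ Tri f g x → w ≠ f → w ≠ c → w ≠ z → 0 < D σ f z w :=
    fun w h₁ h₂ h₃ h₄ h₅ => hfirst w ((hZmem w).2 ⟨h₁, h₂, h₃, h₄⟩) h₅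
  obtain ⟨p, hp, hzp⟩ := exists_ray hzT hzf
  have hpg : p ≠ g := by
    rintro rfl
    have : z ∈ segment ℝ f c :=
      (convex_segment f c).segment_subset (left_mem_segment ℝ _ _) W.gfc hzp
    rcases h.gp.eq_or_eq_of_mem_segment hfT W.ci.1 hzi.1 this with h' | h'
    · exact hzf h'
    · exact hzc h'
  have hpx : p ≠ x := by
    rintro rfl
    rcases h.gp.eq_or_eq_of_mem_segment hfT W.xT hzi.1 hzp with rfl | rfl
    · exact hzf rfl
    · exact W.xo hzi
  have hfgp : 0 < D σ f g p :=
    D_pos_of_mem_segment W.pos (by simp) (by rwa [segment_symm]) hpg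
  have hfpx : 0 < D σ f p x := by
    rw [← D_rot]
    exact D_pos_of_mem_segment (u := g) (v := x) (by rw [D_rot]; exact W.pos) (by simp) hp hpx
  obtain ⟨s, hs, hray⟩ := D_of_mem_ray (σ := σ) hzp hzf
  have hsub : Tri f g p ⊆ Tri f g x := Tri_subset (convex_Tri _ _ _) (Tri_left _ _ _)
    (Tri_mid _ _ _) ((convex_Tri f g x).segment_subset (Tri_mid _ _ _) (Tri_right _ _ _) hp)
  refine ⟨z, p, hzi, hzT, hzf, hzc, hp, hzp, hpg, hpx, hfirst', ?_⟩
  intro a b hab haf hbf haz hbz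
  rw [Set.disjoint_left]
  intro q hq' hq
  obtain ⟨-, haT, hbT⟩ := h.of_Ob hab
  have online : ∀ w ∈ T, D σ f p w = 0 → w = f ∨ w = z := by
    intro w hw hwD
    by_contra! hcon
    refine h.gp.ne hσ hfT hzi.1 hw hzf.symm hcon.2.symm hcon.1.symm ?_
    rw [hray, hwD, mul_zero]
  have inseg : ∀ w ∈ T, w ∈ segment ℝ f p → w = f ∨ w = z := fun w hw hw' =>
    online w hw (D_of_mem_segment hw')
  -- By the choice of `z`, the triangle swept so far holds no vertex except on the ray `fp` or at
  -- the corner `g`, so `Conf.reach` applies to `fp`.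
  have H₄ : ∀ w ∈ T, w ∈ Tri f g p → w ∈ segment ℝ f p ∨ (w = v ∧ v = g) := by
    intro w hw hwT
    have hwD := (D_of_mem_Tri hfgp.le hwT).2.2
    rw [D_swap'] at hwD
    rcases W.vertex h hw (hsub hwT) with hwi | hwx
    · by_cases hwf : w = f
      · rw [hwf]; exact Or.inl (left_mem_segment ℝ f p)
      by_cases hwc : w = c
      · subst hwc
        obtain ⟨h₁, h₂⟩ := W.c_eq (hsub hwT)
        exact Or.inr ⟨h₁.trans h₂.symm, h₂⟩
      by_cases hwz : w = z
      · rw [hwz]; exact Or.inl hzp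
      have := hfirst' w hwi (hsub hwT) hwf hwc hwz
      rw [hray, mul_pos_iff_of_pos_left hs] at this
      linarith
    · rw [hwx] at hwD
      linarith
  have H₅ : ∀ w ∈ T, D σ f p w = 0 → w ∈ segment ℝ f p := by
    intro w hw hwD
    rcases online w hw hwD with hwf | hwz
    · rw [hwf]; exact left_mem_segment ℝ f p
    · rw [hwz]; exact hzp
  rcases h.reach W.xv W.gxv W.pos hp hpg W.clear W.h3 H₄ H₅ hab haf.symm hbf.symm hq
    ((convex_segment f p).segment_subset (left_mem_segment ℝ f p) hzp hq') with h' | h' | h'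
  · rcases inseg a haT h' with h' | h'
    · exact haf h'.symm
    · exact haz h'.symm
  · rcases inseg b hbT h' with h' | h'
    · exact hbf h'.symm
    · exact hbz h'.symm
  · subst h'
    have : q = z := eq_of_mem_segments (x := f) (by rwa [segment_symm]) hzp
    rw [this] at hq
    rcases h.gp.eq_or_eq_of_mem_segment haT hbT hzi.1 hq with h' | h'
    · exact haz h'
    · exact hbz h'

end Wall

end PlanePaths

/-! ### What the first inner point sees -/

namespace PlanePaths

open List

variable {T : Finset Plane} {R : List Plane} {k e : Plane} {E : Finset Plane}

theorem Conf.RE_left (h : Conf T R k e E) {a b : Plane} (hab : s(a, b) ∈ RE R k e) (ha : a ∈ E) :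
    a = e := by
  rcases (h.of_RE hab).2.1 with h' | h'
  · exact absurd ha (h.disj a h')
  · exact h'

namespace First

variable {σ : ℝ} {f c x v g z p : Plane}

theorem fgp (F : First T R k e E σ f c x g z p) (W : Wall T R k e E σ f c x v g) :
    0 < D σ f g p :=
  D_pos_of_mem_segment W.pos (by simp) (by rw [segment_symm]; exact F.hp) F.pg

theorem fpx (F : First T R k e E σ f c x g z p) (W : Wall T R k e E σ f c x v g) :
    0 < D σ f p x := by
  rw [← D_rot]
  exact D_pos_of_mem_segment (u := g) (v := x) (by rw [D_rot]; exact W.pos) (by simp) F.hp F.px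

theorem ray (F : First T R k e E σ f c x g z p) :
    ∃ s : ℝ, 0 < s ∧ ∀ w, D σ f z w = s * D σ f p w := D_of_mem_ray F.hz F.zf

theorem fgz (F : First T R k e E σ f c x g z p) (W : Wall T R k e E σ f c x v g) :
    0 < D σ f g z := by
  obtain ⟨s, hs, hray⟩ := F.ray
  have h₁ := F.fgp W
  have h₂ := hray g
  rw [D_swap, D_swap σ f p g] at h₂
  have := mul_pos hs h₁
  linarith

theorem fzx (F : First T R k e E σ f c x g z p) (W : Wall T R k e E σ f c x v g) :
    0 < D σ f z x := by
  obtain ⟨s, hs, hray⟩ := F.ray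
  rw [hray]
  exact mul_pos hs (F.fpx W)

theorem fcz (F : First T R k e E σ f c x g z p) (W : Wall T R k e E σ f c x v g) :
    0 < D σ f c z := by
  obtain ⟨s, t, -, ht, hst, hg⟩ := W.gfc
  have := F.fgz W
  rw [← hg, D_swap, D_comb₂ σ hst, D_swap σ f z c] at this
  simp only [D_self_outer] at this
  rcases eq_or_lt_of_le ht with rfl | ht
  · simp at this
  · have h' : 0 < t * D σ f c z := by linarith
    exact (mul_pos_iff_of_pos_left ht).1 h'

theorem gxz (F : First T R k e E σ f c x g z p) (W : Wall T R k e E σ f c x v g)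
    (h : Conf T R k e E) : 0 < D σ g x z := by
  refine lt_of_le_of_ne (D_of_mem_Tri W.pos.le F.zTri).2.1 fun h0 => ?_
  have : z ∈ segment ℝ g x := mem_segment_of_D W.pos (D_of_mem_Tri W.pos.le F.zTri).1 h0.symm
    (D_of_mem_Tri W.pos.le F.zTri).2.2
  have h₁ : z ∈ segment ℝ x v :=
    (convex_segment x v).segment_subset W.gxv (left_mem_segment ℝ x v) this
  rcases h.gp.eq_or_eq_of_mem_segment W.xT (h.of_Ob (Or.inl W.xv)).2.2 F.zi.1 h₁ with h₂ | h₂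
  · exact W.xo (h₂ ▸ F.zi)
  · subst h₂
    rcases W.alt with ⟨-, h₃, -⟩ | ⟨-, h₃⟩
    · exact F.zc h₃
    · exact h₃ (eq_of_mem_segments this W.gxv).symm

theorem Tri_zgx (F : First T R k e E σ f c x g z p) : Tri z g x ⊆ Tri f g x :=
  Tri_subset (convex_Tri _ _ _) F.zTri (Tri_mid _ _ _) (Tri_right _ _ _)

theorem mem_fgp (F : First T R k e E σ f c x g z p) (W : Wall T R k e E σ f c x v g)
    (h : Conf T R k e E) {w : Plane} (hw : w ∈ T) (hwT : w ∈ Tri f g p) :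
    w = f ∨ w = z ∨ (w = v ∧ w = c ∧ v = g) := by
  obtain ⟨s, hs, hray⟩ := F.ray
  have hsub : Tri f g p ⊆ Tri f g x := Tri_subset (convex_Tri _ _ _) (Tri_left _ _ _)
    (Tri_mid _ _ _) ((convex_Tri f g x).segment_subset (Tri_mid _ _ _) (Tri_right _ _ _) F.hp)
  have hwD := (D_of_mem_Tri (F.fgp W).le hwT).2.2
  rw [D_swap'] at hwD
  rcases W.vertex h hw (hsub hwT) with hwi | hwx
  · by_cases hwf : w = f
    · exact Or.inl hwf
    by_cases hwc : w = c
    · subst hwc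
      obtain ⟨h₁, h₂⟩ := W.c_eq (hsub hwT)
      exact Or.inr (Or.inr ⟨h₁.trans h₂.symm, rfl, h₂⟩)
    by_cases hwz : w = z
    · exact Or.inr (Or.inl hwz)
    have := F.first w hwi (hsub hwT) hwf hwc hwz
    rw [hray, mul_pos_iff_of_pos_left hs] at this
    linarith
  · rw [hwx] at hwD
    have := F.fpx W
    linarith

/-- Any further inner point `w` of this triangle comes after `z` in the sweep. Then `z` lies in the
triangle `fgw`, hence in `fcw`, whose corners are inner: this contradicts convex position. -/
theorem mem_zgx (F : First T R k e E σ f c x g z p) (W : Wall T R k e E σ f c x v g)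
    (h : Conf T R k e E) {w : Plane} (hw : w ∈ T) (hwT : w ∈ Tri z g x) :
    w = z ∨ w = x ∨ (w = v ∧ v = g) := by
  have hzgx : 0 < D σ z g x := by rw [D_rot]; exact F.gxz W h
  have hwD := D_of_mem_Tri hzgx.le hwT
  rcases W.vertex h hw (F.Tri_zgx hwT) with hwi | hwx
  swap
  · exact Or.inr (Or.inl hwx)
  by_cases hwz : w = z
  · exact Or.inl hwz
  by_cases hwc : w = c
  · subst hwc
    obtain ⟨h₁, h₂⟩ := W.c_eq (F.Tri_zgx hwT)
    exact Or.inr (Or.inr ⟨h₁.trans h₂.symm, h₂⟩)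
  exfalso
  by_cases hwf : w = f
  · subst hwf
    have h₁ := (D_of_mem_Tri (σ := -σ) (a := g) (b := z) (c := x) (z := w)
      (by rw [D_neg, ← D_swap', D_rot, D_rot, D_rot]; exact hzgx.le) (by rwa [Tri_comm₁])).1
    rw [D_neg, ← D_rot] at h₁
    have := F.fgz W
    linarith
  have hfi := F.first w hwi (F.Tri_zgx hwT) hwf hwc hwz
  have hgw : 0 ≤ D σ g w z := by rw [← D_rot]; exact hwD.1
  have hfgw : 0 < D σ f g w := by
    have := D_add σ f g w z
    have h₁ := F.fgz W
    have h₂ : D σ w f z = D σ f z w := D_rot ..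
    linarith
  have hz : z ∈ Tri f g w := mem_Tri_of_D hfgw (F.fgz W).le hgw (by rw [D_rot]; exact hfi.le)
  have hz' : z ∈ Tri f c w := Tri_subset (convex_Tri _ _ _) (Tri_left _ _ _)
    ((convex_Tri f c w).segment_subset (Tri_left _ _ _) (Tri_mid _ _ _) W.gfc) (Tri_right _ _ _) hz
  rcases h.two.eq_of_mem_Tri (W.fi h) W.ci hwi F.zi.1 hz' with h' | h' | h'
  · exact F.zf h'
  · exact F.zc h'
  · exact hwz h'.symm

theorem mem_fgz (F : First T R k e E σ f c x g z p) (W : Wall T R k e E σ f c x v g)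
    (h : Conf T R k e E) {w : Plane} (hw : w ∈ T) (hwT : w ∈ Tri f g z) :
    w = f ∨ w = z ∨ (w = v ∧ w = c ∧ v = g) :=
  F.mem_fgp W h hw (Tri_subset (convex_Tri _ _ _) (Tri_left _ _ _) (Tri_mid _ _ _)
    ((convex_Tri f g p).segment_subset (Tri_left _ _ _) (Tri_right _ _ _) F.hz) hwT)

/-- The edges of the path at `z` lie to the left of the ray `fz`. -/
theorem left_of_mem (F : First T R k e E σ f c x g z p) (W : Wall T R k e E σ f c x v g)
    (h : Conf T R k e E) {z' : Plane} (hzz : s(z, z') ∈ ES R) (hz'i : Inner T z') :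
    0 < D σ f z z' := by
  have hσ := ne_zero_of_D W.pos
  obtain ⟨s, hs, hray⟩ := F.ray
  have hzR := (mem_of_mem_edgesL hzz).1
  have hz'R := (mem_of_mem_edgesL hzz).2
  have hzz' := ne_of_mem_edgesL h.nodup hzz
  have hz'f : z' ≠ f := h.ne_of_mem hz'R W.hf
  by_contra hcon
  have hneg : D σ f z z' < 0 := lt_of_le_of_ne (not_lt.1 hcon)
    (h.gp.ne hσ (W.fi h).1 F.zi.1 hz'i.1 F.zf.symm hzz' hz'f.symm)
  have hneg' : 0 < D σ p f z' := by
    rw [hray] at hneg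
    rw [D_swap']
    by_contra hcon
    have := mul_nonneg hs.le (by linarith : 0 ≤ D σ f p z')
    linarith
  have hOb : s(z, z') ∈ Ob R k e E := Or.inl (Or.inr hzz)
  have hzv : g = v → z ≠ v := by
    rintro hgv hzv
    rcases W.alt with ⟨-, h₃, -⟩ | ⟨-, h₃⟩
    · exact F.zc (hzv.trans h₃)
    · exact h₃ hgv
  have hz'v : g = v → z' ≠ v := by
    rintro hgv rfl
    refine hzv hgv (W.h3 hgv z (by rwa [Sym2.eq_swap]) (fun hzx => W.xo (hzx ▸ F.zi)) F.zf z
      (right_mem_segment ℝ _ _) F.zTri)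
  have hnT : z' ∉ Tri p f g := by
    intro hT
    rw [Tri_comm₁ p f g, Tri_comm₂ f p g] at hT
    rcases F.mem_fgp W h hz'i.1 hT with h' | h' | ⟨h', -, h''⟩
    · exact hz'f h'
    · exact hzz' h'.symm
    · exact hz'v h''.symm h'
  obtain ⟨r, hr, hr'⟩ := exit (q := z) (by rw [D_rot]; exact F.fgp W)
    (by rw [segment_symm]; exact F.hz) hneg' hnT
  have hrpg : r ∈ segment ℝ p g := by
    rcases hr' with hr' | hr'
    · exact hr'
    · rw [W.clear z z' hOb F.zf hz'f r hr hr']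
      exact right_mem_segment ℝ p g
  have hrgx : r ∈ segment ℝ g x :=
    (convex_segment g x).segment_subset F.hp (left_mem_segment ℝ g x) hrpg
  have hrxv : r ∈ segment ℝ x v :=
    (convex_segment x v).segment_subset W.gxv (left_mem_segment ℝ x v) hrgx
  have hxz : x ≠ z := fun hxz => W.xo (hxz ▸ F.zi)
  have hxz' : x ≠ z' := fun hxz => W.xo (hxz ▸ hz'i)
  rcases h.touch W.xv hOb hrxv hr with h' | ⟨-, h'⟩ | ⟨hrv, h'⟩
  · rcases Sym2.eq_iff.1 h' with ⟨h', -⟩ | ⟨-, h'⟩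
    · exact hxz h'.symm
    · exact hxz' h'.symm
  · rcases h' with h' | h'
    · exact hxz h'.symm
    · exact hxz' h'.symm
  · subst hrv
    have : r = g := eq_of_mem_segments hrgx W.gxv
    rcases h' with h' | h'
    · exact hzv this.symm h'
    · exact hz'v this.symm h'

/-- The segment `gx` is part of the path edge `xv`, which other edges touch only in shared
endpoints. -/
theorem hit_gx (_ : First T R k e E σ f c x g z p) (W : Wall T R k e E σ f c x v g)
    (h : Conf T R k e E) {a b r : Plane} (hab : s(a, b) ∈ Ob R k e E) (hax : a ≠ x)
    (hbx : b ≠ x) (hv : v = g → a ≠ g ∧ b ≠ g) (hr : r ∈ segment ℝ a b)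
    (hr' : r ∈ segment ℝ g x) : False := by
  have hrxv : r ∈ segment ℝ x v :=
    (convex_segment x v).segment_subset W.gxv (left_mem_segment ℝ x v) hr'
  rcases h.touch W.xv hab hrxv hr with h' | ⟨-, h'⟩ | ⟨hrv, h'⟩
  · rcases Sym2.eq_iff.1 h' with ⟨h', -⟩ | ⟨-, h'⟩
    · exact hax h'
    · exact hbx h'
  · rcases h' with h' | h'
    · exact hax h'
    · exact hbx h'
  · subst hrv
    have : r = g := eq_of_mem_segments hr' W.gxv
    subst this
    obtain ⟨h₁, h₂⟩ := hv rfl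
    rcases h' with h' | h'
    · exact h₁ h'
    · exact h₂ h'

theorem hit_fg (F : First T R k e E σ f c x g z p) (W : Wall T R k e E σ f c x v g)
    (h : Conf T R k e E) {a b r : Plane} (hab : s(a, b) ∈ Ob R k e E) (hax : a ≠ x)
    (hbx : b ≠ x) (haf : a ≠ f) (hbf : b ≠ f) (hv : v = g → a ≠ g ∧ b ≠ g)
    (hr : r ∈ segment ℝ a b) (hr' : r ∈ segment ℝ f g) : False := by
  have := W.clear a b hab haf hbf r hr hr'
  subst this
  exact F.hit_gx W h hab hax hbx hv hr (left_mem_segment ℝ _ _)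

/-- An inner point `z ∈ E` that comes first in a wall sees the extreme end of the wall. -/
theorem hit_zx (F : First T R k e E σ f c x g z p) (W : Wall T R k e E σ f c x v g)
    (h : Conf T R k e E) {a b q : Plane} (hab : s(a, b) ∈ Ob R k e E) (haz : a ≠ z) (hbz : b ≠ z)
    (hax : a ≠ x) (hbx : b ≠ x) (hq : q ∈ segment ℝ a b) (hq' : q ∈ segment ℝ z x) : False := by
  have hσ := ne_zero_of_D W.pos
  obtain ⟨-, haT, hbT⟩ := h.of_Ob hab
  have hgxz := F.gxz W h
  have hfgz := F.fgz W
  have hfzx := F.fzx W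
  have hzx : z ≠ x := fun hzx => W.xo (hzx ▸ F.zi)
  have nz : ∀ w ∈ T, w ≠ z → w ≠ x → D σ x z w ≠ 0 := fun w hw hwz hwx =>
    h.gp.ne hσ W.xT F.zi.1 hw hzx.symm hwz.symm hwx.symm
  have h₁ : D σ x z q = 0 := by rw [D_swap', D_of_mem_segment hq', neg_zero]
  -- Let `b` be the end on the side of `g`. From `zx` the edge traverses the empty triangle `xzg`,
  -- must leave it through `zg`, traverses the triangle `gzf`, and then has no exit: neither `fg`
  -- nor the sightline `fz` may be crossed.
  wlog hb : 0 < D σ x z b generalizing a b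
  · refine this (by rwa [Sym2.eq_swap]) hbz haz hbx hax (by rwa [segment_symm]) hbT haT ?_
    rcases D_opposite h₁ hq (nz a haT haz hax) (nz b hbT hbz hbx) with h₂ | h₂
    · exact h₂.1
    · exact absurd h₂.2 hb
  have hqT : q ∈ Tri f g x :=
    (convex_Tri f g x).segment_subset F.zTri (Tri_right _ _ _) hq'
  have hqz : q ≠ z := by
    rintro rfl
    rcases h.gp.eq_or_eq_of_mem_segment haT hbT F.zi.1 hq with h' | h'
    · exact haz h'.symm
    · exact hbz h'.symm
  have hxzf : D σ x z f < 0 := by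
    rw [D_swap', ← D_rot]
    linarith
  have hvx : ∀ b, s(v, b) ∈ Ob R k e E → b ≠ x → v = g → q ∈ segment ℝ v b → False := by
    rintro b hb hbx rfl hqb
    by_cases hbf : b = f
    · subst hbf
      have h₂ := D_pos_of_mem_segment W.pos hfgz.le (by rwa [segment_symm]) hqz
      have h₃ := D_of_mem_segment (σ := σ) hqb
      rw [D_swap'] at h₃
      linarith
    · have := W.h3 rfl b hb hbx hbf q hqb hqT
      subst this
      have := D_of_mem_segment (σ := σ) hq'
      rw [D_swap, ← D_rot, ← D_rot] at this
      rw [← D_rot] at hgxz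
      have e₁ : D σ z q x = D σ q x z := D_rot ..
      linarith [F.gxz W h]
  have hv : v = g → a ≠ g ∧ b ≠ g := by
    intro hvg
    constructor
    · rintro rfl
      subst hvg
      exact hvx b hab hbx rfl hq
    · rintro rfl
      subst hvg
      exact hvx a (by rwa [Sym2.eq_swap]) hax rfl (by rwa [segment_symm])
  have hnT : b ∉ Tri x z g := by
    intro hT
    rw [Tri_comm₁ x z g, Tri_comm₂ z x g] at hT
    rcases F.mem_zgx W h hbT hT with h' | h' | ⟨h', h''⟩
    · exact hbz h'
    · exact hbx h'
    · exact (hv h'').2 (h'.trans h'')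
  obtain ⟨r, hr, hr'⟩ := exit (by rw [← D_rot]; exact hgxz) (by rwa [segment_symm]) hb hnT
  have hrab : r ∈ segment ℝ a b :=
    (convex_segment a b).segment_subset hq (right_mem_segment ℝ a b) hr
  rcases hr' with hr' | hr'
  · rw [segment_symm] at hr'
    exact F.hit_gx W h hab hax hbx hv hrab hr'
  have hrz : r ≠ z := by
    rintro rfl
    rcases h.gp.eq_or_eq_of_mem_segment haT hbT F.zi.1 hrab with h' | h'
    · exact haz h'.symm
    · exact hbz h'.symm
  have hbf : b ≠ f := by
    rintro rfl
    linarith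
  -- An edge from `f` cannot meet both `zx` and `zg` outside `z`, since these lie on different sides
  -- of the line `fz`.
  by_cases haf : a = f
  · subst haf
    have q₁ : 0 < D σ a z q :=
      D_pos_of_mem_segment hfzx (by simp) (by rwa [segment_symm]) hqz
    have q₂ : 0 < D (-σ) a z r :=
      D_pos_of_mem_segment (u := g) (v := z) (by rw [D_neg, ← D_swap]; exact hfgz) (by simp)
        (by rwa [segment_symm]) hrz
    rw [D_neg] at q₂
    obtain ⟨s₁, t₁, -, ht₁, hst₁, rfl⟩ := hq
    obtain ⟨s₂, t₂, -, ht₂, hst₂, rfl⟩ := hrab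
    rw [D_comb₂ σ hst₁, D_self_outer, mul_zero, zero_add] at q₁
    rw [D_comb₂ σ hst₂, D_self_outer, mul_zero, zero_add] at q₂
    have : 0 < D σ a z b := by
      by_contra hcon
      have := mul_nonneg ht₁ (by linarith : 0 ≤ -D σ a z b)
      linarith
    have := mul_nonneg ht₂ this.le
    linarith
  have hgzf : 0 < D σ g z f := by rwa [← D_rot]
  have hgzq : D σ g z q < 0 := by
    have : 0 < D (-σ) g z q := D_pos_of_mem_segment (u := x) (v := z)
      (by rw [D_neg, ← D_swap]; exact hgxz) (by simp) (by rwa [segment_symm]) hqz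
    rw [D_neg] at this
    linarith
  have hgzr : D σ g z r = 0 := by
    rw [segment_symm] at hr'
    exact D_of_mem_segment hr'
  have hgzb : 0 < D σ g z b := by
    by_contra hcon
    have hrb : r ≠ b := by
      rintro rfl
      refine hnT ((convex_Tri x z g).segment_subset (Tri_mid _ _ _) (Tri_right _ _ _) hr')
    have := D_pos_of_mem_segment (σ := -σ) (p := g) (q := z) (u := q) (v := b) (z := r)
      (by rw [D_neg]; linarith) (by rw [D_neg]; linarith) hr hrb
    rw [D_neg] at this
    linarith
  have hnT' : b ∉ Tri g z f := by
    intro hT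
    rw [Tri_comm₂ g z f, Tri_comm₁ g f z] at hT
    rcases F.mem_fgz W h hbT hT with h' | h' | ⟨h', -, h''⟩
    · exact hbf h'
    · exact hbz h'
    · exact (hv h'').2 (h'.trans h'')
  obtain ⟨r', hr₂, hr₂'⟩ := exit hgzf (by rwa [segment_symm]) hgzb hnT'
  have hrab' : r' ∈ segment ℝ a b :=
    (convex_segment a b).segment_subset hrab (right_mem_segment ℝ a b) hr₂
  rw [segment_symm ℝ g f, segment_symm ℝ z f] at hr₂'
  rcases hr₂' with hr₂' | hr₂'
  · exact F.hit_fg W h hab hax hbx haf hbf hv hrab' hr₂'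
  · exact Set.disjoint_left.1 (F.sees a b hab (Ne.symm haf) hbf.symm haz.symm hbz.symm) hr₂' hrab'

theorem sees_x (F : First T R k e E σ f c x g z p) (W : Wall T R k e E σ f c x v g)
    (h : Conf T R k e E) : Clear (Ob R k e E) z x := by
  intro a b hab h₁ h₂ h₃ h₄
  rw [Set.disjoint_left]
  intro q hq' hq
  exact F.hit_zx W h hab h₁.symm h₂.symm h₃.symm h₄.symm hq hq'

/-- If the wall is met in a vertex, that vertex is seen, too. -/
theorem sees_g (F : First T R k e E σ f c x g z p) (W : Wall T R k e E σ f c x v g)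
    (h : Conf T R k e E) (hfe : f ≠ e) (hvg : v = g) :
    Clear (Ob R k e E) z g := by
  intro a b hab haz hbz hag hbg
  rw [Set.disjoint_left]
  intro r hr' hr
  have hσ := ne_zero_of_D W.pos
  obtain ⟨-, haT, hbT⟩ := h.of_Ob hab
  have hgT : g ∈ T := hvg ▸ (h.of_Ob (Or.inl W.xv)).2.2
  have hgxz := F.gxz W h
  have hfgz := F.fgz W
  obtain ⟨hfg, hgx, -⟩ := ne_of_D W.pos
  obtain ⟨-, hgz, -⟩ := ne_of_D hfgz
  have nz : ∀ w ∈ T, w ≠ z → w ≠ g → D σ g z w ≠ 0 := fun w hw hwz hwx =>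
    h.gp.ne hσ hgT F.zi.1 hw hgz hwz.symm hwx.symm
  have h₁ : D σ g z r = 0 := by rw [D_swap', D_of_mem_segment hr', neg_zero]
  wlog hb : 0 < D σ g z b generalizing a b
  · refine this _ _ (by rwa [Sym2.eq_swap]) hbz haz hbg hag (by rwa [segment_symm]) hbT haT ?_
    rcases D_opposite h₁ hr (nz a haT haz.symm hag.symm) (nz b hbT hbz.symm hbg.symm) with h₂ | h₂
    · exact h₂.1
    · exact absurd h₂.2 hb
  have ha : D σ g z a < 0 := by
    rcases D_opposite h₁ hr (nz a haT haz.symm hag.symm) (nz b hbT hbz.symm hbg.symm) with h₂ | h₂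
    · linarith
    · exact h₂.1
  have hgzf : 0 < D σ g z f := by rwa [← D_rot]
  -- Past `zg`, an edge not ending in `f` would have to leave the triangle `gzf` through `fg` or
  -- `fz`. So it ends in `f`, and as `f ≠ e` it is a segment between points of `E`; its other end is
  -- inner, so it would have to leave the triangle `zgx` on the far side.
  have hbf : b = f := by
    by_contra hbf
    have haf : a ≠ f := by
      rintro rfl
      linarith
    have hnT' : b ∉ Tri g z f := by
      intro hT
      rw [Tri_comm₂ g z f, Tri_comm₁ g f z] at hT
      rcases F.mem_fgz W h hbT hT with h' | h' | ⟨h', -, h''⟩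
      · exact hbf h'
      · exact hbz h'.symm
      · exact hbg (h'.trans h'').symm
    obtain ⟨r', hr₂, hr₂'⟩ := exit hgzf (by rwa [segment_symm]) hb hnT'
    have hrab' : r' ∈ segment ℝ a b :=
      (convex_segment a b).segment_subset hr (right_mem_segment ℝ a b) hr₂
    rw [segment_symm ℝ g f, segment_symm ℝ z f] at hr₂'
    rcases hr₂' with hr₂' | hr₂'
    · have := W.clear a b hab haf hbf r' hrab' hr₂'
      subst this
      rcases h.gp.eq_or_eq_of_mem_segment haT hbT hgT hrab' with h' | h'
      · exact hag h'
      · exact hbg h'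
    · exact Set.disjoint_left.1 (F.sees a b hab haf.symm (Ne.symm hbf) haz hbz) hr₂' hrab'
  subst hbf
  have haE : a ∈ E := by
    rcases hab with hab | hab
    · rw [Sym2.eq_swap] at hab
      exact absurd (h.RE_left hab W.hf) hfe
    · exact (mem_segs.1 hab).1
  have hax : a ≠ x := fun hax => W.xo (hax ▸ h.inner a haE)
  have hbx : b ≠ x := fun hbx => W.xo (hbx ▸ W.fi h)
  have hnT : a ∉ Tri z g x := by
    intro hT
    rcases F.mem_zgx W h haT hT with h' | h' | ⟨h', h''⟩
    · exact haz h'.symm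
    · exact hax h'
    · exact hag (h'.trans h'').symm
  obtain ⟨r', hr₂, hr₂'⟩ := exit (q := r) (z := a) (by rw [D_rot]; exact hgxz) hr'
    (by rw [D_swap']; linarith) hnT
  have hrab' : r' ∈ segment ℝ a b :=
    (convex_segment a b).segment_subset hr (left_mem_segment ℝ a b) hr₂
  rcases hr₂' with hr₂' | hr₂'
  · exact F.hit_zx W h hab haz.symm hbz.symm hax hbx hrab' hr₂'
  · exact F.hit_gx W h hab hax hbx (fun _ => ⟨hag.symm, hbg.symm⟩) hrab' hr₂'

end First

end PlanePaths

/-! ### Sweeping until a point can be inserted -/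

namespace PlanePaths

open List

variable {T : Finset Plane} {R : List Plane} {k e : Plane} {E : Finset Plane}

/-- A wall formed by an edge of `R` at which `f` can be inserted as soon as it sees `x`. -/
structure RWall (T : Finset Plane) (R : List Plane) (k e : Plane) (E : Finset Plane) (σ : ℝ)
    (f c x v g : Plane) : Prop where
  wall : Wall T R k e E σ f c x v g
  split : ∃ A B, R = A ++ x :: v :: B
  nonhull : ¬ HullEdge T x v
  ends : ¬ Inner T v ∨ (v = g ∧ Clear (Ob R k e E) f v)

/-- Some other point `z` of `E` can be inserted into `R`. -/
def Outcome (T : Finset Plane) (R : List Plane) (k e : Plane) (E : Finset Plane) (σ : ℝ)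
    (f c : Plane) : Prop :=
  ∃ z ∈ E, z ≠ f ∧ 0 < D σ f c z ∧ ∃ A x v B, R = A ++ x :: v :: B ∧ ¬ HullEdge T x v ∧
    Clear (Ob R k e E) z x ∧ (¬ Inner T v ∨ (Clear (Ob R k e E) z v ∧ 0 < D σ z f v)) ∧
    (z = e → 0 < D σ e x k ∧ 0 < D σ e k f)

/-- A ray that starts in the apex of a triangle and runs inside the angle leaves the triangle
through the opposite side. -/
theorem wedge {σ : ℝ} {e u k w : Plane} (h₁ : 0 ≤ D σ e u k) (h₂ : 0 ≤ D σ e k w)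
    (h₃ : 0 < D σ e u w) (hk : k ∉ Tri e u w) : ∃ r ∈ segment ℝ e k, r ∈ segment ℝ u w := by
  have hneg : D σ u w k < 0 := by
    by_contra hcon
    exact hk (mem_Tri_of_D h₃ h₁ (not_lt.1 hcon) (by rw [D_rot]; exact h₂))
  have hb := bary σ h₃.ne' k
  have hadd := D_add σ e u w k
  have h₂' : D σ w e k = D σ e k w := D_rot ..
  have hS : 0 < D σ w e k + D σ e u k := by linarith
  refine ⟨(D σ w e k / (D σ w e k + D σ e u k)) • u + (D σ e u k / (D σ w e k + D σ e u k)) • w,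
    ⟨(-D σ u w k) / (D σ w e k + D σ e u k), D σ e u w / (D σ w e k + D σ e u k), ?_, ?_, ?_, ?_⟩,
    _, _, ?_, ?_, ?_, rfl⟩
  · exact div_nonneg (by linarith) hS.le
  · positivity
  · rw [← add_div, div_eq_one_iff_eq hS.ne']
    linarith
  · ext i
    have hbi := congrArg (fun q : Plane => q i) hb
    simp only [PiLp.add_apply, PiLp.smul_apply, smul_eq_mul] at hbi ⊢
    have hΔ := h₃.ne'
    generalize D σ u w k = A at *
    generalize D σ w e k = B at *
    generalize D σ e u k = C at *
    generalize D σ e u w = Δ at *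
    have hS' := hS.ne'
    field_simp at hbi ⊢
    linarith
  · rw [h₂']; positivity
  · positivity
  · rw [← add_div, div_self hS.ne']

/-- The edge from `e` to `k` can leave the triangle `fgx` neither through `fg` nor through `gx`, so
it leaves in the angle at `e` from `x` to `f`. The identity `key`, with positive coefficients,
excludes the other sign patterns. -/
theorem First.position {σ : ℝ} {f c x v g p : Plane} (F : First T R k e E σ f c x g e p)
    (W : Wall T R k e E σ f c x v g) (h : Conf T R k e E) (hkx : k ≠ x) :
    0 < D σ e x k ∧ 0 < D σ e k f := by
  have hσ := ne_zero_of_D W.pos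
  have hkT := h.memT k h.k_mem
  have hke := h.ne_of_mem h.k_mem h.start
  have hkf := h.ne_of_mem h.k_mem W.hf
  have hxe : x ≠ e := fun hx => W.xo (hx ▸ F.zi)
  have hOb : s(k, e) ∈ Ob R k e E := Or.inl (Or.inl rfl)
  have hv : v = g → k ≠ g ∧ e ≠ g := by
    rintro rfl
    rcases W.alt with ⟨h₁, -, -⟩ | ⟨-, h₁⟩
    · subst h₁
      exact ⟨fun hk => h.outer (hk ▸ W.ci), F.zc⟩
    · exact absurd rfl h₁
  have hkTri : k ∉ Tri f g x := by
    intro hk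
    rcases W.vertex h hkT hk with h' | h'
    · exact h.outer h'
    · exact hkx h'
  have c₁ : 0 < D σ e f g := by rw [D_rot]; exact F.fgz W
  have c₂ : 0 < D σ e g x := by rw [D_rot]; exact F.gxz W h
  have c₃ : 0 < D σ e x f := by rw [← D_rot]; exact F.fzx W
  have w₁ : 0 ≤ D σ e f k → 0 ≤ D σ e k g → False := by
    intro h₁ h₂
    obtain ⟨r, hr, hr'⟩ := wedge h₁ h₂ c₁ (fun hk => hkTri (Tri_subset (convex_Tri _ _ _) F.zTri
      (Tri_left _ _ _) (Tri_mid _ _ _) hk))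
    rw [segment_symm] at hr
    exact F.hit_fg W h hOb hkx hxe.symm hkf F.zf hv hr hr'
  have w₂ : 0 ≤ D σ e g k → 0 ≤ D σ e k x → False := by
    intro h₁ h₂
    obtain ⟨r, hr, hr'⟩ := wedge h₁ h₂ c₂ (fun hk => hkTri (Tri_subset (convex_Tri _ _ _) F.zTri
      (Tri_mid _ _ _) (Tri_right _ _ _) hk))
    rw [segment_symm] at hr
    exact F.hit_gx W h hOb hkx hxe.symm hv hr hr'
  have key : D σ e g x * D σ e f k + D σ e x f * D σ e g k + D σ e f g * D σ e x k = 0 := by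
    unfold D; ring
  have sw : ∀ u w, D σ e u w = - D σ e w u := fun u w => D_swap ..
  rcases le_or_gt 0 (D σ e g k) with h₁ | h₁
  · have h₂ : 0 < D σ e x k := by
      by_contra hcon
      exact w₂ h₁ (by rw [sw]; linarith)
    refine ⟨h₂, ?_⟩
    by_contra hcon
    rw [sw] at hcon
    have := mul_nonneg c₂.le (by linarith : 0 ≤ D σ e f k)
    have := mul_nonneg c₃.le h₁
    have := mul_pos c₁ h₂
    linarith
  · have h₂ : D σ e f k < 0 := by
      by_contra hcon
      exact w₁ (by linarith) (by rw [sw]; linarith)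
    refine ⟨?_, by rw [sw]; linarith⟩
    by_contra hcon
    have := mul_pos c₂ (by linarith : 0 < -D σ e f k)
    have := mul_pos c₃ (by linarith : 0 < -D σ e g k)
    have := mul_nonneg c₁.le (by linarith : 0 ≤ -D σ e x k)
    linarith

/-- The wall at an inner vertex that is seen from `f`. -/
theorem Conf.stepWall (h : Conf T R k e E) {f g : Plane} (hf : f ∈ E) (hg : g ∈ R)
    (hgi : Inner T g) (hc : Clear (Ob R k e E) f g) (hn : ¬ Prog T R (Ob R k e E) f) :
    ∃ g', s(g, g') ∈ ES R ∧ Inner T g' ∧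
      ∃ x, ∀ σ, 0 < D σ f g g' → RWall T R k e E σ f g x g g := by
  obtain ⟨A, x, g', B, hR, hxo, hg'i, side, side'⟩ := h.stepV hf hg hgi hc hn
  have hgg' : s(g, g') ∈ ES R := by
    rw [hR, ← List.singleton_append (l := g :: g' :: B), ← List.append_assoc, ES_append]
    exact Or.inl rfl
  refine ⟨g', hgg', hg'i, x, fun σ hσg => ?_⟩
  have hσ := ne_zero_of_D hσg
  have hpos := side σ hσg
  have hxg : s(x, g) ∈ RE R k e := h.edge_mem hR
  refine ⟨⟨hf, hgi, (h.of_Ob (Or.inl hxg)).2.1, hxo, hxg, right_mem_segment _ _ _,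
    right_mem_segment _ _ _, hpos, ?_, Or.inl ⟨rfl, rfl, ?_⟩⟩, ⟨A, _, hR⟩,
    fun hh => hh.not_inner_right hgi, Or.inr ⟨rfl, hc⟩⟩
  · have key : ∀ b, s(g, b) ∈ Ob R k e E → b ≠ f → ∀ q ∈ segment ℝ g b, q ∈ segment ℝ f g →
        q = g := by
      intro b hb hbf q hq hq'
      obtain ⟨hgb, -, hbT⟩ := h.of_Ob hb
      rw [segment_symm] at hq'
      exact segment_inter_of_D (h.gp g hgi.1 b hbT f (h.inner f hf).1 hgb hbf
        (h.ne_of_mem hg hf)) hq hq'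
    intro a b hab haf hbf q hq hq'
    by_cases hag : a = g
    · subst hag
      exact key b hab hbf q hq hq'
    by_cases hbg : b = g
    · subst hbg
      exact key a (by rwa [Sym2.eq_swap]) haf q (by rwa [segment_symm]) hq'
    exact absurd hq (Set.disjoint_left.1 (hc a b hab (Ne.symm haf) (Ne.symm hbf) (Ne.symm hag)
      (Ne.symm hbg)) hq')
  · intro b hb hbx hbf q hq hqT
    -- Apart from `xg`, the only edge at `g` is `gg'`, which points away from the triangle by
    -- `side'`.
    have hbg' : b = g' := by
      by_contra hbg'
      rcases hb with (hb | hb) | hb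
      · rcases Sym2.eq_iff.1 hb with ⟨h', -⟩ | ⟨h', -⟩
        · exact h.outer (h' ▸ hgi)
        · exact h.disj g hg (h' ▸ h.start)
      · have hR' : R = (A ++ [x]) ++ g :: g' :: B := by simpa using hR
        obtain ⟨A', hA⟩ := prev_of_edge (hR' ▸ h.nodup) (by rw [← hR']; exact hb) hbg'
        have := List.append_inj_right' hA rfl
        exact hbx (by simpa using this.symm)
      · exact h.disj g hg (mem_segs.1 hb).1
    subst hbg'
    by_contra hqg
    have h₁ := (D_of_mem_Tri hpos.le hqT).2.1
    have h₂ : 0 < D (-σ) g x q := D_pos_of_mem_segment (u := b) (v := g)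
      (by rw [D_neg]; linarith [side' σ hpos]) (by simp) (by rwa [segment_symm]) hqg
    rw [D_neg] at h₂
    linarith

/-- Some inner point is swept, since otherwise `f` could be inserted at the wall. If the first one
belongs to `R`, it carries a new wall with fewer inner points to the left of the sightline, which is
the induction. If it belongs to `E`, it can be inserted at the wall in place of `f`. -/
theorem RWall.outcome {σ : ℝ} {f : Plane} (h : Conf T R k e E) (hfe : f ≠ e ∨ E = {e})
    (hn : ¬ Prog T R (Ob R k e E) f) {c x v g : Plane} (W : RWall T R k e E σ f c x v g) :
    Outcome T R k e E σ f c := by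
  classical
  induction hm : (T.filter fun w => Inner T w ∧ 0 < D σ f c w).card using
    Nat.strong_induction_on generalizing c x v g with
  | _ n ih =>
    obtain ⟨A, B, hR⟩ := W.split
    by_cases hZ : ∀ w, Inner T w → w ∈ Tri f g x → w = f ∨ w = c
    · refine absurd ⟨A, x, v, B, hR, W.nonhull, W.wall.clear_of_empty h hZ, ?_⟩ hn
      exact W.ends.imp_right fun h => h.2
    obtain ⟨z, p, F⟩ := W.wall.exists_first h hZ
    have hfcz := F.fcz W.wall
    have hfi := W.wall.fi h
    rcases h.cover z F.zi.1 with hzR | hzE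
    · obtain ⟨g', hgg', hg'i, x', hW⟩ := h.stepWall W.wall.hf hzR F.zi F.sees hn
      have W' := hW σ (F.left_of_mem W.wall h hgg' hg'i)
      have tr : ∀ w, Inner T w → 0 < D σ f z w → 0 < D σ f c w := fun w hw hzw =>
        Ext_trans (h.two.ext hfi) ⟨W.wall.ci, W.wall.fc.symm⟩ ⟨F.zi, F.zf⟩
          ⟨hw, (ne_of_D hzw).2.2.symm⟩ hfcz hzw
      obtain ⟨z', hz', hz'f, hzz', rest⟩ := ih _ (by
        rw [← hm]
        refine Finset.card_lt_card (Finset.ssubset_iff_of_subset ?_ |>.2 ⟨z, ?_, ?_⟩)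
        · intro w hw
          rw [Finset.mem_filter] at hw ⊢
          exact ⟨hw.1, hw.2.1, tr w hw.2.1 hw.2.2⟩
        · rw [Finset.mem_filter]
          exact ⟨F.zi.1, F.zi, hfcz⟩
        · rw [Finset.mem_filter]
          simp) W' rfl
      exact ⟨z', hz', hz'f, tr z' (h.inner z' hz') hzz', rest⟩
    · have hfe' : f ≠ e := by
        rcases hfe with hfe | hfe
        · exact hfe
        · rintro rfl
          rw [hfe, Finset.mem_singleton] at hzE
          exact absurd hzE F.zf
      refine ⟨z, hzE, F.zf, hfcz, A, x, v, B, hR, W.nonhull, F.sees_x W.wall h, ?_, ?_⟩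
      · refine W.ends.imp_right fun hv => ⟨?_, ?_⟩
        · rw [hv.1]
          exact F.sees_g W.wall h hfe' hv.1
        · rw [hv.1, D_rot]
          exact F.fgz W.wall
      · rintro rfl
        refine F.position W.wall h ?_
        rintro rfl
        have h₁ := h.last
        have h₂ := h.nodup
        rw [hR] at h₁ h₂
        have h₃ : k ∈ v :: B := by
          rw [List.getLast?_append_of_ne_nil _ (by simp), List.getLast?_cons_cons] at h₁
          exact List.mem_of_getLast? h₁
        exact (List.nodup_cons.1 (List.nodup_append.1 h₂).2.1).1 h₃

end PlanePaths

/-! ### Making another point of the tail the first one -/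

namespace PlanePaths

open List

variable {T : Finset Plane} {R : List Plane} {k e : Plane} {E : Finset Plane}

theorem Outcome.prog {z x v : Plane} {A B : List Plane} {O : Set (Sym2 Plane)}
    (hR : R = A ++ x :: v :: B) (hh : ¬ HullEdge T x v) (hx : Clear O z x)
    (hv : ¬ Inner T v ∨ Clear O z v) : Prog T R O z := ⟨A, x, v, B, hR, hh, hx, hv⟩

/-- Some point of `E` that need not come first can be inserted into `R`, possibly after another
point of `E` has been put first. -/
def Good (T : Finset Plane) (R : List Plane) (k e : Plane) (E : Finset Plane) : Prop :=
  (∃ f ∈ E, (f ≠ e ∨ E = {e}) ∧ Prog T R (Ob R k e E) f) ∨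
  (∃ f ∈ E, f ≠ e ∧ Clear (Ob R k e E) f k ∧ Prog T R (Ob R k f E) e)

namespace Conf

/-- The wall formed by the edge `ke`, seen from a suitable point of `E`. -/
theorem exists_hatWall (h : Conf T R k e E) {σ : ℝ} {f : Plane} (hf : f ∈ E)
    (hpos : 0 < D σ e k f) :
    ∃ f' ∈ E, 0 < D σ e k f' ∧ (∀ u ∈ E, 0 < D σ e k u → u ≠ f' → 0 < D σ e f' u) ∧
      Wall T R k e E σ f' e k e e := by
  classical
  have hσ := ne_zero_of_D hpos
  have hei := h.inner e h.start
  have hke := h.ne_of_mem h.k_mem h.start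
  have hkT := h.memT k h.k_mem
  have hmem : ∀ u, u ∈ E.filter (fun u => 0 < D σ e k u) ↔ u ∈ E ∧ 0 < D σ e k u := fun u =>
    Finset.mem_filter
  obtain ⟨f', hf', hfirst⟩ := exists_tangent (σ := σ) (a := e)
    (G := E.filter fun u => 0 < D σ e k u) ⟨f, (hmem f).2 ⟨hf, hpos⟩⟩
    (Ext_of_D' (σ := σ) (b := k) fun u hu => ((hmem u).1 hu).2)
    (fun a ha b hb hab => by
      rw [hmem] at ha hb
      exact h.gp.ne hσ hei.1 (h.inner a ha.1).1 (h.inner b hb.1).1 (ne_of_D ha.2).2.2 hab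
        (ne_of_D hb.2).2.2)
  obtain ⟨hf'E, hf'pos⟩ := (hmem f').1 hf'
  have hfirst' : ∀ u ∈ E, 0 < D σ e k u → u ≠ f' → 0 < D σ e f' u := fun u hu hu' hne =>
    hfirst u ((hmem u).2 ⟨hu, hu'⟩) hne
  have hf'i := h.inner f' hf'E
  have hef' : e ≠ f' := (ne_of_D hf'pos).2.2
  have hkf' : k ≠ f' := h.ne_of_mem h.k_mem hf'E
  refine ⟨f', hf'E, hf'pos, hfirst', hf'E, hei, hkT, h.outer, Or.inl rfl, right_mem_segment _ _ _,
    right_mem_segment _ _ _, by rw [D_rot]; exact hf'pos, ?_, Or.inl ⟨rfl, rfl, ?_⟩⟩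
  · have shared : ∀ b, s(e, b) ∈ Ob R k e E → b ≠ f' → ∀ q ∈ segment ℝ e b,
        q ∈ segment ℝ f' e → q = e := by
      intro b hb hbf q hq hq'
      obtain ⟨heb, -, hbT⟩ := h.of_Ob hb
      rw [segment_symm] at hq'
      exact segment_inter_of_D (h.gp e hei.1 b hbT f' hf'i.1 heb hbf hef') hq hq'
    intro a b hab haf hbf q hq hq'
    by_cases hae : a = e
    · subst hae
      exact shared b hab hbf q hq hq'
    by_cases hbe : b = e
    · subst hbe
      exact shared a (by rwa [Sym2.eq_swap]) haf q (by rwa [segment_symm]) hq'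
    exfalso
    rcases hab with hab | hab
    · have hfe : s(f', e) ∈ Ob R k e E := Or.inr (mem_segs.2 ⟨hf'E, h.start, hef'.symm⟩)
      exact Set.disjoint_left.1 (h.clear a b hab f' e hfe haf hae hbf hbe) hq hq'
    rw [mem_segs] at hab
    obtain ⟨haE, hbE, hab⟩ := hab
    have hai := h.inner a haE
    have hbi := h.inner b hbE
    have hka := h.ne_of_mem h.k_mem haE
    have hkb := h.ne_of_mem h.k_mem hbE
    have h₀ : D σ e f' q = 0 := by
      rw [D_swap', D_of_mem_segment hq', neg_zero]
    have hqe : q ≠ e := by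
      rintro rfl
      rcases h.gp.eq_or_eq_of_mem_segment hai.1 hbi.1 hei.1 hq with h' | h'
      · exact hae h'.symm
      · exact hbe h'.symm
    have hqk : 0 < D σ e k q := D_pos_of_mem_segment hf'pos (by simp) hq' hqe
    have na := h.gp.ne hσ hei.1 hf'i.1 hai.1 hef' (Ne.symm haf) (Ne.symm hae)
    have nb := h.gp.ne hσ hei.1 hf'i.1 hbi.1 hef' (Ne.symm hbf) (Ne.symm hbe)
    wlog ha : D σ e f' a < 0 generalizing a b
    · refine this b a hbf haf (by rwa [segment_symm]) hbe hae hbE haE hab.symm hbi hai hkb hka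
        nb na ?_
      rcases D_opposite h₀ hq na nb with h' | h'
      · exact h'.2
      · exact absurd h'.1 ha
    have hb : 0 < D σ e f' b := by
      rcases D_opposite h₀ hq na nb with h' | h'
      · linarith
      · exact h'.2
    -- Among the points beyond `ek` none precedes `f'`, so `a` is on the other side of `ek`. Then
    -- `k` lies in the angle at `e` from `a` to `b`, and `ke` would have to cross `ab`.
    have hak : D σ e k a < 0 := by
      refine lt_of_le_of_ne (not_lt.1 fun hcon => ?_)
        (h.gp.ne hσ hei.1 hkT hai.1 hke.symm hka (Ne.symm hae))
      have := hfirst' a haE hcon haf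
      linarith
    have hbk : 0 < D σ e k b := by
      by_contra hcon
      have h₁ := D_nonneg_of_mem_segment (σ := -σ) (p := e) (q := k) (u := a) (v := b)
        (by rw [D_neg]; linarith) (by rw [D_neg]; linarith) hq
      rw [D_neg] at h₁
      linarith
    have haf'  : 0 < D σ e a f' := by rw [D_swap]; linarith
    have hab' : 0 < D σ e a b := Ext_trans (h.two.ext hei) ⟨hai, hae⟩ ⟨hf'i, hef'.symm⟩
      ⟨hbi, hbe⟩ haf' hb
    obtain ⟨r, hr, hr'⟩ := wedge (by rw [D_swap]; linarith : 0 ≤ D σ e a k) hbk.le hab'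
      (fun hk => by
        rcases eq_of_mem_Tri_of_not_inner hei.1 hai.1 hbi.1 hkT h.outer hk with h' | h' | h'
        · exact hke h'
        · exact hka h'
        · exact hkb h')
    rw [segment_symm] at hr
    exact Set.disjoint_left.1 (h.clear k e (Or.inl rfl) a b (Or.inr (mem_segs.2 ⟨haE, hbE, hab⟩))
      hka hkb (Ne.symm hae) (Ne.symm hbe)) hr hr'
  · intro b hb hbk hbf q hq hqT
    have hbE : b ∈ E := by
      rcases hb with (hb | hb) | hb
      · rcases Sym2.eq_iff.1 hb with ⟨h', -⟩ | ⟨-, h'⟩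
        · exact absurd h'.symm hke
        · exact absurd h' hbk
      · exact absurd h.start (h.disj e (mem_of_mem_edgesL hb).1)
      · exact (mem_segs.1 hb).2.1
    have hbe := (h.of_Ob hb).1
    by_contra hqe
    have hpos' : 0 < D σ f' e k := by rw [D_rot]; exact hf'pos
    obtain ⟨t₁, t₂, -⟩ := D_of_mem_Tri hpos'.le hqT
    rw [segment_symm] at hq
    have n := h.gp.ne hσ hei.1 hkT (h.inner b hbE).1 hke.symm hbk.symm hbe
    rcases lt_or_gt_of_ne n with h' | h'
    · have := D_pos_of_mem_segment (σ := -σ) (p := e) (q := k) (u := b) (v := e) (z := q)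
        (by rw [D_neg]; linarith) (by simp) hq hqe
      rw [D_neg] at this
      linarith
    · have := hfirst' b hbE h' hbf
      have := D_pos_of_mem_segment (σ := σ) (p := e) (q := f') (u := b) (v := e) (z := q)
        this (by simp) hq hqe
      rw [D_swap'] at this
      linarith

/-- The point `f'` may be put first, unless some other point can be inserted into `R`. -/
theorem hat_clear (h : Conf T R k e E) {σ : ℝ} {f' : Plane}
    (hfirst : ∀ u ∈ E, 0 < D σ e k u → u ≠ f' → 0 < D σ e f' u)
    (W : Wall T R k e E σ f' e k e e)
    (hn : ∀ f ∈ E, f ≠ e → ¬ Prog T R (Ob R k e E) f) : Clear (Ob R k e E) f' k := by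
  have hσ := ne_zero_of_D W.pos
  have hf'e : f' ≠ e := (ne_of_D W.pos).1
  by_cases hZ : ∀ w, Inner T w → w ∈ Tri f' e k → w = f' ∨ w = e
  · exact W.clear_of_empty h hZ
  exfalso
  obtain ⟨z, p, F⟩ := W.exists_first h hZ
  rcases h.cover z F.zi.1 with hzR | hzE
  · obtain ⟨g', hgg', hg'i, x', hW⟩ := h.stepWall W.hf hzR F.zi F.sees (hn f' W.hf hf'e)
    obtain ⟨z', hz', hz'f, hzz', A, x, v, B, hR, hh, hx, hv, -⟩ :=
      (hW σ (F.left_of_mem W h hgg' hg'i)).outcome h (Or.inl hf'e) (hn f' W.hf hf'e)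
    have hez' := Ext_trans (h.two.ext (W.fi h)) ⟨W.ci, W.fc.symm⟩ ⟨F.zi, F.zf⟩
      ⟨h.inner z' hz', hz'f⟩ (F.fcz W) hzz'
    exact hn z' hz' (ne_of_D hez').2.1.symm (Outcome.prog hR hh hx (hv.imp_right fun h => h.1))
  -- A point of `E` in the triangle `f'ek` would precede `f'` in the angular order around `e`.
  · obtain ⟨t₁, t₂, -⟩ := D_of_mem_Tri W.pos.le F.zTri
    have hkz := h.ne_of_mem h.k_mem hzE
    have n := h.gp.ne hσ W.ci.1 W.xT F.zi.1 (h.ne_of_mem h.k_mem h.start).symm hkz F.zc.symm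
    have := hfirst z hzE (lt_of_le_of_ne t₂ n.symm) F.zf
    rw [D_swap'] at this
    linarith

/-- Only the case that the point to be inserted is `e` needs work. Then `f'`, the first point of `E`
after `k` around `e`, sees `k` and may open the tail instead. It has to be checked that the new edge
`kf'` hides neither end of the target edge from `e`, as far as they are needed. -/
theorem good_of_outcome (h : Conf T R k e E) {σ : ℝ} {f c : Plane} (hf : f ∈ E)
    (ho : Outcome T R k e E σ f c) : Good T R k e E := by
  by_contra hng
  unfold Good at hng
  push Not at hng
  obtain ⟨hn₁, hn₂⟩ := hng
  have hn : ∀ f ∈ E, f ≠ e → ¬ Prog T R (Ob R k e E) f := fun f hf hfe =>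
    hn₁ f hf (Or.inl hfe)
  obtain ⟨z, hz, hzf, -, A, x, v, B, hR, hh, hx, hv, hpos⟩ := ho
  by_cases hze : z = e
  swap
  · exact hn z hz hze (Outcome.prog hR hh hx (hv.imp_right fun h => h.1))
  subst hze
  obtain ⟨hxk, hkf⟩ := hpos rfl
  have hσ := ne_zero_of_D hkf
  obtain ⟨f', hf', hkf', hfirst, W⟩ := h.exists_hatWall hf hkf
  have hf'e : f' ≠ z := (ne_of_D W.pos).1
  have hcl := h.hat_clear hfirst W hn
  refine hn₂ f' hf' hf'e hcl ?_
  have hkT := h.memT k h.k_mem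
  have hzT := (h.inner z hz).1
  have hvT := (h.of_Ob (Or.inl (h.edge_mem hR))).2.2
  have hxT := (h.of_Ob (Or.inl (h.edge_mem hR))).2.1
  have extend : ∀ w, Clear (Ob R k z E) z w →
      (k ≠ w → f' ≠ w → Disjoint (segment ℝ z w) (segment ℝ k f')) →
      Clear (Ob R k f' E) z w := by
    intro w hw hd
    have : Ob R k f' E = insert s(k, f') (ES R ∪ segs E) := by
      simp only [Ob, RE, Set.insert_union]
    rw [this]
    refine (hw.mono ?_).insert (fun _ _ h₁ h₂ => hd h₁.symm h₂.symm)
    exact Set.union_subset_union_left _ (Set.subset_insert _ _)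
  -- Except for `k`, the edge `kf'` lies strictly on one side of the line `ek`, so a target on the
  -- other side stays visible.
  have below : ∀ w ∈ T, w ≠ k → D σ z k w ≤ 0 → Disjoint (segment ℝ z w) (segment ℝ k f') := by
    intro w hw hwk hwD
    rw [Set.disjoint_left]
    intro r hr hr'
    have h₁ : 0 ≤ D (-σ) z k r := D_nonneg_of_mem_segment (u := z) (v := w) (by simp)
      (by rw [D_neg]; linarith) hr
    rw [D_neg] at h₁
    by_cases hrk : r = k
    · subst hrk
      rcases h.gp.eq_or_eq_of_mem_segment hzT hw hkT hr with h' | h'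
      · exact h.ne_of_mem h.k_mem hz h'
      · exact hwk h'.symm
    · have := D_pos_of_mem_segment (σ := σ) (p := z) (q := k) (u := f') (v := k) (z := r) hkf'
        (by simp) (by rwa [segment_symm]) hrk
      linarith
  refine Outcome.prog hR hh (extend x hx fun hk _ => below x hxT hk.symm ?_) ?_
  · rw [D_swap]; linarith
  · refine hv.imp_right fun hv => extend v hv.1 fun hkv hfv => ?_
    rcases le_or_gt (D σ z k v) 0 with h₁ | h₁
    · exact below v hvT hkv.symm h₁
    -- Otherwise `v` comes after `f`, hence after `f'`, in the angular order, whereas `kf'` stays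
    -- between `k` and `f'`.
    have hf'v : 0 < D σ z f' v := by
      by_cases hff : f = f'
      · rw [← hff]; exact hv.2
      · exact Ext_trans (G := {u | 0 < D σ z k u}) (Ext_of_D' (σ := σ) (b := k) fun u hu => hu)
          hkf' hkf h₁ (hfirst f hf hkf hff) hv.2
    rw [Set.disjoint_left]
    intro r hr hr'
    have h₂ : 0 ≤ D σ z f' r := D_nonneg_of_mem_segment (u := z) (v := v) (by simp) hf'v.le hr
    by_cases hrf : r = f'
    · subst hrf
      rcases h.gp.eq_or_eq_of_mem_segment hzT hvT (h.inner r hf').1 hr with h' | h'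
      · exact hf'e h'
      · exact hfv h'
    · have := D_pos_of_mem_segment (σ := -σ) (p := z) (q := f') (u := k) (v := f') (z := r)
        (by rw [D_neg, ← D_swap]; exact hkf') (by simp) hr' hrf
      rw [D_neg] at this
      linarith

/-- The case that `f` sees an inner vertex of the path. -/
theorem good_of_sees (h : Conf T R k e E) {f g : Plane} (hf : f ∈ E) (hfe : f ≠ e ∨ E = {e})
    (hg : g ∈ R) (hgi : Inner T g) (hc : Clear (Ob R k e E) f g) : Good T R k e E := by
  by_cases hn : Prog T R (Ob R k e E) f
  · exact Or.inl ⟨f, hf, hfe, hn⟩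
  obtain ⟨g', hgg', hg'i, x, hW⟩ := h.stepWall hf hg hgi hc hn
  obtain ⟨σ, -, hσ⟩ := exists_sign (h.gp f (h.inner f hf).1 g hgi.1 g' hg'i.1
    (h.ne_of_mem hg hf).symm (ne_of_mem_edgesL h.nodup hgg')
    (h.ne_of_mem (mem_of_mem_edgesL hgg').2 hf).symm)
  exact h.good_of_outcome hf ((hW σ hσ).outcome h hfe hn)

end Conf

end PlanePaths

/-! ### Choosing the viewpoint -/

namespace PlanePaths

open List

variable {T : Finset Plane} {R : List Plane} {k e : Plane} {E : Finset Plane}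

theorem isCompact_seg (a b : Plane) : IsCompact (segment ℝ a b) := by
  rw [← convexHull_pair]
  exact (Set.toFinite {a, b}).isCompact_convexHull ℝ

/-- A nearest point of intersection of the segment `fc` with finitely many segments. -/
theorem exists_nearest (f c : Plane) (P : Finset (Plane × Plane))
    (hne : ∃ p ∈ P, ¬ Disjoint (segment ℝ f c) (segment ℝ p.1 p.2)) :
    ∃ p ∈ P, ∃ y, y ∈ segment ℝ f c ∧ y ∈ segment ℝ p.1 p.2 ∧
      ∀ p' ∈ P, ∀ q ∈ segment ℝ p'.1 p'.2, q ∈ segment ℝ f y → q = y := by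
  have hK : IsCompact (⋃ p ∈ P, segment ℝ f c ∩ segment ℝ p.1 p.2) :=
    P.isCompact_biUnion fun p _ => (isCompact_seg f c).inter (isCompact_seg p.1 p.2)
  obtain ⟨p, hp, hd⟩ := hne
  obtain ⟨q, hq, hq'⟩ := Set.not_disjoint_iff.1 hd
  obtain ⟨y, hy, hmin⟩ := hK.exists_isMinOn ⟨q, Set.mem_biUnion hp ⟨hq, hq'⟩⟩
    (f := fun q => dist f q) (continuous_const.dist continuous_id).continuousOn
  simp only [Set.mem_iUnion] at hy
  obtain ⟨p₁, hp₁, hy, hy'⟩ := hy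
  refine ⟨p₁, hp₁, y, hy, hy', fun p' hp' r hr hr' => ?_⟩
  have h₁ : dist f y ≤ dist f r := hmin (Set.mem_biUnion hp'
    ⟨(convex_segment f c).segment_subset (left_mem_segment ℝ _ _) hy hr', hr⟩)
  have h₂ := dist_add_dist_of_mem_segment hr'
  have h₃ := dist_nonneg (x := r) (y := y)
  exact dist_le_zero.1 (by linarith)

namespace Conf

/-- Take the edge `xv` of `R` that the sightline `fc` meets first, at `y`. If one of its ends is
inner, `f` sees that end: the triangle it spans with `f` and `y` lies in one with inner corners. If
both ends are extreme, the edge is a wall to which `RWall.outcome` applies. -/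
theorem good_of_viewpoint (h : Conf T R k e E) {f c : Plane} (hf : f ∈ E)
    (hfe : f ≠ e ∨ E = {e}) (hc : c ∈ R) (hci : Inner T c)
    (hE : ∀ a ∈ E, ∀ b ∈ E, a ≠ f → b ≠ f → Disjoint (segment ℝ f c) (segment ℝ a b))
    (hk : f ≠ e → Disjoint (segment ℝ f c) (segment ℝ k e)) : Good T R k e E := by
  classical
  by_cases hn : Prog T R (Ob R k e E) f
  · exact Or.inl ⟨f, hf, hfe, hn⟩
  by_cases hcl : Clear (Ob R k e E) f c
  · exact h.good_of_sees hf hfe hc hci hcl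
  have hfi := h.inner f hf
  have hfc : f ≠ c := (h.ne_of_mem hc hf).symm
  set P := (T ×ˢ T).filter (fun p => s(p.1, p.2) ∈ Ob R k e E ∧ p.1 ≠ f ∧ p.2 ≠ f ∧ p.1 ≠ c ∧
    p.2 ≠ c) with hPdef
  have hP : ∀ a b, (a, b) ∈ P ↔ s(a, b) ∈ Ob R k e E ∧ a ≠ f ∧ b ≠ f ∧ a ≠ c ∧ b ≠ c := by
    intro a b
    rw [hPdef, Finset.mem_filter, Finset.mem_product]
    exact ⟨fun h => h.2, fun h' => ⟨(h.of_Ob h'.1).2, h'⟩⟩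
  obtain ⟨⟨a, b⟩, hp, y, hyf, hyab, hnear⟩ := exists_nearest f c P (by
    unfold Clear at hcl
    push Not at hcl
    obtain ⟨a, b, hab, h₁, h₂, h₃, h₄, hd⟩ := hcl
    exact ⟨(a, b), (hP a b).2 ⟨hab, h₁.symm, h₂.symm, h₃.symm, h₄.symm⟩, hd⟩)
  rw [hP] at hp
  obtain ⟨hab, haf, hbf, hac, hbc⟩ := hp
  simp only at hyab
  have habR : s(a, b) ∈ ES R := by
    rcases hab with (hab | hab) | hab
    · exfalso
      have hke := h.ne_of_mem h.k_mem h.start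
      have hfe' : f ≠ e := by
        rcases Sym2.eq_iff.1 hab with ⟨-, h'⟩ | ⟨h', -⟩
        · exact h' ▸ hbf.symm
        · exact h' ▸ haf.symm
      refine Set.disjoint_left.1 (hk hfe') hyf ?_
      rcases Sym2.eq_iff.1 hab with ⟨rfl, rfl⟩ | ⟨rfl, rfl⟩
      · exact hyab
      · rwa [segment_symm]
    · exact hab
    · rw [mem_segs] at hab
      exact absurd hyab (Set.disjoint_left.1 (hE a hab.1 b hab.2.1 haf hbf) hyf)
  obtain ⟨A, x, v, B, hR, hxv⟩ := mem_edgesL_iff.1 habR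
  obtain ⟨hxvE, hxf, hvf, hxc, hvc, hyxv⟩ : s(x, v) ∈ Ob R k e E ∧ x ≠ f ∧ v ≠ f ∧ x ≠ c ∧
      v ≠ c ∧ y ∈ segment ℝ x v := by
    rcases Sym2.eq_iff.1 hxv with ⟨rfl, rfl⟩ | ⟨rfl, rfl⟩
    · exact ⟨hab, haf, hbf, hac, hbc, hyab⟩
    · exact ⟨by rwa [Sym2.eq_swap], hbf, haf, hbc, hac, by rwa [segment_symm]⟩
  clear hxv hyab hbc hac haf hbf hab habR a b
  have hxvR : s(x, v) ∈ RE R k e := h.edge_mem hR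
  obtain ⟨hxv, hxT, hvT⟩ := h.of_Ob hxvE
  have hyT : y ∉ T := by
    intro hyT
    rcases h.gp.eq_or_eq_of_mem_segment hfi.1 hci.1 hyT hyf with rfl | rfl <;>
      rcases h.gp.eq_or_eq_of_mem_segment hxT hvT hyT hyxv with h' | h'
    · exact hxf h'.symm
    · exact hvf h'.symm
    · exact hxc h'.symm
    · exact hvc h'.symm
  have hyf' : y ≠ f := fun h' => hyT (h' ▸ hfi.1)
  have hyc : y ≠ c := fun h' => hyT (h' ▸ hci.1)
  have hyx : y ≠ x := fun h' => hyT (h' ▸ hxT)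
  have hyv : y ≠ v := fun h' => hyT (h' ▸ hvT)
  have H₁ : ∀ a b, s(a, b) ∈ Ob R k e E → a ≠ f → b ≠ f → ∀ q ∈ segment ℝ a b,
      q ∈ segment ℝ f y → q = y := by
    have atc : ∀ b, s(c, b) ∈ Ob R k e E → b ≠ f → ∀ q ∈ segment ℝ c b,
        q ∈ segment ℝ f y → q = y := by
      intro b hb hbf q hq hq'
      exfalso
      obtain ⟨hcb, -, hbT⟩ := h.of_Ob hb
      have hqfc : q ∈ segment ℝ c f := by
        rw [segment_symm]
        exact (convex_segment f c).segment_subset (left_mem_segment ℝ _ _) hyf hq'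
      have := segment_inter_of_D (h.gp c hci.1 b hbT f hfi.1 hcb hbf hfc.symm) hq hqfc
      subst this
      rw [segment_symm] at hq'
      exact hyc (eq_of_mem_segments hq' hyf).symm
    intro a b hab haf hbf q hq hq'
    by_cases hac : a = c
    · subst hac
      exact atc b hab hbf q hq hq'
    by_cases hbc : b = c
    · subst hbc
      exact atc a (by rwa [Sym2.eq_swap]) haf q (by rwa [segment_symm]) hq'
    exact hnear (a, b) ((hP a b).2 ⟨hab, haf, hbf, hac, hbc⟩) q hq hq'
  obtain ⟨s, hs, hray⟩ := D_of_mem_ray (σ := 1) hyf hyf'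
  have sees : ∀ x v, s(x, v) ∈ RE R k e → y ∈ segment ℝ x v → x ≠ f → x ≠ c → y ≠ v →
      Inner T x → Clear (Ob R k e E) f x := by
    intro x v hxvR hyxv hxf hxc hyv hxi
    have hyx : y ≠ x := fun h' => hyT (h' ▸ hxi.1)
    obtain ⟨σ, hσ, hpos⟩ : ∃ σ : ℝ, σ ≠ 0 ∧ 0 < D σ f y x := exists_sign (by
      rw [hray]
      exact mul_ne_zero hs.ne' (h.gp f hfi.1 c hci.1 x hxi.1 hfc hxc.symm hxf.symm))
    have hsub : Tri f y x ⊆ Tri f c x := Tri_subset (convex_Tri _ _ _) (Tri_left _ _ _)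
      ((convex_Tri f c x).segment_subset (Tri_left _ _ _) (Tri_mid _ _ _) hyf) (Tri_right _ _ _)
    have H₄ : ∀ w ∈ T, w ∈ Tri f y x → w ∈ segment ℝ f x ∨ (w = v ∧ v = y) := by
      intro w hw hwT
      left
      rcases h.two.eq_of_mem_Tri hfi hci hxi hw (hsub hwT) with rfl | rfl | rfl
      · exact left_mem_segment ℝ _ _
      · exfalso
        have t := D_of_mem_Tri hpos.le hwT
        have : w ∈ segment ℝ f y := mem_segment_of_D (a := x) (by rw [D_rot]; exact hpos) t.2.2
          (by rw [D_swap, D_of_mem_segment hyf, neg_zero]) t.2.1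
        rw [segment_symm] at this
        exact hyc (eq_of_mem_segments this hyf).symm
      · exact right_mem_segment ℝ _ _
    have H₅ : ∀ w ∈ T, D σ f x w = 0 → w ∈ segment ℝ f x := by
      intro w hw hwD
      by_cases hwf : w = f
      · rw [hwf]; exact left_mem_segment ℝ f x
      by_cases hwx : w = x
      · rw [hwx]; exact right_mem_segment ℝ f x
      exact absurd hwD (h.gp.ne hσ hfi.1 hxi.1 hw hxf.symm (Ne.symm hwx) (Ne.symm hwf))
    intro a b hab haf hbf hax hbx
    rw [Set.disjoint_left]
    intro q hq' hq
    obtain ⟨-, haT, hbT⟩ := h.of_Ob hab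
    rcases h.reach hxvR hyxv hpos (right_mem_segment ℝ y x) hyx.symm H₁
      (fun h' => absurd h' hyv) H₄ H₅ hab haf.symm hbf.symm hq hq' with h' | h' | h'
    · rcases h.gp.eq_or_eq_of_mem_segment hfi.1 hxi.1 haT h' with h' | h'
      · exact haf h'.symm
      · exact hax h'.symm
    · rcases h.gp.eq_or_eq_of_mem_segment hfi.1 hxi.1 hbT h' with h' | h'
      · exact hbf h'.symm
      · exact hbx h'.symm
    · rw [h'] at hq
      rcases h.gp.eq_or_eq_of_mem_segment haT hbT hxi.1 hq with h' | h'
      · exact hax h'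
      · exact hbx h'
  have hxvL : s(x, v) ∈ ES R := mem_edgesL_iff.2 ⟨A, x, v, B, hR, rfl⟩
  by_cases hxi : Inner T x
  · exact h.good_of_sees hf hfe (mem_of_mem_edgesL hxvL).1 hxi (sees x v hxvR hyxv hxf hxc hyv hxi)
  by_cases hvi : Inner T v
  · exact h.good_of_sees hf hfe (mem_of_mem_edgesL hxvL).2 hvi
      (sees v x (by rwa [Sym2.eq_swap]) (by rwa [segment_symm]) hvf hvc hyx hvi)
  obtain ⟨σ, hσ, hpos⟩ : ∃ σ : ℝ, σ ≠ 0 ∧ 0 < D σ f y x := exists_sign (by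
    rw [hray]
    exact mul_ne_zero hs.ne' (h.gp f hfi.1 c hci.1 x hxT hfc hxc.symm hxf.symm))
  refine h.good_of_outcome hf (σ := σ) (c := c) (RWall.outcome h hfe hn (x := x) (v := v) (g := y)
    ⟨⟨hf, hci, hxT, hxi, hxvR, hyxv, hyf, hpos, H₁, Or.inr ⟨hyc, hyv⟩⟩, ⟨A, B, hR⟩, ?_,
      Or.inl hvi⟩)
  -- A hull edge would have `f` and `c` strictly on one side, yet `fc` meets `xv` in `y`.
  rintro ⟨-, τ, hτ⟩
  have h₁ := hτ f hfi.1 hxf.symm hvf.symm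
  have h₂ := hτ c hci.1 hxc.symm hvc.symm
  have := D_pos_of_mem_segment h₁ h₂.le hyf hyc
  rw [D_of_mem_segment hyxv] at this
  exact lt_irrefl _ this

/-- Another point of `E` may be put first if it sees the end of `R`. -/
theorem swap (h : Conf T R k e E) {f : Plane} (hf : f ∈ E) (hc : Clear (Ob R k e E) f k) :
    Conf T R k f E := by
  refine ⟨h.gp, h.two, h.memT, h.cover, h.inner, h.disj, h.nodup, h.last, h.outer, hf, ?_⟩
  have e₁ : Ob R k f E = insert s(k, f) (ES R ∪ segs E) := by simp only [Ob, RE, Set.insert_union]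
  have hsub : ES R ∪ segs E ⊆ Ob R k e E :=
    Set.union_subset_union_left _ (Set.subset_insert _ _)
  intro a b hab
  rw [show RE R k f ∪ segs E = _ from e₁]
  rcases hab with hab | hab
  · rw [clear_congr hab]
    exact (hc.symm.mono hsub).insert (fun h => absurd rfl h)
  · refine ((h.clear a b (Or.inr hab)).mono hsub).insert fun h₁ h₂ h₃ h₄ => ?_
    rw [segment_symm ℝ k f]
    exact (hc a b (Or.inl (Or.inr hab)) h₂.symm h₄.symm h₁.symm h₃.symm).symm

/-- If the path visits an inner point before it enters `E`, then it can be improved. -/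
theorem exists_good (h : Conf T R k e E) {c : Plane} (hc : c ∈ R) (hci : Inner T c) :
    Good T R k e E ∨ ∃ f ∈ E, f ≠ e ∧ Clear (Ob R k e E) f k ∧ Good T R k f E := by
  by_contra hcon
  push Not at hcon
  obtain ⟨hng, hng'⟩ := hcon
  have hext : Ext c (E : Set Plane) := (h.two.ext hci).mono fun u hu =>
    ⟨h.inner u hu, (h.ne_of_mem hc hu).symm⟩
  have hgp : ∀ σ : ℝ, σ ≠ 0 → ∀ g ∈ E, ∀ h ∈ E, g ≠ h → D σ c g h ≠ 0 := fun σ hσ a ha b hb hab =>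
    h.gp.ne hσ hci.1 (h.inner a ha).1 (h.inner b hb).1 (h.ne_of_mem hc ha) hab (h.ne_of_mem hc hb)
  -- A tangent from `c` to `E` crosses no segment of `E` away from its end `f`. There are two
  -- tangents, so `f` can be taken different from `e` unless `E = {e}`.
  obtain ⟨σ, f, hf, hfe, hside⟩ : ∃ σ : ℝ, ∃ f ∈ E, (f ≠ e ∨ E = {e}) ∧
      ∀ u ∈ E, u ≠ f → 0 < D σ c f u := by
    obtain ⟨u, hu, hu'⟩ := exists_tangent (σ := 1) ⟨e, h.start⟩ hext (hgp 1 (by norm_num))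
    obtain ⟨w, hw, hw'⟩ := exists_tangent (σ := -1) ⟨e, h.start⟩ hext (hgp (-1) (by norm_num))
    by_cases hue : u = e
    · by_cases hwe : w = e
      · refine ⟨1, u, hu, Or.inr ?_, hu'⟩
        subst hue hwe
        refine Finset.eq_singleton_iff_unique_mem.2 ⟨hu, fun x hx => ?_⟩
        by_contra hxu
        have h₁ := hu' x hx hxu
        have h₂ := hw' x hx hxu
        rw [D_neg] at h₂
        linarith
      · exact ⟨-1, w, hw, Or.inl hwe, hw'⟩
    · exact ⟨1, u, hu, Or.inl hue, hu'⟩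
  have hE : ∀ a ∈ E, ∀ b ∈ E, a ≠ f → b ≠ f → Disjoint (segment ℝ f c) (segment ℝ a b) := by
    intro a ha b hb haf hbf
    rw [segment_symm]
    exact disjoint_of_side (hside a ha haf) (hside b hb hbf)
  by_cases hd : f ≠ e → Disjoint (segment ℝ f c) (segment ℝ k e)
  · exact hng (h.good_of_viewpoint hf hfe hc hci hE hd)
  push Not at hd
  obtain ⟨hfe', hd⟩ := hd
  obtain ⟨y, hyfc, hyke⟩ := Set.not_disjoint_iff.1 hd
  have hei := h.inner e h.start
  have hfi := h.inner f hf
  have hkT := h.memT k h.k_mem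
  have hke := h.ne_of_mem h.k_mem h.start
  have hkf := h.ne_of_mem h.k_mem hf
  have hkc : k ≠ c := fun hkc => h.outer (hkc ▸ hci)
  have hce := h.ne_of_mem hc h.start
  have hcf := h.ne_of_mem hc hf
  have hyc : y ≠ c := by
    rintro rfl
    rcases h.gp.eq_or_eq_of_mem_segment hkT hei.1 hci.1 hyke with h' | h'
    · exact hkc h'.symm
    · exact hce h'
  have hyf : y ≠ f := by
    rintro rfl
    rcases h.gp.eq_or_eq_of_mem_segment hkT hei.1 hfi.1 hyke with h' | h'
    · exact hkf h'.symm
    · exact hfe' h'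
  obtain ⟨τ, hτ, hτpos⟩ := exists_sign (h.gp e hei.1 k hkT f hfi.1 hke.symm hkf hfe'.symm)
  obtain ⟨f', hf', hf'pos, hfirst, W⟩ := h.exists_hatWall hf hτpos
  have hf'e : f' ≠ e := (ne_of_D W.pos).1
  have hcl := h.hat_clear hfirst W fun f hf hfe hp => hng (Or.inl ⟨f, hf, Or.inl hfe, hp⟩)
  -- The edge `ke` crosses the tangent `fc`. So make `f'` first and use `e`, which is now free, as
  -- the viewpoint towards `c`.
  refine hng' f' hf' hf'e hcl ((h.swap hf' hcl).good_of_viewpoint h.start (Or.inl hf'e.symm)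
    hc hci ?_ fun _ => ?_)
  -- With `y` the crossing of `ke` and `fc`, a segment crossing `ec` would run into the triangle
  -- `ecy`. That triangle contains no further point of `E`, and its other sides lie on `ke` and on
  -- the tangent `cf`, which the segment does not cross.
  · have main : ∀ a ∈ E, ∀ b ∈ E, a ≠ e → b ≠ e → ∀ ρ : ℝ, 0 < D ρ e c b → 0 < D ρ e c f →
        a ≠ b → Disjoint (segment ℝ e c) (segment ℝ a b) := by
      intro a ha b hb hae hbe ρ hρb hρf hab
      have hbi := h.inner b hb
      rw [Set.disjoint_left]
      intro q hq hqab
      have hfcy : f ∉ segment ℝ c y := by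
        intro h'
        exact hyf (eq_of_mem_segments hyfc h')
      have hρy : 0 < D ρ e c y := D_pos_of_mem_segment hρf (by simp) hyfc hyc
      have hbT : b ∉ Tri e c y := by
        intro hbT
        have hbT' : b ∈ Tri e c f := Tri_subset (convex_Tri _ _ _) (Tri_left _ _ _) (Tri_mid _ _ _)
          ((convex_Tri e c f).segment_subset (Tri_right _ _ _) (Tri_mid _ _ _) hyfc) hbT
        rcases h.two.eq_of_mem_Tri hei hci hfi hbi.1 hbT' with h' | h' | h'
        · exact hbe h'
        · exact h.ne_of_mem hc hb h'.symm
        · subst h'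
          have t := D_of_mem_Tri hρy.le hbT
          refine hfcy (mem_segment_of_D (a := e) (by exact hρy) t.1 ?_ t.2.2)
          rw [D_swap, D_of_mem_segment (by rwa [segment_symm]), neg_zero]
      obtain ⟨r, hr, hr'⟩ := exit hρy hq hρb hbT
      have hrab : r ∈ segment ℝ a b :=
        (convex_segment a b).segment_subset hqab (right_mem_segment ℝ a b) hr
      rcases hr' with hr' | hr'
      · have hrke : r ∈ segment ℝ k e :=
          (convex_segment k e).segment_subset (right_mem_segment ℝ _ _) hyke hr'
        exact Set.disjoint_left.1 (h.clear k e (Or.inl rfl) a b (Or.inr (mem_segs.2 ⟨ha, hb, hab⟩))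
          (h.ne_of_mem h.k_mem ha) (h.ne_of_mem h.k_mem hb) hae.symm hbe.symm) hrke hrab
      · have hrcf : r ∈ segment ℝ f c :=
          (convex_segment f c).segment_subset (right_mem_segment ℝ _ _) hyfc hr'
        have atf : ∀ u ∈ E, u ≠ f → r ∈ segment ℝ u f → False := by
          intro u hu huf hru
          by_cases hrf : r = f
          · exact hfcy (hrf ▸ hr')
          · have := D_pos_of_mem_segment (hside u hu huf) (by simp) hru hrf
            rw [D_of_mem_segment (by rwa [segment_symm])] at this
            exact lt_irrefl _ this
        by_cases haf : a = f
        · subst haf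
          exact atf b hb hab.symm (by rwa [segment_symm])
        by_cases hbf : b = f
        · subst hbf
          exact atf a ha hab hrab
        exact Set.disjoint_left.1 (hE a ha b hb haf hbf) hrcf hrab
    intro a ha b hb hae hbe
    by_cases hab : a = b
    · subst hab
      rw [segment_same, Set.disjoint_singleton_right]
      intro h'
      rcases h.gp.eq_or_eq_of_mem_segment hei.1 hci.1 (h.inner a ha).1 h' with h' | h'
      · exact hae h'
      · exact h.ne_of_mem hc ha h'.symm
    obtain ⟨ρ, hρ, hρpos⟩ := exists_sign (h.gp e hei.1 c hci.1 f hfi.1 hce.symm hcf hfe'.symm)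
    by_cases hb' : 0 < D ρ e c b
    · exact main a ha b hb hae hbe ρ hb' hρpos hab
    by_cases ha' : 0 < D ρ e c a
    · rw [segment_symm ℝ a b]
      exact main b hb a ha hbe hae ρ ha' hρpos (Ne.symm hab)
    have na := h.gp.ne hρ hei.1 hci.1 (h.inner a ha).1 hce.symm (h.ne_of_mem hc ha) hae.symm
    have nb := h.gp.ne hρ hei.1 hci.1 (h.inner b hb).1 hce.symm (h.ne_of_mem hc hb) hbe.symm
    refine disjoint_of_side (σ := -ρ) ?_ ?_ <;> rw [D_neg]
    · linarith [lt_of_le_of_ne (not_lt.1 ha') na]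
    · linarith [lt_of_le_of_ne (not_lt.1 hb') nb]
  · rw [Set.disjoint_left]
    intro r hr hr'
    -- The line `ek` separates `c` from `f`, and hence from `f'`, so `ec` and `kf'` are on different
    -- sides.
    have hcneg : D τ e k c < 0 := by
      have h₀ : D τ e k y = 0 := by
        rw [D_swap', D_of_mem_segment hyke, neg_zero]
      rcases D_opposite h₀ hyfc hτpos.ne'
        (h.gp.ne hτ hei.1 hkT hci.1 hke.symm hkc hce.symm) with h' | h'
      · exact h'.2
      · linarith
    by_cases hrk : r = k
    · subst hrk
      rcases h.gp.eq_or_eq_of_mem_segment hei.1 hci.1 hkT hr with h' | h'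
      · exact hke h'
      · exact hkc h'
    have h₁ := D_pos_of_mem_segment (σ := τ) (p := e) (q := k) (u := f') (v := k) (z := r) hf'pos
      (by simp) (by rwa [segment_symm]) hrk
    have h₂ := D_nonneg_of_mem_segment (σ := -τ) (p := e) (q := k) (u := e) (v := c) (z := r)
      (by simp) (by rw [D_neg]; linarith) hr
    rw [D_neg] at h₂
    linarith

end Conf

end PlanePaths

/-! ### Hull edges of a path and insertion by two flips -/

namespace PlanePaths

open List

/-- The unordered pair `e` is a hull edge. -/
def IsHull (T : Finset Plane) (e : Sym2 Plane) : Prop := ∃ a b, e = s(a, b) ∧ HullEdge T a b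

theorem isHull_iff {T : Finset Plane} {a b : Plane} : IsHull T s(a, b) ↔ HullEdge T a b := by
  constructor
  · rintro ⟨c, d, h, hcd⟩
    rcases Sym2.eq_iff.1 h with ⟨rfl, rfl⟩ | ⟨rfl, rfl⟩
    · exact hcd
    · exact hcd.symm
  · exact fun h => ⟨a, b, rfl, h⟩

open Classical in
/-- The number of hull edges of a path. -/
noncomputable def hullCount (T : Finset Plane) (l : List Plane) : ℕ :=
  (edgesL l).countP fun e => decide (IsHull T e)

open Classical in
theorem hullCount_append (T : Finset Plane) (A : List Plane) (x y : Plane) (B : List Plane) :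
    hullCount T (A ++ x :: y :: B) =
      hullCount T (A ++ [x]) + hullCount T (y :: B) + if HullEdge T x y then 1 else 0 := by
  simp only [hullCount, edgesL_append, List.countP_append, List.countP_cons, isHull_iff,
    decide_eq_true_eq]
  omega

@[simp] theorem hullCount_reverse (T : Finset Plane) (l : List Plane) :
    hullCount T l.reverse = hullCount T l := by
  simp [hullCount, edgesL_reverse]

open Classical in
theorem hullCount_eq_zero {T : Finset Plane} {l : List Plane} (h : ∀ x ∈ l, Inner T x) :
    hullCount T l = 0 := by
  rw [hullCount, List.countP_eq_zero]
  intro e he hd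
  obtain ⟨a, b, rfl, hab⟩ := of_decide_eq_true hd
  exact hab.not_inner_left (h a (mem_of_mem_edgesL he).1)

/-- Hull edges have extreme ends, so rearranging a tail of inner points never costs a hull edge. -/
theorem hullCount_append_inner {T : Finset Plane} {R L : List Plane} (h : ∀ x ∈ L, Inner T x) :
    hullCount T (R ++ L) = hullCount T R := by
  cases L with
  | nil => simp
  | cons y L =>
    rcases List.eq_nil_or_concat R with rfl | ⟨R, x, rfl⟩
    · rw [List.nil_append, hullCount_eq_zero h]
      rfl
    · rw [List.concat_eq_append, List.append_assoc, List.singleton_append, hullCount_append,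
        hullCount_eq_zero h, if_neg fun hh => hh.not_inner_right (h y (by simp)), add_zero, add_zero]

/-- Adding an edge at the end of the path. -/
theorem flip {T : Finset Plane} {A C : List Plane} {a b f : Plane}
    (h : PH T (A ++ a :: b :: C)) (hf : (b :: C).getLast? = some f)
    (hc : Clear (ES (A ++ a :: b :: C)) a f) (hh : ¬ HullEdge T a b) :
    Step T (A ++ a :: b :: C) (A ++ a :: (b :: C).reverse) ∧
      hullCount T (A ++ a :: b :: C) ≤ hullCount T (A ++ a :: (b :: C).reverse) := by
  obtain ⟨C', hC'⟩ : ∃ C', (b :: C).reverse = f :: C' := by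
    cases hr : (b :: C).reverse with
    | nil => simp at hr
    | cons g C' =>
      have h₁ : (b :: C).reverse.head? = some f := by rw [List.head?_reverse]; exact hf
      rw [hr] at h₁
      exact ⟨C', by simpa using h₁⟩
  have hperm : (A ++ a :: (b :: C).reverse).Perm (A ++ a :: b :: C) :=
    List.Perm.append_left A (List.Perm.cons a (List.reverse_perm _))
  have hes : ES (f :: C') = ES (b :: C) := by rw [← hC', ES_reverse]
  have hph : PH T (A ++ a :: (b :: C).reverse) := by
    refine ⟨hperm.nodup_iff.2 h.nodup, fun x => by rw [hperm.mem_iff, h.mem], ?_⟩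
    rw [hC', ES_append, hes]
    refine (h.nc.insert hc).mono (Set.insert_subset_insert ?_)
    rw [ES_append]
    exact Set.subset_insert _ _
  refine ⟨⟨h, hph, A ++ [a], b :: C, by simp, by simp, by simp⟩, ?_⟩
  rw [hullCount_append, if_neg hh, hC', hullCount_append, ← hC', hullCount_reverse]
  omega

/-- Any two plane spanning paths with the same extreme starting point are connected. -/
def Rooted (T : Finset Plane) : Prop :=
  ∀ l l' s, PH T l → PH T l' → l.head? = some s → l'.head? = some s → ¬ Inner T s → Reach T l l'

/-- The path can be changed such that it ends in an extreme point, without losing hull edges. -/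
def Done (T : Finset Plane) (l : List Plane) : Prop :=
  ∃ l' t, Reach T l l' ∧ l'.getLast? = some t ∧ ¬ Inner T t ∧ hullCount T l ≤ hullCount T l'

theorem Done.of_reach {T : Finset Plane} {l l' : List Plane} (h : Reach T l l')
    (hc : hullCount T l ≤ hullCount T l') (hd : Done T l') : Done T l := by
  obtain ⟨m, t, h₁, h₂, h₃, h₄⟩ := hd
  exact ⟨m, t, h.trans h₁, h₂, h₃, hc.trans h₄⟩

variable {T : Finset Plane} {R : List Plane} {k e : Plane} {E : Finset Plane}

namespace Conf

theorem R_eq (h : Conf T R k e E) : ∃ R₀, R = R₀ ++ [k] := by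
  rcases List.eq_nil_or_concat R with h' | ⟨R₀, x, h'⟩
  · have := h.last
    simp [h'] at this
  · have := h.last
    rw [h', List.concat_eq_append, List.getLast?_append_of_ne_nil _ (by simp)] at this
    simp only [List.getLast?_singleton, Option.some.injEq] at this
    exact ⟨R₀, by rw [h', this, List.concat_eq_append]⟩

theorem ES_eq (h : Conf T R k e E) {m : List Plane} (hm : m.head? = some e) :
    ES (R ++ m) = RE R k e ∪ ES m := by
  obtain ⟨R₀, rfl⟩ := h.R_eq
  cases m with
  | nil => simp at hm
  | cons x m =>
    obtain rfl : x = e := by simpa using hm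
    rw [List.append_assoc, List.singleton_append, ES_append, RE, Set.insert_union]

theorem ES_sub {m : List Plane} (hm : PH E m) : ES m ⊆ segs E := by
  intro p hp
  induction p using Sym2.ind with
  | _ a b =>
    have := mem_of_mem_edgesL hp
    rw [hm.mem, hm.mem] at this
    exact mem_segs.2 ⟨this.1, this.2, ne_of_mem_edgesL hm.nodup hp⟩

theorem ph (h : Conf T R k e E) {m : List Plane} (hm : PH E m) (hme : m.head? = some e) :
    PH T (R ++ m) := by
  refine ⟨?_, fun x => ?_, ?_⟩
  · refine List.nodup_append.2 ⟨h.nodup, hm.nodup, fun a ha b hb => ?_⟩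
    exact h.ne_of_mem ha ((hm.mem b).1 hb)
  · rw [List.mem_append, hm.mem]
    constructor
    · rintro (hx | hx)
      · exact h.memT x hx
      · exact (h.inner x hx).1
    · exact h.cover x
  · rw [h.ES_eq hme]
    refine NC.union (fun a b hab => (h.clear a b hab).mono Set.subset_union_left) hm.nc
      fun a b hab => (h.clear a b hab).mono ((ES_sub hm).trans Set.subset_union_right)

theorem card_lt (h : Conf T R k e E) : E.card < T.card :=
  Finset.card_lt_card (Finset.ssubset_iff_of_subset (fun x hx => (h.inner x hx).1) |>.2
    ⟨k, h.memT k h.k_mem, h.disj k h.k_mem⟩)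

theorem E_sub (h : Conf T R k e E) : E ⊆ T := fun x hx => (h.inner x hx).1

theorem not_inner_E (h : Conf T R k e E) {x : Plane} (hx : x ∈ E) : ¬ Inner E x := fun hi =>
  h.two x (h.inner x hx) (convexHull_mono
    (Set.sdiff_subset_sdiff_left fun y hy => h.inner y hy) hi.2)

theorem rearrange (h : Conf T R k e E) (ih : Rooted E) {m m' : List Plane} (hm : PH E m)
    (hm' : PH E m') (hme : m.head? = some e) (hme' : m'.head? = some e) :
    Reach T (R ++ m) (R ++ m') ∧ hullCount T (R ++ m) ≤ hullCount T (R ++ m') := by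
  refine ⟨(ih m m' e hm hm' hme hme' (h.not_inner_E h.start)).lift fun n hn hne =>
    h.ph hn (hne.trans hme), ?_⟩
  rw [hullCount_append_inner fun x hx => h.inner x ((hm.mem x).1 hx),
    hullCount_append_inner fun x hx => h.inner x ((hm'.mem x).1 hx)]

theorem exists_to (h : Conf T R k e E) {m : List Plane} (hm : PH E m) (hme : m.head? = some e)
    {f : Plane} (hf : f ∈ E) (hfe : f ≠ e ∨ E = {e}) :
    ∃ m', PH E m' ∧ m'.head? = some e ∧ m'.getLast? = some f := by
  by_cases h' : f = e
  · have hE := hfe.resolve_left fun h => h h'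
    subst h'
    refine ⟨m, hm, hme, ?_⟩
    have hl := hm.length
    rw [hE, Finset.card_singleton] at hl
    obtain ⟨x, rfl⟩ := List.length_eq_one_iff.1 hl
    simpa using hme
  · refine exists_path (h.gp.mono h.E_sub) h.start hf (Ne.symm h') ?_
    exact ext_of_not_inner h.start (h.not_inner_E h.start)

/-- Inserting the last point of the path into `R`, or making it end in an extreme point. -/
theorem done_of_prog (h : Conf T R k e E) {m : List Plane} (hm : PH E m)
    (hme : m.head? = some e) {f : Plane} (hmf : m.getLast? = some f)
    (hp : Prog T R (Ob R k e E) f) (hci : ∃ c ∈ R, Inner T c)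
    (ih : ∀ R' L', R'.getLast? = some k → (∃ c ∈ R', Inner T c) → L' ≠ [] →
      L'.length < m.length → (∀ x ∈ L', Inner T x) → PH T (R' ++ L') → Done T (R' ++ L')) :
    Done T (R ++ m) := by
  obtain ⟨A, a, b, B, rfl, hh, hfa, hb⟩ := hp
  have hph := h.ph hm hme
  have hsub : ES (A ++ a :: b :: B ++ m) ⊆ Ob (A ++ a :: b :: B) k e E := by
    rw [h.ES_eq hme]
    exact Set.union_subset_union_right _ (ES_sub hm)
  have e₀ : A ++ a :: b :: B ++ m = A ++ a :: b :: (B ++ m) := by simp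
  have hm0 : m ≠ [] := by rintro rfl; simp at hmf
  obtain ⟨M, rfl⟩ : ∃ M, m = M ++ [f] := by
    refine ⟨m.dropLast, ?_⟩
    rw [← List.dropLast_append_getLast hm0] at hmf
    rw [List.getLast?_append_of_ne_nil _ (by simp)] at hmf
    simp only [List.getLast?_singleton, Option.some.injEq] at hmf
    conv_lhs => rw [← List.dropLast_append_getLast hm0, hmf]
  have hfi : Inner T f := h.inner f ((hm.mem f).1 (by simp))
  rw [e₀] at hph hsub ⊢
  -- First flip: `af` replaces `ab`, and the path now ends in `b`.
  obtain ⟨st, hcount⟩ := flip hph (f := f) (by simp [List.getLast?_cons]) (hfa.symm.mono hsub) hh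
  have e₁ : (b :: (B ++ (M ++ [f]))).reverse = f :: (M.reverse ++ B.reverse ++ [b]) := by simp
  by_cases hbi : Inner T b
  swap
  · refine Done.of_reach st.reach hcount ⟨_, b, Reach.refl _ _, ?_, hbi, le_rfl⟩
    rw [e₁]
    simp [List.getLast?_cons]
  have hfb := hb.resolve_left fun h => h hbi
  obtain ⟨g, G, hG⟩ : ∃ g G, M.reverse ++ B.reverse ++ [b] = g :: G := by
    cases hr : M.reverse ++ B.reverse ++ [b] with
    | nil => simp at hr
    | cons g G => exact ⟨g, G, rfl⟩
  have e₂ : A ++ a :: (b :: (B ++ (M ++ [f]))).reverse = (A ++ [a]) ++ f :: g :: G := by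
    rw [e₁, hG]; simp
  have hph' := st.2.1
  rw [e₂] at st hcount hph'
  have hlast : (g :: G).getLast? = some b := by rw [← hG]; simp
  have hES : ES ((A ++ [a]) ++ f :: g :: G) ⊆ insert s(a, f) (ES (A ++ a :: b :: (B ++ (M ++ [f])))) := by
    have e₃ : (A ++ [a]) ++ f :: g :: G = A ++ a :: f :: (g :: G) := by simp
    have e₄ : f :: g :: G = (b :: (B ++ (M ++ [f]))).reverse := by rw [e₁, hG]
    rw [e₃, ES_append, e₄, ES_reverse, ES_append]
    exact Set.insert_subset_insert (Set.subset_insert _ _)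
  -- Second flip, for `b` inner and visible: `fb` replaces the edge after `f`, which is no hull edge
  -- since `f` is inner. Now `f` sits between `a` and `b`, and the tail has lost a point.
  obtain ⟨st₂, hcount₂⟩ := flip hph' hlast
    (((hfb.mono hsub).insert fun _ h₂ _ _ => absurd rfl h₂).mono hES)
    (fun hh => hh.not_inner_left hfi)
  have e₅ : (A ++ [a]) ++ f :: (g :: G).reverse = (A ++ a :: f :: b :: B) ++ M := by
    rw [← hG]; simp
  rw [e₅] at st₂ hcount₂
  refine Done.of_reach (st.reach.trans st₂.reach) (hcount.trans hcount₂) ?_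
  have hk : (A ++ a :: f :: b :: B).getLast? = some k := by
    have := h.last
    rw [List.getLast?_append_of_ne_nil _ (by simp)] at this ⊢
    simpa [List.getLast?_cons_cons] using this
  by_cases hM : M = []
  · subst hM
    rw [List.append_nil]
    exact ⟨_, k, Reach.refl _ _, hk, h.outer, le_rfl⟩
  · refine ih _ M hk ⟨b, by simp, hbi⟩ hM (by simp) (fun x hx => ?_) st₂.2.1
    exact h.inner x ((hm.mem x).1 (by simp [hx]))

end Conf

end PlanePaths

/-! ### Paths that end with inner points -/

namespace PlanePaths

open List

variable {T : Finset Plane} {R : List Plane} {k e : Plane} {E : Finset Plane}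

/-- A path that ends with inner points: its other edges do not cross the segments between them. -/
theorem clear_segs (hT : GP T) (h2 : TwoLayer T) {R L : List Plane} {k e : Plane}
    (hph : PH T (R ++ k :: e :: L)) (hL : ∀ x ∈ e :: L, Inner T x)
    {a b : Plane} (hab : s(a, b) ∈ RE (R ++ [k]) k e) (M : List Plane) :
    ∀ A u v B, e :: L = A ++ u :: (M ++ v :: B) → a ≠ u → b ≠ u → a ≠ v → b ≠ v →
      Disjoint (segment ℝ a b) (segment ℝ u v) := by
  have hES : ES (R ++ k :: e :: L) = RE (R ++ [k]) k e ∪ ES (e :: L) := by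
    rw [ES_append, RE, Set.insert_union]
  have hnd := hph.nodup
  have hdis := (List.nodup_append.1 (by simpa using hnd : ((R ++ [k]) ++ e :: L).Nodup)).2.2
  have hndL := (List.nodup_append.1 (by simpa using hnd : ((R ++ [k]) ++ e :: L).Nodup)).2.1
  have nc : ∀ c d, s(c, d) ∈ ES (e :: L) → a ≠ c → b ≠ c → a ≠ d → b ≠ d →
      Disjoint (segment ℝ a b) (segment ℝ c d) := fun c d hcd h₁ h₂ h₃ h₄ =>
    hph.nc a b (by rw [hES]; exact Or.inl hab) c d (by rw [hES]; exact Or.inr hcd) h₁ h₃ h₂ h₄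
  have habT : a ∈ T ∧ b ∈ T := by
    have : s(a, b) ∈ ES (R ++ k :: e :: L) := by rw [hES]; exact Or.inl hab
    have := mem_of_mem_edgesL this
    rwa [hph.mem, hph.mem] at this
  have hmemE : ∀ x, x ∈ e :: L → x = a ∨ x = b → x = e := by
    intro x hx hxab
    have key : ∀ y, y ∈ R ++ [k] → x ≠ y := fun y hy hxy => hdis y hy x hx hxy.symm
    rcases hab with hab | hab
    · rcases Sym2.eq_iff.1 hab with ⟨rfl, rfl⟩ | ⟨rfl, rfl⟩
      · exact hxab.resolve_left (key _ (by simp))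
      · exact hxab.resolve_right (key _ (by simp))
    · have := mem_of_mem_edgesL hab
      rcases hxab with h' | h'
      · exact absurd h' (key a this.1)
      · exact absurd h' (key b this.2)
  -- Induction on the number of tail points between `u` and `v`. With `w` the predecessor of `v`,
  -- the triangle `uvw` contains no other points, so an edge crossing `uv` also crosses `uw`,
  -- excluded by induction, or the path edge `wv`.
  induction M using List.reverseRecOn with
  | nil =>
    intro A u v B hA hau hbu hav hbv
    refine nc u v ?_ hau hbu hav hbv
    rw [hA, List.nil_append, ES_append]
    exact Or.inl rfl
  | append_singleton M w ih =>
    intro A u v B hA hau hbu hav hbv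
    have hA' : e :: L = A ++ u :: (M ++ w :: (v :: B)) := by simpa using hA
    have hu : u ∈ e :: L := by rw [hA']; simp
    have hv : v ∈ e :: L := by rw [hA']; simp
    have hw : w ∈ e :: L := by rw [hA']; simp
    have hwe : w ≠ e := by
      rintro rfl
      rw [hA'] at hndL
      cases A with
      | nil =>
        obtain ⟨rfl, -⟩ : w = u ∧ _ := by simpa using hA'
        simp at hndL
      | cons x A =>
        obtain ⟨rfl, -⟩ : w = x ∧ _ := by simpa using hA'
        simp at hndL
    have haw : a ≠ w := fun h => hwe (hmemE w hw (Or.inl h.symm))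
    have hbw : b ≠ w := fun h => hwe (hmemE w hw (Or.inr h.symm))
    have hndA := hndL
    rw [hA'] at hndA
    have hn₁ := (List.nodup_append.1 hndA).2.1
    have huv : u ≠ v := by rintro rfl; simp at hn₁
    have huw : u ≠ w := by rintro rfl; simp at hn₁
    have hvw : v ≠ w := by
      rintro rfl
      have := (List.nodup_append.1 (List.nodup_cons.1 hn₁).2).2.1
      simp at this
    have h₁ := ih A u w (v :: B) hA' hau hbu haw hbw
    have h₂ : Disjoint (segment ℝ a b) (segment ℝ w v) := by
      refine nc w v ?_ haw hbw hav hbv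
      have : e :: L = (A ++ u :: M) ++ w :: v :: B := by simpa using hA'
      rw [this, ES_append]
      exact Or.inl rfl
    have hui := hL u hu
    have hvi := hL v hv
    have hwi := hL w hw
    obtain ⟨σ, hσ, hpos⟩ := exists_sign (hT u hui.1 v hvi.1 w hwi.1 huv hvw huw)
    rw [Set.disjoint_left]
    intro q hq hq'
    have h₀ : D σ u v q = 0 := D_of_mem_segment hq'
    obtain ⟨haT, hbT⟩ := habT
    have na := hT.ne hσ hui.1 hvi.1 haT huv hav.symm hau.symm
    have nb := hT.ne hσ hui.1 hvi.1 hbT huv hbv.symm hbu.symm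
    have fin : ∀ c, c ∈ T → c ≠ u → c ≠ v → c ≠ w → 0 < D σ u v c →
        segment ℝ q c ⊆ segment ℝ a b → False := by
      intro c hcT hcu hcv hcw hc hsub
      obtain ⟨r, hr, hr'⟩ := exit hpos hq' hc (fun hcT' => by
        rcases h2.eq_of_mem_Tri hui hvi hwi hcT hcT' with h' | h' | h'
        · exact hcu h'
        · exact hcv h'
        · exact hcw h')
      rcases hr' with hr' | hr'
      · exact Set.disjoint_left.1 h₁ (hsub hr) hr'
      · rw [segment_symm] at hr'
        exact Set.disjoint_left.1 h₂ (hsub hr) hr'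
    rcases D_opposite h₀ hq na nb with ⟨h', -⟩ | ⟨-, h'⟩
    · exact fin a haT hau hav haw h' ((convex_segment a b).segment_subset hq
        (left_mem_segment ℝ _ _))
    · exact fin b hbT hbu hbv hbw h' ((convex_segment a b).segment_subset hq
        (right_mem_segment ℝ _ _))

theorem conf_of_path (hT : GP T) (h2 : TwoLayer T) {R L : List Plane} {k e : Plane}
    (hph : PH T ((R ++ [k]) ++ e :: L)) (hk : ¬ Inner T k) (hL : ∀ x ∈ e :: L, Inner T x) :
    Conf T (R ++ [k]) k e (e :: L).toFinset ∧ PH (e :: L).toFinset (e :: L) := by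
  have hnd := List.nodup_append.1 hph.nodup
  have hph' : PH T (R ++ k :: e :: L) := by simpa using hph
  have hES : ES (R ++ k :: e :: L) = RE (R ++ [k]) k e ∪ ES (e :: L) := by
    rw [ES_append, RE, Set.insert_union]
  have hnc := hph'.nc
  rw [hES] at hnc
  refine ⟨⟨hT, h2, fun x hx => (hph.mem x).1 (List.mem_append_left _ hx), fun x hx => ?_,
    fun x hx => hL x (List.mem_toFinset.1 hx), fun x hx hx' => ?_, hnd.1, by simp, hk, by simp,
    fun a b hab => ?_⟩, hnd.2.1, fun x => by rw [List.mem_toFinset],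
    hnc.mono Set.subset_union_right⟩
  · have := (hph.mem x).2 hx
    rw [List.mem_append] at this
    rwa [List.mem_toFinset]
  · exact hnd.2.2 x hx x (List.mem_toFinset.1 hx') rfl
  · refine ((hnc a b (Or.inl hab)).mono Set.subset_union_left).union ?_
    intro u v huv hau hav hbu hbv
    obtain ⟨hu, hv, huv⟩ := mem_segs.1 huv
    rw [List.mem_toFinset] at hu hv
    obtain ⟨A, C, hA⟩ := List.append_of_mem hu
    rw [hA, List.mem_append, List.mem_cons] at hv
    rcases hv with hv | hv | hv
    · obtain ⟨A', M, rfl⟩ := List.append_of_mem hv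
      rw [segment_symm ℝ u v]
      exact clear_segs hT h2 hph' hL hab M A' v u C (by simpa using hA) hav hbv hau hbu
    · exact absurd hv.symm huv
    · obtain ⟨M, B, rfl⟩ := List.append_of_mem hv
      exact clear_segs hT h2 hph' hL hab M A u v B (by simpa using hA) hau hbu hav hbv

/-- A path that ends with inner points, but also has an inner point before an extreme one, can be
changed such that it ends in an extreme point. -/
theorem inner_end (hT : GP T) (h2 : TwoLayer T)
    (hroot : ∀ U : Finset Plane, U ⊆ T → U.card < T.card → Rooted U) (n : ℕ) :
    ∀ (R L : List Plane) (k : Plane), R.getLast? = some k → (∃ c ∈ R, Inner T c) → L ≠ [] →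
      L.length ≤ n → ¬ Inner T k → (∀ x ∈ L, Inner T x) → PH T (R ++ L) → Done T (R ++ L) := by
  induction n with
  | zero =>
    intro R L k _ _ hL hn
    exact absurd (List.length_eq_zero_iff.1 (Nat.le_zero.1 hn)) hL
  | succ n ih =>
    intro R L k hRk hc hL hn hk hLi hph
    cases L with
    | nil => exact absurd rfl hL
    | cons e L =>
      obtain ⟨R₀, rfl⟩ : ∃ R₀, R = R₀ ++ [k] := by
        rcases List.eq_nil_or_concat R with rfl | ⟨R₀, x, rfl⟩
        · simp at hRk
        · simp only [List.concat_eq_append, List.getLast?_append_of_ne_nil _ (List.cons_ne_nil x []),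
            List.getLast?_singleton, Option.some.injEq] at hRk
          exact ⟨R₀, by rw [hRk, List.concat_eq_append]⟩
      obtain ⟨hconf, hmE⟩ := conf_of_path hT h2 hph hk hLi
      set E := (e :: L).toFinset with hEdef
      have hrE : Rooted E := hroot E hconf.E_sub hconf.card_lt
      have hlen : E.card ≤ n + 1 := by rw [← hmE.length]; exact hn
      have ih' : ∀ m : List Plane, PH E m → ∀ R' L', R'.getLast? = some k →
          (∃ c ∈ R', Inner T c) → L' ≠ [] → L'.length < m.length → (∀ x ∈ L', Inner T x) →
          PH T (R' ++ L') → Done T (R' ++ L') := by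
        intro m hm R' L' h₁ h₂ h₃ h₄ h₅ h₆
        have := hm.length
        exact ih R' L' k h₁ h₂ h₃ (by omega) hk h₅ h₆
      have good : ∀ e', Conf T (R₀ ++ [k]) k e' E → ∀ m, PH E m → m.head? = some e' →
          Good T (R₀ ++ [k]) k e' E → Done T (R₀ ++ [k] ++ m) := by
        intro e' hconf' m hm hme hg
        rcases hg with ⟨f, hf, hfe, hp⟩ | ⟨f, hf, hfe, hcl, hp⟩
        · obtain ⟨m', hm', hme', hmf'⟩ := hconf'.exists_to hm hme hf hfe
          obtain ⟨r₁, r₂⟩ := hconf'.rearrange hrE hm hm' hme hme'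
          exact Done.of_reach r₁ r₂ (hconf'.done_of_prog hm' hme' hmf' hp hc (ih' m' hm'))
        -- Let the tail run from `e'` to `f` and reverse it: `f` comes first, and `e'` is last,
        -- ready to be inserted.
        · obtain ⟨m', hm', hme', hmf'⟩ := hconf'.exists_to hm hme hf (Or.inl hfe)
          obtain ⟨r₁, r₂⟩ := hconf'.rearrange hrE hm hm' hme hme'
          have hconf'' := hconf'.swap hf hcl
          have hhead : m'.reverse.head? = some f := by rw [List.head?_reverse]; exact hmf'
          have hlast : m'.reverse.getLast? = some e' := by rw [List.getLast?_reverse]; exact hme'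
          have hph'' := hconf''.ph hm'.reverse hhead
          refine Done.of_reach (r₁.trans (Step.reach ⟨hconf'.ph hm' hme', hph'', R₀ ++ [k], m',
            by simp, rfl, rfl⟩)) (r₂.trans (le_of_eq ?_))
            (hconf''.done_of_prog hm'.reverse hhead hlast hp hc (ih' _ hm'.reverse))
          rw [hullCount_append_inner fun x hx => hconf.inner x ((hm'.mem x).1 hx),
            hullCount_append_inner fun x hx => hconf.inner x ((hm'.reverse.mem x).1 hx)]
      obtain ⟨c, hcR, hci⟩ := hc
      rcases hconf.exists_good hcR hci with hg | ⟨f, hf, hfe, hcl, hg⟩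
      · exact good e hconf _ hmE rfl hg
      · obtain ⟨m', hm', hme', hmf'⟩ := hconf.exists_to hmE rfl hf (Or.inl hfe)
        obtain ⟨r₁, r₂⟩ := hconf.rearrange hrE hmE hm' rfl hme'
        have hconf'' := hconf.swap hf hcl
        have hhead : m'.reverse.head? = some f := by rw [List.head?_reverse]; exact hmf'
        have hph'' := hconf''.ph hm'.reverse hhead
        refine Done.of_reach (r₁.trans (Step.reach ⟨hconf.ph hm' hme', hph'', R₀ ++ [k], m',
          by simp, rfl, rfl⟩)) (r₂.trans (le_of_eq ?_)) (good f hconf'' _ hm'.reverse hhead hg)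
        rw [hullCount_append_inner fun x hx => hconf.inner x ((hm'.mem x).1 hx),
          hullCount_append_inner fun x hx => hconf.inner x ((hm'.reverse.mem x).1 hx)]

end PlanePaths

/-! ### Gaining hull edges and the main induction -/

namespace PlanePaths

open List

variable {T : Finset Plane}

theorem forall_of_edgesL {p : Plane → Prop} {l : List Plane} :
    ∀ {x : Plane}, p x → (∀ u v, s(u, v) ∈ edgesL (x :: l) → p u → p v) → ∀ y ∈ x :: l, p y := by
  induction l with
  | nil =>
    intro x hx _ y hy
    obtain rfl : y = x := by simpa using hy
    exact hx
  | cons z l ih =>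
    intro x hx h y hy
    rcases List.mem_cons.1 hy with rfl | hy
    · exact hx
    · refine ih (h x z (by simp) hx) (fun u v huv => h u v ?_) y hy
      rw [edgesL_cons_cons]
      exact List.mem_cons_of_mem _ huv

/-- Segments between extreme points are crossed by all segments from one side to the other. -/
theorem not_disjoint_of_not_inner (hT : GP T) {σ : ℝ} (hσ : σ ≠ 0) {a b u v : Plane}
    (ha : a ∈ T) (hb : b ∈ T) (hu : u ∈ T) (hv : v ∈ T) (hao : ¬ Inner T a) (hbo : ¬ Inner T b)
    (h₁ : 0 < D σ a b u) (h₂ : D σ a b v < 0) : ¬ Disjoint (segment ℝ a b) (segment ℝ u v) := by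
  obtain ⟨hab, hbu, hau⟩ := ne_of_D h₁
  have h₂' : 0 < D (-σ) a b v := by rw [D_neg]; linarith
  obtain ⟨-, hbv, hav⟩ := ne_of_D h₂'
  have huv : u ≠ v := by rintro rfl; linarith
  have na := hT.ne hσ hu hv ha huv hav.symm hau.symm
  have nb := hT.ne hσ hu hv hb huv hbv.symm hbu.symm
  have e₁ : D σ b u a = D σ a b u := (D_rot ..).symm
  have e₂ : D σ v b a = -D σ a b v := by rw [D_rot σ a b v, D_rot σ b v a, D_swap]
  have e₃ : D σ u a b = D σ a b u := D_rot ..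
  have e₄ : D σ a v b = -D σ a b v := D_swap ..
  -- If `a` and `b` were on the same side of `uv`, one of them would lie in the triangle of the
  -- other and `u`, `v`, although both are extreme.
  have key : (0 < D σ u v a ∧ D σ u v b < 0) ∨ (D σ u v a < 0 ∧ 0 < D σ u v b) := by
    rcases lt_or_gt_of_ne na with na | na <;> rcases lt_or_gt_of_ne nb with nb | nb
    · have e₅ : D σ v u a = -D σ u v a := D_swap' ..
      have e₆ : D σ v u b = -D σ u v b := D_swap' ..
      rcases eq_of_mem_Tri_of_not_inner hv hu ha hb hbo (mem_Tri_of_D (σ := σ) (by linarith)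
        (by linarith) (by linarith) (by linarith)) with h | h | h
      · exact absurd h hbv
      · exact absurd h hbu
      · exact absurd h.symm hab
    · exact Or.inr ⟨na, nb⟩
    · exact Or.inl ⟨na, nb⟩
    · rcases eq_of_mem_Tri_of_not_inner hu hv hb ha hao (mem_Tri_of_D (σ := σ) nb na.le
        (by linarith) (by linarith)) with h | h | h
      · exact absurd h hau
      · exact absurd h hav
      · exact absurd h hab
  refine inter_of_X h₁.ne' h₂.ne na nb ?_
  rcases key with ⟨k₁, k₂⟩ | ⟨k₁, k₂⟩ <;>
    simp [X, P, h₁, h₂.le, k₁, k₂, k₁.le, k₂.le]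

/-- The rest of the path never crosses `sq`, and an edge between the two sides of a chord of extreme
points would. So all other points are on one side. -/
theorem hullEdge_of_head (hT : GP T) {s q : Plane} {r : List Plane} (h : PH T (s :: q :: r))
    (hs : ¬ Inner T s) (hq : ¬ Inner T q) : HullEdge T s q := by
  have hsT : s ∈ T := (h.mem s).1 (by simp)
  have hqT : q ∈ T := (h.mem q).1 (by simp)
  have hnd := List.nodup_cons.1 h.nodup
  have hnd' := List.nodup_cons.1 hnd.2
  have hsq : s ≠ q := by rintro rfl; simp at hnd
  have hcov : ∀ x ∈ T, x ≠ s → x ≠ q → x ∈ r := by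
    intro x hx h₁ h₂
    have := (h.mem x).2 hx
    simpa [h₁, h₂] using this
  have hrT : ∀ x ∈ r, x ∈ T ∧ s ≠ x ∧ q ≠ x := fun x hx =>
    ⟨(h.mem x).1 (by simp [hx]), by rintro rfl; simp [hx] at hnd, by rintro rfl; simp [hx] at hnd'⟩
  refine ⟨hsq, ?_⟩
  cases r with
  | nil => exact ⟨1, fun x hx h₁ h₂ => absurd (hcov x hx h₁ h₂) (by simp)⟩
  | cons y r =>
    obtain ⟨hyT, hsy, hqy⟩ := hrT y (by simp)
    obtain ⟨σ, hσ, hy⟩ := exists_sign (hT s hsT q hqT y hyT hsq hqy hsy)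
    refine ⟨σ, fun x hx h₁ h₂ => forall_of_edgesL (p := fun x => 0 < D σ s q x) hy
      (fun u v huv hu => ?_) x (hcov x hx h₁ h₂)⟩
    have hm := mem_of_mem_edgesL huv
    obtain ⟨huT, hsu, hqu⟩ := hrT u hm.1
    obtain ⟨hvT, hsv, hqv⟩ := hrT v hm.2
    rcases lt_or_gt_of_ne (hT.ne hσ hsT hqT hvT hsq hqv hsv) with hv | hv
    · refine absurd (h.nc s q ?_ u v ?_ hsu hsv hqu hqv)
        (not_disjoint_of_not_inner hT hσ hsT hqT huT hvT hs hq hu hv)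
      · simp [mem_ES]
      · rw [mem_ES, edgesL_cons_cons, edgesL_cons_cons]
        exact List.mem_cons_of_mem _ (List.mem_cons_of_mem _ huv)
    · exact hv

/-- An extreme point has a neighbour on the hull other than a given point. -/
theorem exists_hull_neighbour (hT : GP T) {t p : Plane} (ht : t ∈ T) (hto : ¬ Inner T t)
    (hc : 3 ≤ T.card) : ∃ w ∈ T, w ≠ t ∧ w ≠ p ∧ ∃ σ : ℝ, σ ≠ 0 ∧
      ∀ x ∈ T, x ≠ t → x ≠ w → 0 < D σ t w x := by
  have hext := ext_of_not_inner ht hto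
  have hcard : 2 ≤ (T.erase t).card := by rw [Finset.card_erase_of_mem ht]; omega
  have hne : (T.erase t).Nonempty := Finset.card_pos.1 (by omega)
  have hgp : ∀ σ : ℝ, σ ≠ 0 → ∀ g ∈ T.erase t, ∀ h ∈ T.erase t, g ≠ h → D σ t g h ≠ 0 := by
    intro σ hσ g hg h hh hgh
    rw [Finset.mem_erase] at hg hh
    exact hT.ne hσ ht hg.2 hh.2 hg.1.symm hgh hh.1.symm
  have key : ∀ σ : ℝ, (∃ w ∈ T.erase t, ∀ h ∈ T.erase t, h ≠ w → 0 < D σ t w h) →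
      ∃ w ∈ T, w ≠ t ∧ ∀ x ∈ T, x ≠ t → x ≠ w → 0 < D σ t w x := by
    rintro σ ⟨w, hw, h⟩
    rw [Finset.mem_erase] at hw
    exact ⟨w, hw.2, hw.1, fun x hx hxt hxw => h x (Finset.mem_erase.2 ⟨hxt, hx⟩) hxw⟩
  obtain ⟨w, hw, hwt, hw'⟩ := key 1 (exists_tangent hne hext (hgp 1 (by norm_num)))
  obtain ⟨v, hv, hvt, hv'⟩ := key (-1) (exists_tangent hne hext (hgp (-1) (by norm_num)))
  by_cases hwp : w = p
  · refine ⟨v, hv, hvt, ?_, -1, by norm_num, hv'⟩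
    rintro rfl
    subst hwp
    obtain ⟨x, hx, hxw⟩ := Finset.exists_mem_ne (by omega : 1 < (T.erase t).card) w
    rw [Finset.mem_erase] at hx
    have h₁ := hw' x hx.2 hx.1 hxw
    have h₂ := hv' x hx.2 hx.1 hxw
    rw [D_neg] at h₂
    linarith
  · exact ⟨w, hw, hwt, hwp, 1, by norm_num, hw'⟩

theorem length_edgesL (l : List Plane) : (edgesL l).length = l.length - 1 := by
  induction l with
  | nil => rfl
  | cons x l ih =>
    cases l with
    | nil => rfl
    | cons y l => simp [ih]

theorem PH.hullCount_lt {l : List Plane} (h : PH T l) (hl : l ≠ []) :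
    hullCount T l < T.card := by
  have h₁ : hullCount T l ≤ (edgesL l).length := List.countP_le_length
  rw [length_edgesL] at h₁
  have := List.length_pos_iff.2 hl
  rw [← h.length]
  omega

/-- Split a list after its last extreme point. -/
theorem exists_last_outer (T : Finset Plane) {l : List Plane} (h : ∃ x ∈ l, ¬ Inner T x) :
    ∃ R k L, l = R ++ k :: L ∧ ¬ Inner T k ∧ ∀ x ∈ L, Inner T x := by
  induction l with
  | nil => simp at h
  | cons a l ih =>
    by_cases h' : ∃ x ∈ l, ¬ Inner T x
    · obtain ⟨R, k, L, rfl, hk, hL⟩ := ih h'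
      exact ⟨a :: R, k, L, rfl, hk, hL⟩
    · push Not at h'
      obtain ⟨x, hx, hxo⟩ := h
      rcases List.mem_cons.1 hx with rfl | hx
      · exact ⟨[], x, l, rfl, hxo, h'⟩
      · exact absurd (h' x hx) hxo

/-- A path between extreme points can be changed such that its first edge is a hull edge, or such
that it has more hull edges. -/
theorem hull_step (hT : GP T) (hc : 3 ≤ T.card) {l : List Plane} {s t : Plane} (h : PH T l)
    (hs : l.head? = some s) (ht : l.getLast? = some t) (hso : ¬ Inner T s) (hto : ¬ Inner T t) :
    ∃ l', Reach T l l' ∧ ((∃ q r, l' = s :: q :: r ∧ HullEdge T s q) ∨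
      hullCount T l < hullCount T l') := by
  have htT : t ∈ T := (h.mem t).1 (List.mem_of_getLast? ht)
  have hlen := h.length
  obtain ⟨M, p, rfl⟩ : ∃ M p, l = M ++ [p, t] := by
    rcases List.eq_nil_or_concat l with rfl | ⟨m, x, rfl⟩
    · simp at ht
    obtain rfl : x = t := by simpa using ht
    rcases List.eq_nil_or_concat m with rfl | ⟨M, p, rfl⟩
    · simp at hlen; omega
    · exact ⟨M, p, by simp⟩
  -- Of the two hull neighbours of `t`, one differs from the predecessor `p`; the hull edge `tw` is
  -- then not yet in the path.
  obtain ⟨w, hw, hwt, hwp, σ, hσ, hside⟩ := exists_hull_neighbour (p := p) hT htT hto hc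
  have hwe : HullEdge T t w := ⟨hwt.symm, σ, hside⟩
  have hwo := hwe.not_inner_right
  have hwM : w ∈ M := by
    have := (h.mem w).2 hw
    simpa [hwt, hwp] using this
  obtain ⟨A, B, rfl⟩ := List.append_of_mem hwM
  obtain ⟨w', C, hC⟩ : ∃ w' C, B ++ [p, t] = w' :: C := by
    cases B with
    | nil => exact ⟨_, _, rfl⟩
    | cons b B => exact ⟨_, _, rfl⟩
  have e : A ++ w :: B ++ [p, t] = A ++ w :: w' :: C := by simp [← hC]
  have hlast : (w' :: C).getLast? = some t := by rw [← hC]; simp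
  rw [e] at h hs ⊢
  have hclear : Clear (ES (A ++ w :: w' :: C)) w t :=
    (clear_of_side fun x hx h₁ h₂ => hside x ((h.mem x).1 hx) h₁ h₂).symm
  obtain ⟨C', hC'⟩ : ∃ C', (w' :: C).reverse = t :: C' := by
    exact ⟨p :: B.reverse, by simp [← hC]⟩
  cases A with
  | nil =>
    obtain rfl : w = s := by simpa using hs
    by_cases hww : HullEdge T w w'
    · exact ⟨_, Reach.refl _ _, Or.inl ⟨w', C, rfl, hww⟩⟩
    · obtain ⟨st, -⟩ := flip h hlast hclear hww
      refine ⟨_, st.reach, Or.inl ⟨t, C', by rw [hC']; rfl, hwe.symm⟩⟩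
  | cons a A =>
    obtain rfl : a = s := by simpa using hs
    have hww : ¬ HullEdge T w w' := by
      rintro ⟨hne, τ, hτ⟩
      have hwT := (h.mem w).1 (by simp)
      have hwT' := (h.mem w').1 (by simp)
      have hnd := (List.nodup_append.1 h.nodup).2.1
      have hwt' : w' ≠ t := by
        rintro rfl
        cases B with
        | nil =>
          obtain ⟨-, hC₂⟩ : p = w' ∧ [w'] = C := by simpa using hC
          simp [← hC₂] at hnd
        | cons b B =>
          obtain ⟨rfl, rfl⟩ : b = w' ∧ B ++ [p, b] = C := by simp_all
          simp at hnd
      have h₁ := hside w' hwT' hwt' hne.symm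
      have h₂ := hτ t htT hwt.symm hwt'.symm
      have hpos : 0 < D σ w w' t := by rwa [← D_rot]
      refine hull_parity hT hσ h hlast (ext_of_not_inner ((h.mem a).1 (by simp)) hso)
        (ext_of_not_inner hw hwo) hside fun x hx hx₁ hx₂ => ?_
      have h₃ := hτ x hx hx₁ hx₂
      rw [D_scale] at h₂ h₃ hpos ⊢
      -- Both `σ` and `τ` make the triangle `w`, `w'`, `t` positive, so they have the same sign and
      -- one orientation serves both hull edges, as `hull_parity` requires.
      rcases lt_or_gt_of_ne (hT w hwT w' hwT' t htT hne hwt' hwt) with hd | hd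
      · have hσn : σ < 0 := by nlinarith
        have hτn : τ < 0 := by nlinarith
        have : D 1 w w' x < 0 := by nlinarith
        exact mul_pos_of_neg_of_neg hσn this
      · have hσn : 0 < σ := by nlinarith
        have hτn : 0 < τ := by nlinarith
        have : 0 < D 1 w w' x := by nlinarith
        exact mul_pos hσn this
    obtain ⟨st, -⟩ := flip h hlast hclear hww
    refine ⟨_, st.reach, Or.inr ?_⟩
    rw [hC', hullCount_append, hullCount_append, if_neg hww, if_pos hwe.symm, ← hC',
      hullCount_reverse]
    omega

/-- The induction is on the number of hull edges still missing. If the second vertex is inner,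
`inner_end` provides an extreme last point without losing hull edges, and `hull_step` then succeeds
or gains a hull edge. -/
theorem reach_hull_head (hT : GP T) (h2 : TwoLayer T)
    (hroot : ∀ U : Finset Plane, U ⊆ T → U.card < T.card → Rooted U) (hc : 3 ≤ T.card) {s : Plane}
    (hs : ¬ Inner T s) (n : ℕ) : ∀ l : List Plane, PH T l → l.head? = some s →
      T.card ≤ hullCount T l + n → ∃ q r, Reach T l (s :: q :: r) ∧ HullEdge T s q := by
  induction n with
  | zero =>
    intro l h hl hn
    have := h.hullCount_lt (by rintro rfl; simp at hl)
    omega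
  | succ n ih =>
    intro l h hl hn
    have hlen := h.length
    obtain ⟨q, r, rfl⟩ : ∃ q r, l = s :: q :: r := by
      match l, hl, hlen with
      | [], hl, _ => simp at hl
      | [x], _, hlen => simp at hlen; omega
      | x :: q :: r, hl, _ => exact ⟨q, r, by simpa using hl⟩
    by_cases hq : Inner T q
    swap
    · exact ⟨q, r, Reach.refl _ _, hullEdge_of_head hT h hs hq⟩
    obtain ⟨w, hw, hws, -, σ, -, hside⟩ := exists_hull_neighbour (p := s) hT
      ((h.mem s).1 (by simp)) hs hc
    have hwo : ¬ Inner T w := HullEdge.not_inner_right ⟨hws.symm, σ, hside⟩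
    have hdone : Done T (s :: q :: r) := by
      obtain ⟨R, k, L, he, hk, hL⟩ := exists_last_outer T (l := q :: r)
        ⟨w, by simpa [hws] using (h.mem w).2 hw, hwo⟩
      have hqR : q ∈ R := by
        cases R with
        | nil =>
          obtain rfl : q = k := by simp_all
          exact absurd hq hk
        | cons x R =>
          obtain rfl : q = x := by simp_all
          simp
      by_cases hL0 : L = []
      · refine ⟨_, k, Reach.refl _ _, ?_, hk, le_rfl⟩
        rw [he, hL0]
        exact List.getLast?_concat (l := s :: R)
      · have e : s :: q :: r = (s :: R ++ [k]) ++ L := by simp [he]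
        rw [e] at h ⊢
        exact inner_end hT h2 hroot _ _ L k List.getLast?_concat ⟨q, by simp [hqR], hq⟩ hL0 le_rfl hk hL h
    obtain ⟨l', t, hr, ht, hto, hle⟩ := hdone
    obtain ⟨l'', hr', hl''⟩ := hull_step hT hc (hr.ph h) hr.head ht hs hto
    rcases hl'' with ⟨q', r', rfl, hh⟩ | hlt
    · exact ⟨q', r', hr.trans hr', hh⟩
    · obtain ⟨q', r', hr'', hh⟩ := ih l'' (hr'.ph (hr.ph h)) (by rw [hr'.head, hr.head]; rfl) (by omega)
      exact ⟨q', r', (hr.trans hr').trans hr'', hh⟩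

theorem HullEdge.cons {s q : Plane} {m : List Plane} (h : HullEdge T s q) (hs : s ∈ T)
    (hm : PH (T.erase s) m) (hmq : m.head? = some q) : PH T ([s] ++ m) := by
  cases m with
  | nil => simp at hmq
  | cons x m =>
    obtain rfl : x = q := by simpa using hmq
    obtain ⟨-, σ, hσ⟩ := h
    exact PH.cons hs hm (clear_of_side fun y hy h₁ h₂ =>
      hσ y (Finset.mem_of_mem_erase ((hm.mem y).1 hy)) h₁ h₂)

theorem HullEdge.ext_erase {s q : Plane} (h : HullEdge T s q) :
    Ext q ((T.erase s).erase q) := by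
  obtain ⟨-, σ, hσ⟩ := h
  refine Ext_of_D (σ := σ) (a := s) fun g hg => ?_
  rw [Finset.mem_coe, Finset.mem_erase, Finset.mem_erase] at hg
  exact hσ g hg.2.2 hg.2.1 hg.1

/-- After a hull edge `sq` the rest is a path on the smaller set from `q`, which is extreme there,
and `sq` is compatible with every such path. The induction hypothesis therefore also serves for the
shorter tails in `inner_end`. -/
theorem rooted (hT : GP T) (h2 : TwoLayer T) : Rooted T := by
  induction hn : T.card using Nat.strong_induction_on generalizing T with
  | _ n ih =>
    have hroot : ∀ U : Finset Plane, U ⊆ T → U.card < T.card → Rooted U := fun U hU hlt =>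
      ih U.card (hn ▸ hlt) (hT.mono hU) (h2.mono hU) rfl
    intro l l' s h h' hl hl' hs
    have hsT : s ∈ T := (h.mem s).1 (List.mem_of_head? hl)
    have hr : Rooted (T.erase s) :=
      hroot _ (Finset.erase_subset _ _) (Finset.card_erase_lt_of_mem hsT)
    by_cases hc : 3 ≤ T.card
    · obtain ⟨q, r, h₁, hq⟩ := reach_hull_head hT h2 hroot hc hs _ l h hl le_add_self
      obtain ⟨q', r', h₁', hq'⟩ := reach_hull_head hT h2 hroot hc hs _ l' h' hl' le_add_self
      refine h₁.trans (Reach.trans ?_ h₁'.symm)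
      have ht := (h₁.ph h).tail
      have ht' := (h₁'.ph h').tail
      have key : ∀ {q m m'}, HullEdge T s q → PH (T.erase s) m → PH (T.erase s) m' →
          m.head? = some q → m'.head? = some q → Reach T ([s] ++ m) ([s] ++ m') := by
        intro q m m' hq hm hm' hmq hmq'
        exact (hr m m' q hm hm' hmq hmq' (not_inner_of_ext hq.ext_erase)).lift
          fun n hn hnq => hq.cons hsT hn (hnq.trans hmq)
      by_cases hqq : q = q'
      · subst hqq
        exact key hq ht ht' rfl rfl
      -- To pass from the hull edge `sq` to `sq'`, let the remainder run from `q` to `q'` and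
      -- reverse it; both versions are plane because hull edges are never crossed.
      · obtain ⟨m, hm, hmq, hmq'⟩ := exists_path (hT.mono (Finset.erase_subset s T))
          ((ht.mem q).1 (by simp)) ((ht'.mem q').1 (by simp)) hqq hq.ext_erase
        have hrev : m.reverse.head? = some q' := by rw [List.head?_reverse, hmq']
        refine (key hq ht hm rfl hmq).trans (Reach.trans (Step.reach ?_)
          (key hq' hm.reverse ht' hrev rfl))
        exact ⟨hq.cons hsT hm hmq, hq'.cons hsT hm.reverse hrev, [s], m, by simp, rfl, rfl⟩
    · obtain ⟨m, rfl⟩ : ∃ m, l = s :: m := List.head?_eq_some_iff.1 hl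
      obtain ⟨m', rfl⟩ : ∃ m, l' = s :: m := List.head?_eq_some_iff.1 hl'
      have hm := h.tail
      have hm' := h'.tail
      have hlen := h.length
      have hlen' := h'.length
      have : m = m' := by
        match m, m', hm, hm', hlen, hlen' with
        | [], [], _, _, _, _ => rfl
        | [], x :: m', _, _, h₁, h₂ => simp at h₁ h₂; omega
        | x :: m, [], _, _, h₁, h₂ => simp at h₁ h₂; omega
        | [x], [y], hm, hm', _, _ =>
          have := (hm'.mem x).2 ((hm.mem x).1 (by simp))
          rw [List.mem_singleton.1 this]
        | x :: x' :: m, _, _, _, h₁, _ => simp at h₁; omega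
        | _, x :: x' :: m', _, _, _, h₂ => simp at h₂; omega
      rw [this]
      exact Reach.refl _ _

end PlanePaths

/-! ### Convex layers and the conclusion -/

namespace PlanePaths

open List

theorem mem_interior_Tri {σ : ℝ} {a b c z : Plane} (h : 0 < D σ a b c) (h₁ : 0 < D σ a b z)
    (h₂ : 0 < D σ b c z) (h₃ : 0 < D σ c a z) : z ∈ interior (Tri a b c) := by
  have hD : ∀ p q : Plane, Continuous fun x : Plane => D σ p q x := by
    intro p q
    unfold D
    fun_prop
  have ho : IsOpen {x : Plane | 0 < D σ a b x ∧ 0 < D σ b c x ∧ 0 < D σ c a x} :=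
    (isOpen_lt continuous_const (hD a b)).inter
      ((isOpen_lt continuous_const (hD b c)).inter (isOpen_lt continuous_const (hD c a)))
  exact interior_maximal (fun x hx => mem_Tri_of_D h hx.1.le hx.2.1.le hx.2.2.le) ho ⟨h₁, h₂, h₃⟩

/-- By Carathéodory the point lies in a simplex with at most three corners among the other points.
General position excludes fewer than three corners and the sides of the triangle, so the point is
interior. -/
theorem mem_interior_convexHull {T : Finset Plane} (hT : GP T) {A : Set Plane}
    (hA : A ⊆ T) {x : Plane} (hx : x ∈ A) (hxA : x ∈ convexHull ℝ (A \ {x})) :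
    x ∈ interior (convexHull ℝ A) := by
  rw [convexHull_eq_union] at hxA
  simp only [Set.mem_iUnion] at hxA
  obtain ⟨t, htA, hai, hxt⟩ := hxA
  have hcard : t.card ≤ 3 := by
    have h := hai.card_le_finrank_succ
    have h' := Submodule.finrank_le (vectorSpan ℝ (Set.range ((↑) : t → Plane)))
    rw [finrank_euclideanSpace_fin] at h'
    rw [Fintype.card_coe] at h
    omega
  have hxT : x ∈ T := hA hx
  have ht : ∀ y ∈ t, y ∈ T ∧ y ∈ A ∧ y ≠ x := fun y hy => ⟨hA (htA hy).1, (htA hy).1, (htA hy).2⟩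
  have hc : t.card = 0 ∨ t.card = 1 ∨ t.card = 2 ∨ t.card = 3 := by omega
  rcases hc with hc | hc | hc | hc
  · rw [Finset.card_eq_zero] at hc
    simp [hc] at hxt
  · obtain ⟨a, rfl⟩ := Finset.card_eq_one.1 hc
    simp only [Finset.coe_singleton, convexHull_singleton, Set.mem_singleton_iff] at hxt
    exact absurd hxt.symm (ht a (by simp)).2.2
  · obtain ⟨a, b, hab, rfl⟩ := Finset.card_eq_two.1 hc
    simp only [Finset.coe_pair, convexHull_pair] at hxt
    obtain ⟨ha, -, hax⟩ := ht a (by simp)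
    obtain ⟨hb, -, hbx⟩ := ht b (by simp)
    exact absurd (D_of_mem_segment hxt) (hT a ha b hb x hxT hab hbx hax)
  · obtain ⟨a, b, c, hab, hac, hbc, rfl⟩ := Finset.card_eq_three.1 hc
    obtain ⟨ha, haA, hax⟩ := ht a (by simp)
    obtain ⟨hb, hbA, hbx⟩ := ht b (by simp)
    obtain ⟨hcT, hcA, hcx⟩ := ht c (by simp)
    obtain ⟨σ, hσ, hpos⟩ := exists_sign (hT a ha b hb c hcT hab hbc hac)
    have hxt' : x ∈ Tri a b c := by simpa [Tri] using hxt
    obtain ⟨h₁, h₂, h₃⟩ := D_of_mem_Tri hpos.le hxt'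
    refine interior_mono (Tri_subset (convex_convexHull ℝ A) (subset_convexHull ℝ A haA)
      (subset_convexHull ℝ A hbA) (subset_convexHull ℝ A hcA)) (mem_interior_Tri hpos ?_ ?_ ?_)
    · exact lt_of_le_of_ne h₁ (hT.ne hσ ha hb hxT hab hbx hax).symm
    · exact lt_of_le_of_ne h₂ (hT.ne hσ hb hcT hxT hbc hcx hbx).symm
    · exact lt_of_le_of_ne h₃ (hT.ne hσ hcT ha hxT hac.symm hax hcx).symm

theorem mem_outer_iff {A : Set Plane} {x : Plane} (hx : x ∈ A) :
    x ∈ outer A ↔ x ∉ interior (convexHull ℝ A) := by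
  have : x ∈ closure (convexHull ℝ A) := subset_closure (subset_convexHull ℝ A hx)
  exact ⟨fun h => h.2.2, fun h => ⟨hx, this, h⟩⟩

/-- A point with the largest first coordinate is not interior, because the coordinate projection is
open. -/
theorem outer_nonempty {A : Set Plane} (hA : A.Finite) (hne : A.Nonempty) :
    (outer A).Nonempty := by
  obtain ⟨x, hx, hmax⟩ := Set.exists_max_image A (fun y => y 0) hA hne
  refine ⟨x, (mem_outer_iff hx).2 fun hi => ?_⟩
  have hsub : convexHull ℝ A ⊆ {y : Plane | y 0 ≤ x 0} := by
    refine convexHull_min hmax ?_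
    exact convex_halfSpace_le (f := fun y : Plane => y 0) ⟨by simp, by simp⟩ _
  have hsurj : Function.Surjective (EuclideanSpace.proj 0 : Plane →L[ℝ] ℝ) :=
    fun r => ⟨EuclideanSpace.single 0 r, by simp⟩
  have ho := (ContinuousLinearMap.isOpenMap _ hsurj) _ (isOpen_interior (s := convexHull ℝ A))
  have h₁ : _ ⊆ interior (Set.Iic (x 0)) := interior_maximal (by
    rintro _ ⟨y, hy, rfl⟩
    exact hsub (interior_subset hy)) ho
  have : x 0 ∈ interior (Set.Iic (x 0)) := h₁ ⟨x, hi, rfl⟩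
  simp at this

theorem remaining_subset (A : Set Plane) (i : ℕ) : remaining A i ⊆ A := by
  induction i with
  | zero => exact subset_rfl
  | succ i ih => exact Set.sdiff_subset.trans ih

/-- If anything were left after two layers, the layers 0, 1 and 2 would all be non-empty. -/
theorem remaining_two_eq_empty {A : Set Plane} (hA : A.Finite) (h : layerNumber A ≤ 2) :
    remaining A 2 = ∅ := by
  by_contra hne
  have h₂ := Set.nonempty_iff_ne_empty.2 hne
  have h₁ : (remaining A 1).Nonempty := h₂.mono Set.sdiff_subset
  have h₀ : (remaining A 0).Nonempty := h₁.mono Set.sdiff_subset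
  have hf : ∀ i, (remaining A i).Nonempty → (layer A i).Nonempty := fun i hi =>
    outer_nonempty (hA.subset (remaining_subset A i)) hi
  have hsub : ({0, 1, 2} : Set ℕ) ⊆ {i | (layer A i).Nonempty} := by
    rintro i (rfl | rfl | rfl)
    · exact hf _ h₀
    · exact hf _ h₁
    · exact hf _ h₂
  have h3 : ({0, 1, 2} : Set ℕ).encard = 3 :=
    Set.encard_eq_three.2 ⟨0, 1, 2, by simp, by simp, by simp, rfl⟩
  have := (Set.encard_le_encard hsub).trans h
  rw [h3] at this
  exact absurd this (by decide)

theorem not_inner_of_mem_outer {T : Finset Plane} (hT : GP T) {x : Plane}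
    (hx : x ∈ outer (T : Set Plane)) : ¬ Inner T x := fun hi =>
  (mem_outer_iff hx.1).1 hx (mem_interior_convexHull hT subset_rfl hx.1 hi.2)

/-- Inner points survive the removal of the first layer. Everything that survives it is outer in the
remainder, which by general position excludes lying in the hull of the other survivors. -/
theorem twoLayer {S : Finset Plane} (hS : GP S) (h : layerNumber (S : Set Plane) ≤ 2) :
    TwoLayer S := by
  have h2 := remaining_two_eq_empty S.finite_toSet h
  have hsub : ∀ y, Inner S y → y ∈ remaining (S : Set Plane) 1 := fun y hy =>
    ⟨hy.1, fun ho => not_inner_of_mem_outer hS ho hy⟩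
  intro x hx hx'
  have hx1 := hsub x hx
  have hout : x ∈ outer (remaining (S : Set Plane) 1) := by
    by_contra hcon
    have : x ∈ remaining (S : Set Plane) 2 := ⟨hx1, hcon⟩
    rw [h2] at this
    exact this
  refine (mem_outer_iff hx1).1 hout (mem_interior_convexHull hS (remaining_subset _ 1) hx1 ?_)
  exact convexHull_mono (Set.sdiff_subset_sdiff_left hsub) hx'

variable {S : Finset Plane}

theorem Move.symm {l l' : List Plane} (h : Move S l l') : Move S l' l := by
  rcases h with h | ⟨h, rfl⟩
  · exact Or.inl h.symm
  · exact Or.inr ⟨h.reverse, by simp⟩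

theorem Reach.move {l l' : List Plane} (h : Reach S l l') : Relation.ReflTransGen (Move S) l l' :=
  Relation.ReflTransGen.mono (fun _ _ h => Or.inl h) _ _ h

/-- If both ends are inner, `inner_end` applies with the first point as the inner point before the
tail. Once the path has an extreme end, it may be read from there. -/
theorem exists_outer_head (hT : GP S) (h2 : TwoLayer S) (ho : ∃ x ∈ S, ¬ Inner S x)
    {l : List Plane} (h : PH S l) : ∃ l' s, Relation.ReflTransGen (Move S) l l' ∧ PH S l' ∧
      l'.head? = some s ∧ ¬ Inner S s := by
  have fin : ∀ {l k}, PH S l → l.getLast? = some k → ¬ Inner S k → ∃ l' s,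
      Relation.ReflTransGen (Move S) l l' ∧ PH S l' ∧ l'.head? = some s ∧ ¬ Inner S s :=
    fun {l k} h hk hko => ⟨l.reverse, k, Relation.ReflTransGen.single (Or.inr ⟨h, rfl⟩), h.reverse,
      by rw [List.head?_reverse, hk], hko⟩
  obtain ⟨x, hx, hxo⟩ := ho
  obtain ⟨R, k, L, rfl, hk, hL⟩ := exists_last_outer S ⟨x, (h.mem x).2 hx, hxo⟩
  by_cases hL0 : L = []
  · subst hL0
    exact fin h List.getLast?_concat hk
  cases R with
  | nil => exact ⟨_, k, Relation.ReflTransGen.refl, h, rfl, hk⟩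
  | cons a R =>
    by_cases ha : Inner S a
    · have e : a :: R ++ k :: L = (a :: R ++ [k]) ++ L := by simp
      rw [e] at h ⊢
      obtain ⟨l', t, hr, ht, hto, -⟩ := inner_end hT h2 (fun U hU _ => rooted (hT.mono hU)
        (h2.mono hU)) _ (a :: R ++ [k]) L k List.getLast?_concat ⟨a, by simp, ha⟩ hL0 le_rfl hk hL h
      obtain ⟨l'', s, h₁, h₂, h₃, h₄⟩ := fin (hr.ph h) ht hto
      exact ⟨l'', s, hr.move.trans h₁, h₂, h₃, h₄⟩
    · exact ⟨_, a, Relation.ReflTransGen.refl, h, rfl, ha⟩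

/-- A path from `s` to `s'` read forwards is reached from any path starting in `s`, and read
backwards from any path starting in `s'`. -/
theorem moves_connected (hT : GP S) (h2 : TwoLayer S) (ho : ∃ x ∈ S, ¬ Inner S x)
    {l l' : List Plane} (h : PH S l) (h' : PH S l') : Relation.ReflTransGen (Move S) l l' := by
  obtain ⟨m, s, h₁, hm, hs, hso⟩ := exists_outer_head hT h2 ho h
  obtain ⟨m', s', h₁', hm', hs', hso'⟩ := exists_outer_head hT h2 ho h'
  have h₂ : Relation.ReflTransGen (Move S) m' l' :=
    (@Relation.ReflTransGen.stdSymm _ _ ⟨fun _ _ h => Move.symm h⟩).symm _ _ h₁'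
  refine h₁.trans (Relation.ReflTransGen.trans ?_ h₂)
  have hr := rooted hT h2
  by_cases hss : s = s'
  · subst hss
    exact (hr m m' s hm hm' hs hs' hso).move
  · have hsS := (hm.mem s).1 (List.mem_of_head? hs)
    obtain ⟨p, hp, hps, hps'⟩ := exists_path hT hsS ((hm'.mem s').1 (List.mem_of_head? hs')) hss
      (ext_of_not_inner hsS hso)
    refine (hr m p s hm hp hs hps hso).move.trans (Relation.ReflTransGen.head
      (Or.inr ⟨hp, rfl⟩) ?_)
    exact (hr _ m' s' hp.reverse hm' (by rw [List.head?_reverse, hps']) hs' hso').move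

theorem connected_of_layerNumber_le_two (hS : GeneralPosition S)
    (hL : layerNumber (S : Set Plane) ≤ 2) : (flipGraph S).Connected := by
  have hT := hS.gp
  have h2 := twoLayer hT hL
  rcases S.eq_empty_or_nonempty with rfl | hne
  · refine flipGraph_connected hT ⟨[], by simp, by simp, by simpa using NC_empty⟩ fun l l' h h' => ?_
    have : ∀ l, PH ∅ l → l = [] := fun l h =>
      List.eq_nil_iff_forall_not_mem.2 fun x hx => by simpa using (h.mem x).1 hx
    rw [this l h, this l' h']
  · obtain ⟨a, ha⟩ := outer_nonempty S.finite_toSet (by simpa using hne)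
    have hao := not_inner_of_mem_outer hT ha
    have haS : a ∈ S := ha.1
    refine flipGraph_connected hT ?_ fun l l' h h' => moves_connected hT h2 ⟨a, haS, hao⟩ h h'
    by_cases hb : ∃ b ∈ S, a ≠ b
    · obtain ⟨b, hb, hab⟩ := hb
      obtain ⟨l, hl, -⟩ := exists_path hT haS hb hab (ext_of_not_inner haS hao)
      exact ⟨l, hl⟩
    · push Not at hb
      refine ⟨[a], by simp, fun x => ?_, by simpa using NC_empty⟩
      rw [List.mem_singleton]
      exact ⟨fun h => h ▸ haS, fun h => (hb x h).symm⟩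

end PlanePaths

theorem mainTheorem4 (S : Finset PlanePaths.Plane) (hS : PlanePaths.GeneralPosition S)
    (hL : PlanePaths.layerNumber (S : Set PlanePaths.Plane) ≤ 2) :
    (PlanePaths.flipGraph S).Connected := by
  exact PlanePaths.connected_of_layerNumber_le_two hS hL
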